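/- **Setting.** For $n\in\mathbb N$ let $L=L_n\ge 1$ be an integer and $\lambda=\lambda_n\ge 0$. Let $\boldsymbol x=(e^{i\varphi_1},\dots,e^{i\varphi_n})$ with $\varphi_1,\dots,\varphi_n$ i.i.d. uniform on $[0,2\pi)$, and let $\boldsymbol W_1,\dots,\boldsymbol W_L$ be independent $n\times n$ GUE matrices, independent of $\boldsymbol x$ (Hermitian, with independent entries on and above the diagonal, $\mathcal N(0,1)$ on the diagonal and standard complex Gaussian above it). In multi-frequency angular synchronization one observes $\boldsymbol Y=(\boldsymbol Y_1,\dots,\boldsymbol Y_L)$, $$\boldsymbol Y_\ell=\Theta_\ell+\boldsymbol W_\ell,\qquad \Theta_\ell=\frac{\lambda}{\sqrt n}\,\boldsymbol x^{(\ell)}\big(\boldsymbol x^{(\ell)}\big)^*,$$ where $\boldsymbol x^{(\ell)}$ is the entrywise $\ell$-th power. Let $\mathbb P_{\lambda,L,n}$ be the law of $\boldsymbol Y$ and $\mathbb Q_{L,n}$ the law of $(\boldsymbol W_1,\dots,\boldsymbol W_L)$. For $\ell=\ell_n\in\{1,\dots,L_n\}$, an estimator $\mathcal X=\mathcal X(\boldsymbol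 Y)\in\mathbb C^{n\times n}$ achieves weak recovery at frequency $\ell$ if there is a constant $c>0$ with $$\mathbb E\left[\frac{\operatorname{Re}\langle\mathcal X,\Theta_\ell\rangle}{\|\mathcal X\|_{\mathrm F}\,\|\Theta_\ell\|_{\mathrm F}}\right]\ge c\quad\text{for all large } n$$ (the quotient is $0$ when its denominator is $0$). *Algorithms* are uniform randomized programs over exact real numbers (finite programs with real constants working on binary trees with real leaves; each pairing or unpairing, each operation $+,-,\times,\div,\sqrt{\cdot}$, each sign test and each draw of a standard Gaussian costs one step). The model parameters are part of the input: $n,L_n,\lambda_n,\ell$ for recovery, and $n,L_n,\lambda_n,M_n$ for the tests below. A running time is a worst-case bound over the observation, the random draws and, for recovery, over all $\ell\in\{1,\dots,L_n\}$. *Hidden-sample problem.* Given $M=M_n\ge1$ samples in the observation space, let $\overline{\mathbb Q}$ be the law of $M$ independent samples from $\mathbb Q_{L,n}$, and let $\overline{\mathbb P}_\lambda$ be the law obtained by choosing $\kappa\in\{1,\dots,M\}$ uniformly and drawing all samples independently, the $\kappa$-th from $\mathbb P_{\lambda,L,n}$ and the others from $\mathbb Q_{L,n}$. Its dimension is $N=M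 L n^2$. Put $$\mathsf{Adv}_{\le D}(\overline{\mathbb P};\overline{\mathbb Q})=\sup_{f}\ \mathbb E_{\overline{\mathbb P}}[f]\big/\sqrt{\mathbb E_{\overline{\mathbb Q}}[f^2]},$$ the supremum over real polynomials $f$ of degree at most $D$ in the real and imaginary parts of the entries. *Low-degree heuristic (for $L=(L_n)$, along an infinite set $S\subseteq\mathbb N$).* For all $\lambda'_n\in[0,1)$ bounded away from $1$, all integers $M_n\ge1$ and $D_n\ge0$: if $\mathsf{Adv}_{\le D_n}(\overline{\mathbb P}_{\lambda'_n};\overline{\mathbb Q})=1+o(1)$ as $n\to\infty$ in $S$, then there is a constant $C>0$ such that no algorithm $\mathcal A$ with running time at most $N^{D_n/(C\log N)}$ achieves weak detection, i.e. $\overline{\mathbb Q}(\mathcal A=1)+\overline{\mathbb P}_{\lambda'_n}(\mathcal A=0)\le1-\eta$ for some constant $\eta>0$ and all large $n\in S$. **Theorem.** There is a constant $\varepsilon>0$ such that the following holds. Suppose that $L_n=n^{o(1)}$ and that $0\le\lambda_n<1-\delta$ for all $n$, for some constant $\delta>0$, and let $\ell_n\in\{1,\dots,L_n\}$. (a) Assume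 the low-degree heuristic along $S=\mathbb N$. Then any algorithm that achieves weak recovery at frequency $\ell_n$ and has running time $T(n)$ satisfies $T(n)>\exp(n^{\varepsilon})$ for infinitely many $n$; that is, no algorithm with running time at most $\exp(n^{\varepsilon})$ achieves weak recovery. (b) Assume the low-degree heuristic along every infinite set $S\subseteq\mathbb N$. Then any such algorithm satisfies $T(n)>\exp(n^{\varepsilon})$ for all sufficiently large $n$. -/

import Mathlib

open MeasureTheory ProbabilityTheory Filter Topology

noncomputable section

namespace AngularSync

/-! ## Randomized algorithms over the reals, with a step count

A uniform real-number machine with pointers: data are binary trees whose leaves carry exact real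
numbers, a program is a finite object that may contain real constants, and every elementary
operation (building or taking apart a pair, `+ - * / √` on reals, a sign test, drawing a standard
Gaussian) costs one unit of time. There is no rounding operation. -/

/-- Data of the machine: binary trees with real leaves. -/
inductive Data : Type
  | nil : Data
  | num (r : ℝ) : Data
  | pair (a b : Data) : Data

/-- Elementary operations. -/
inductive Prim : Type
  | id | nil | const (r : ℝ) | fst | snd | isPair | add | sub | mul | div | sqrt

/-- Effect of an elementary operation; an operation applied to data of the wrong shape gives
`nil`. -/
def Prim.eval : Prim → Data → Data
  | .id, v => v
  | .nil, _ => .nil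
  | .const r, _ => .num r
  | .fst, .pair a _ => a
  | .snd, .pair _ b => b
  | .isPair, .pair _ _ => .num 1
  | .isPair, _ => .num 0
  | .add, .pair (.num a) (.num b) => .num (a + b)
  | .sub, .pair (.num a) (.num b) => .num (a - b)
  | .mul, .pair (.num a) (.num b) => .num (a * b)
  | .div, .pair (.num a) (.num b) => .num (a / b)
  | .sqrt, .num a => .num (Real.sqrt a)
  | _, _ => .nil

/-- Programs: each one maps data to data. `seq f g` runs `f`, then `g` on its result;
`ite c f g` and `loop c f` (while `c` do `f`) test whether the result of `c` is a positive
number; `gauss` draws a standard Gaussian. -/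
inductive Prog : Type
  | prim (o : Prim) : Prog
  | gauss : Prog
  | pair (f g : Prog) : Prog
  | seq (f g : Prog) : Prog
  | ite (c f g : Prog) : Prog
  | loop (c f : Prog) : Prog

/-- The outcome of a test is positive. -/
def Data.Pos : Data → Prop
  | .num r => 0 < r
  | _ => False

/-- A random tape; its entries will be independent standard Gaussians. -/
abbrev Tape : Type := ℕ → ℝ

/-- The two halves of a tape. Consecutive parts of a computation work on disjoint parts of the
tape, so that no entry is ever used by two executions of `gauss`. -/
def Tape.left (τ : Tape) : Tape := fun k => τ (2 * k)

/-- See `Tape.left`. -/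
def Tape.right (τ : Tape) : Tape := fun k => τ (2 * k + 1)

/-- `Eval p τ v w t`: on input `v` and random tape `τ` the program `p` halts with output `w`
after `t` steps. -/
inductive Eval : Prog → Tape → Data → Data → ℕ → Prop
  | prim (o : Prim) (τ : Tape) (v : Data) : Eval (.prim o) τ v (o.eval v) 1
  | gauss (τ : Tape) (v : Data) : Eval .gauss τ v (.num (τ 0)) 1
  | pair {f g : Prog} {τ : Tape} {v a b : Data} {s t : ℕ} :
      Eval f τ.left v a s → Eval g τ.right v b t →
      Eval (.pair f g) τ v (.pair a b) (s + t + 1)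
  | seq {f g : Prog} {τ : Tape} {v a b : Data} {s t : ℕ} :
      Eval f τ.left v a s → Eval g τ.right a b t →
      Eval (.seq f g) τ v b (s + t + 1)
  | ite_pos {c f g : Prog} {τ : Tape} {v d a : Data} {s t : ℕ} :
      Eval c τ.left v d s → d.Pos → Eval f τ.right v a t →
      Eval (.ite c f g) τ v a (s + t + 1)
  | ite_neg {c f g : Prog} {τ : Tape} {v d a : Data} {s t : ℕ} :
      Eval c τ.left v d s → ¬ d.Pos → Eval g τ.right v a t →
      Eval (.ite c f g) τ v a (s + t + 1)
  | loop_done {c f : Prog} {τ : Tape} {v d : Data} {s : ℕ} :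
      Eval c τ.left v d s → ¬ d.Pos → Eval (.loop c f) τ v v (s + 1)
  | loop_step {c f : Prog} {τ : Tape} {v d a b : Data} {s t u : ℕ} :
      Eval c τ.left v d s → d.Pos → Eval f τ.right.left v a t →
      Eval (.loop c f) τ.right.right a b u →
      Eval (.loop c f) τ v b (s + t + u + 1)

/-- The output and the number of steps are determined by the program, the tape and the input. -/
theorem Eval.deterministic {p : Prog} {τ : Tape} {v w : Data} {t : ℕ} (h : Eval p τ v w t) :
    ∀ {w' : Data} {t' : ℕ}, Eval p τ v w' t' → w = w' ∧ t = t' := by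
  induction h with
  | prim => intro w' t' h'; cases h'; exact ⟨rfl, rfl⟩
  | gauss => intro w' t' h'; cases h'; exact ⟨rfl, rfl⟩
  | pair _ _ i1 i2 =>
    intro w' t' h'; cases h' with
    | pair a b => obtain ⟨rfl, rfl⟩ := i1 a; obtain ⟨rfl, rfl⟩ := i2 b; exact ⟨rfl, rfl⟩
  | seq _ _ i1 i2 =>
    intro w' t' h'; cases h' with
    | seq a b => obtain ⟨rfl, rfl⟩ := i1 a; obtain ⟨rfl, rfl⟩ := i2 b; exact ⟨rfl, rfl⟩
  | ite_pos _ hd _ i1 i2 =>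
    intro w' t' h'; cases h' with
    | ite_pos a _ b => obtain ⟨rfl, rfl⟩ := i1 a; obtain ⟨rfl, rfl⟩ := i2 b; exact ⟨rfl, rfl⟩
    | ite_neg a hn b => obtain ⟨rfl, rfl⟩ := i1 a; exact absurd hd hn
  | ite_neg _ hd _ i1 i2 =>
    intro w' t' h'; cases h' with
    | ite_neg a _ b => obtain ⟨rfl, rfl⟩ := i1 a; obtain ⟨rfl, rfl⟩ := i2 b; exact ⟨rfl, rfl⟩
    | ite_pos a hn b => obtain ⟨rfl, rfl⟩ := i1 a; exact absurd hn hd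
  | loop_done _ hd i1 =>
    intro w' t' h'; cases h' with
    | loop_done a _ => obtain ⟨rfl, rfl⟩ := i1 a; exact ⟨rfl, rfl⟩
    | loop_step a hn b c => obtain ⟨rfl, rfl⟩ := i1 a; exact absurd hn hd
  | loop_step _ hd _ _ i1 i2 i3 =>
    intro w' t' h'; cases h' with
    | loop_done a hn => obtain ⟨rfl, rfl⟩ := i1 a; exact absurd hd hn
    | loop_step a _ b c =>
      obtain ⟨rfl, rfl⟩ := i1 a; obtain ⟨rfl, rfl⟩ := i2 b; obtain ⟨rfl, rfl⟩ := i3 c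
      exact ⟨rfl, rfl⟩

/-- The law of the random tape: independent standard Gaussians. -/
def tapeLaw : Measure Tape := Measure.infinitePi fun _ => gaussianReal 0 1

/-! ## The multi-frequency angular synchronization model -/

/-- Complex `n × n` matrices (as functions, which carry a measurable structure). -/
abbrev CMat (n : ℕ) : Type := Fin n → Fin n → ℂ

/-- Observations: `L` complex matrices. The index `k : Fin L` stands for the frequency `k + 1`. -/
abbrev Obs (L n : ℕ) : Type := Fin L → CMat n

/-- The Hermitian matrix made from a real array: the diagonal is kept, and the entry above the
diagonal at `i < j` is `(g i j + √-1 g j i) / √2`. -/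
def hermitianOf {n : ℕ} (g : Fin n → Fin n → ℝ) : CMat n := fun i j =>
  if i = j then (g i i : ℂ)
  else if i < j then ((g i j : ℂ) + Complex.I * (g j i : ℂ)) / (Real.sqrt 2 : ℂ)
  else ((g j i : ℂ) - Complex.I * (g i j : ℂ)) / (Real.sqrt 2 : ℂ)

/-- The law of an array of independent standard Gaussians. -/
def gaussArrayLaw (L n : ℕ) : Measure (Fin L → Fin n → Fin n → ℝ) :=
  Measure.pi fun _ => Measure.pi fun _ => Measure.pi fun _ => gaussianReal 0 1

/-- The noise: `L` matrices `W_1, …, W_L` made from such an array; they are independent GUE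
matrices. -/
def noise {L n : ℕ} (g : Fin L → Fin n → Fin n → ℝ) : Obs L n := fun k => hermitianOf (g k)

/-- The null law: `L` independent GUE matrices. -/
def nullLaw (L n : ℕ) : Measure (Obs L n) := (gaussArrayLaw L n).map noise

/-- The law of `n` independent phases, uniform on `[0, 2π)`. -/
def phaseLaw (n : ℕ) : Measure (Fin n → ℝ) :=
  Measure.pi fun _ => volume[|Set.Ico (0 : ℝ) (2 * Real.pi)]

/-- The signal `Θ = (lam / √n) x^(k+1) (x^(k+1))^*`, where `x_i = exp(√-1 φ_i)` and `x^(k+1)` is the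
entrywise power. -/
def signal {L n : ℕ} (lam : ℝ) (φ : Fin n → ℝ) (k : Fin L) : CMat n := fun i j =>
  ((lam / Real.sqrt n : ℝ) : ℂ) *
    (Complex.exp (Complex.I * (φ i : ℂ)) ^ ((k : ℕ) + 1) *
      star (Complex.exp (Complex.I * (φ j : ℂ)) ^ ((k : ℕ) + 1)))

/-- The observation `Y = Θ + W`. -/
def observe {L n : ℕ} (lam : ℝ) (φ : Fin n → ℝ) (g : Fin L → Fin n → Fin n → ℝ) : Obs L n :=
  fun k i j => signal lam φ k i j + noise g k i j

/-- The planted law: the law of `(Y_1, …, Y_L)`. -/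
def plantedLaw (L n : ℕ) (lam : ℝ) : Measure (Obs L n) :=
  ((phaseLaw n).prod (gaussArrayLaw L n)).map fun ω => observe lam ω.1 ω.2

/-! ## Encoding of inputs and outputs -/

/-- A finite sequence as a list. -/
def encFin {m : ℕ} (f : Fin m → Data) : Data := (List.ofFn f).foldr Data.pair Data.nil

/-- A complex matrix as a list of rows, each a list of pairs (real part, imaginary part). -/
def encMat {n : ℕ} (A : CMat n) : Data :=
  encFin fun i => encFin fun j => Data.pair (.num (A i j).re) (.num (A i j).im)

/-- An observation as a list of matrices. -/
def encObs {L n : ℕ} (Y : Obs L n) : Data := encFin fun k => encMat (Y k)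

/-- Input of a recovery algorithm: the known parameters `n, L, lam`, the frequency to be recovered,
and the observation. -/
def recoveryInput {L n : ℕ} (lam : ℝ) (k : Fin L) (Y : Obs L n) : Data :=
  .pair (.num n) (.pair (.num L) (.pair (.num lam) (.pair (.num ((k : ℕ) + 1)) (encObs Y))))

/-- Input of a test for the hidden-sample problem: the known parameters `n, L, lam, M` and the
`M` samples. -/
def testInput {M L n : ℕ} (lam : ℝ) (Y : Fin M → Obs L n) : Data :=
  .pair (.num n) (.pair (.num L) (.pair (.num lam) (.pair (.num M) (encFin fun m => encObs (Y m)))))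

/-! ## Weak recovery -/

/-- Real part of the Frobenius inner product (the inner product itself if both matrices are
Hermitian). -/
def frobInner {n : ℕ} (A B : CMat n) : ℝ := (∑ i, ∑ j, A i j * star (B i j)).re

/-- Frobenius norm. -/
def frobNorm {n : ℕ} (A : CMat n) : ℝ := Real.sqrt (∑ i, ∑ j, ‖A i j‖ ^ 2)

/-- Normalized correlation (zero if one of the matrices is zero). -/
def correlation {n : ℕ} (A B : CMat n) : ℝ := frobInner A B / (frobNorm A * frobNorm B)

/-- The expected correlation of a randomized estimator `X` of `Θ_{k+1}` with `Θ_{k+1}`. -/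
def expectedCorrelation {L n : ℕ} (lam : ℝ) (k : Fin L) (X : Obs L n → Tape → CMat n) : ℝ :=
  ∫ ω, correlation (X (observe lam ω.1.1 ω.1.2) ω.2) (signal lam ω.1.1 k)
    ∂(((phaseLaw n).prod (gaussArrayLaw L n)).prod tapeLaw)

/-- As `n → ∞` along the filter `F`, the program `p` runs in time `T n` (for every frequency,
observation and random tape), and it achieves weak recovery of the signal at frequency
`ℓ n + 1`: for some constant `c > 0` the expected correlation is at least `c`. -/
def WeaklyRecovers (F : Filter ℕ) (L : ℕ → ℕ) (lam : ℕ → ℝ) (ℓ : ∀ n, Fin (L n))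
    (p : Prog) (T : ℕ → ℕ) : Prop :=
  ∃ X : ∀ n, Fin (L n) → Obs (L n) n → Tape → CMat n,
    (∀ n k, Measurable fun z : Obs (L n) n × Tape => X n k z.1 z.2) ∧
    (∀ᶠ n in F, ∀ k Y τ, ∃ t ≤ T n,
      Eval p τ (recoveryInput (lam n) k Y) (encMat (X n k Y τ)) t) ∧
    ∃ c : ℝ, 0 < c ∧ ∀ᶠ n in F, c ≤ expectedCorrelation (lam n) (ℓ n) (X n (ℓ n))

/-! ## Low-degree advantage, the hidden-sample problem, and the low-degree heuristic -/

/-- The low-degree advantage: the supremum of `E_P[f] / √(E_Q[f ^ 2])` over real polynomials `f` of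
degree at most `D` in the real coordinates `coord` of the sample. -/
def lowDegAdv {Ω σ : Type} [MeasurableSpace Ω] (coord : Ω → σ → ℝ) (P Q : Measure Ω) (D : ℕ) :
    EReal :=
  ⨆ f : {f : MvPolynomial σ ℝ // f.totalDegree ≤ D},
    (((∫ y, MvPolynomial.eval (coord y) f.1 ∂P) /
      Real.sqrt (∫ y, (MvPolynomial.eval (coord y) f.1) ^ 2 ∂Q) : ℝ) : EReal)

/-- Real and imaginary parts of all entries of `M` observations. -/
def hiddenCoord {M L n : ℕ} (Y : Fin M → Obs L n) : Fin M × Fin L × Fin n × Fin n × Bool → ℝ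
  | (m, k, i, j, true) => (Y m k i j).re
  | (m, k, i, j, false) => (Y m k i j).im

/-- Null law of the hidden-sample problem: `M` independent samples from the null law. -/
def hiddenNull (M L n : ℕ) : Measure (Fin M → Obs L n) := Measure.pi fun _ => nullLaw L n

/-- Planted law of the hidden-sample problem: a uniformly random one of `M` independent samples is
drawn from the planted law, the others are drawn from the null law. -/
def hiddenPlanted (M L n : ℕ) (lam : ℝ) : Measure (Fin M → Obs L n) :=
  (M : ENNReal)⁻¹ • ∑ κ : Fin M,
    Measure.pi fun m => if m = κ then plantedLaw L n lam else nullLaw L n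

/-- The real dimension of `M` observations, each made of `L` Hermitian `n × n` matrices. -/
def hiddenDim (M L n : ℕ) : ℝ := M * (L * n ^ 2)

/-- Sum of the two error probabilities of a randomized test (`true` means: planted). -/
def testError {Ω : Type} [MeasurableSpace Ω] (P Q : Measure Ω) (A : Ω → Tape → Bool) : ℝ :=
  (Q.prod tapeLaw).real {z | A z.1 z.2 = true} + (P.prod tapeLaw).real {z | A z.1 z.2 = false}

/-- As `n → ∞` along `F`, some algorithm with running time at most `T n` achieves weak detection in
the hidden-sample problem with `M n` samples: the sum of its error probabilities is at most
`1 - η` for some constant `η > 0`. -/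
def WeakDetectionInTime (F : Filter ℕ) (L : ℕ → ℕ) (lam : ℕ → ℝ) (M : ℕ → ℕ) (T : ℕ → ℝ) : Prop :=
  ∃ (p : Prog) (A : ∀ n, (Fin (M n) → Obs (L n) n) → Tape → Bool),
    (∀ n, Measurable fun z : (Fin (M n) → Obs (L n) n) × Tape => A n z.1 z.2) ∧
    (∀ᶠ n in F, ∀ Y τ, ∃ t : ℕ, (t : ℝ) ≤ T n ∧
      Eval p τ (testInput (lam n) Y) (.num (if A n Y τ = true then 1 else 0)) t) ∧
    ∃ η : ℝ, 0 < η ∧ ∀ᶠ n in F,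
      testError (hiddenPlanted (M n) (L n) n (lam n)) (hiddenNull (M n) (L n) n) (A n) ≤ 1 - η

/-- The low-degree heuristic for the hidden-sample problems of the synchronization model with
`L n` frequencies and signal strength bounded away from (and below) one, as `n → ∞` along `F`: if the
advantage of polynomials of degree at most `D n` is `1 + o(1)`, then for some constant `C` no
algorithm with running time `N ^ (D / (C log N))` achieves weak detection, where `N` is the dimension
of the problem. -/
def LowDegreeHeuristic (F : Filter ℕ) (L : ℕ → ℕ) : Prop :=
  ∀ (lam : ℕ → ℝ) (M D : ℕ → ℕ),
    (∃ δ : ℝ, 0 < δ ∧ ∀ n, 0 ≤ lam n ∧ lam n < 1 - δ) → (∀ n, 1 ≤ M n) →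
    Tendsto (fun n => lowDegAdv hiddenCoord (hiddenPlanted (M n) (L n) n (lam n))
      (hiddenNull (M n) (L n) n) (D n)) F (𝓝 1) →
    ∃ C : ℝ, 0 < C ∧ ¬ WeakDetectionInTime F L lam M
      (fun n => hiddenDim (M n) (L n) n ^
        ((D n : ℝ) / (C * Real.log (hiddenDim (M n) (L n) n))))

end AngularSync

end

noncomputable section

namespace AngularSync

/-! A recovery algorithm at strength `λ < 1 - δ` is turned into a test for the hidden-sample problem
at the slightly larger strength `λ + d`, `d = δ / 2`, and the low-degree heuristic rules out such a
test.

Reduction. One sample `Y₀` serves as a reference. For every other sample `Y` put `U = a Y + b Y₀`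
and `V = b Y - a Y₀` with `a = λ / (λ + d)` and `a² + b² = 1`. The rotation keeps the two noise
parts independent GUE families. If `Y` is planted and `Y₀` is null, then `U` has exactly the planted
law at strength `λ`, and `V` is fresh noise plus the same signal at strength `b (λ + d) ≥ d`. The
estimate `X` computed from `U` is compared with `V` at every frequency, and the test answers
"planted" if `⟨X, V_k⟩ > r √n ‖X‖` occurs somewhere, with `r = c d / 4`. Under the null law `V` is
independent of `X`, so each comparison succeeds with probability at most `exp (-r² n / 2)`, and a
union bound over a huge number of samples is affordable. Under the planted law, expected correlation
at least `c` gives correlation at least `c / 2` with probability at least `c / 2`, and then the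
signal in `V` contributes at least `2 r √n ‖X‖`. The errors add up to at most `1 - c / 2 + o(1)`
(`testError_hitTest_le`); the running time is counted in `eval_testProg`.

Low-degree bound. A Hermite expansion bounds the squared advantage by the mean of a truncated
exponential series in the inner product of two independent shifts (`sq_integral_eval_add_le`). Two
hidden positions coincide with probability `1 / M` only, which leaves `1 + M⁻¹ ∑ λ^(2d) / d!
E[overlap^d]`. The overlap is the squared length of a vector in `ℝ^(2L)` that is a normalized sum of
`n` independent bounded terms; pairing it with a Gaussian vector gives moments of size about `d!
s^(-d) (1 - s)^(-L)` as long as `d L ≪ n` (`integral_phaseOverlap_pow_le`). For `λ² < s < 1` the sum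
is at most a polynomial in `D` times `exp (O(L))`, and the factor `M⁻¹` makes it vanish
(`tendsto_lowDegAdv`).

Scales. With `y = n^(1/8)` one has `L ≤ y` and `T ≤ exp y`, and chooses `M ≈ exp (y²)` and `D ≈ y⁴`.
The requirements are `L ≪ log M`, `log M + log T ≪ D`, `D L ≪ n` and `log M ≪ n = y⁸`. The time
allowed by the heuristic is `N^(D / (C log N)) = exp (D / C)`. -/

/-! ### Gaussian integrals of polynomials in one variable. -/

open Polynomial in
theorem integrable_eval_gaussianReal (p : ℝ[X]) :
    Integrable (fun x => p.eval x) (gaussianReal 0 1) := by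
  simp_rw [Polynomial.eval_eq_sum_range]
  refine integrable_finsetSum _ fun k _ => Integrable.const_mul ?_ _
  have h := (memLp_id_gaussianReal (μ := 0) (v := 1) (k : NNReal)).integrable_norm_pow'
  refine (integrable_norm_iff (by fun_prop)).1 ?_
  simpa [norm_pow] using h

theorem integral_gaussianReal_eq (f : ℝ → ℝ) :
    ∫ x, f x ∂(gaussianReal 0 1) = ∫ x, gaussianPDFReal 0 1 x * f x := by
  rw [integral_gaussianReal_eq_integral_smul one_ne_zero]
  rfl

theorem integrable_gaussianReal_iff (f : ℝ → ℝ) :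
    Integrable f (gaussianReal 0 1) ↔ Integrable (fun x => gaussianPDFReal 0 1 x * f x) := by
  rw [gaussianReal_of_var_ne_zero 0 one_ne_zero]
  rw [integrable_withDensity_iff_integrable_smul' (measurable_gaussianPDF 0 1)
    (ae_of_all _ fun x => gaussianPDF_lt_top)]
  simp only [toReal_gaussianPDF, smul_eq_mul]

open Polynomial in
/-- Gaussian integration by parts. -/
theorem integral_mul_eval_gaussianReal (p : ℝ[X]) :
    ∫ x, x * p.eval x ∂(gaussianReal 0 1) = ∫ x, (derivative p).eval x ∂(gaussianReal 0 1) := by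
  have i1 := (integrable_gaussianReal_iff _).1 (integrable_eval_gaussianReal p)
  have i2 := (integrable_gaussianReal_iff _).1 (integrable_eval_gaussianReal (derivative p))
  have i3 := (integrable_gaussianReal_iff _).1 (integrable_eval_gaussianReal (X * p))
  have hd : ∀ x : ℝ, HasDerivAt (gaussianPDFReal 0 1) (-x * gaussianPDFReal 0 1 x) x := by
    intro x
    rw [gaussianPDFReal_def]
    have h : HasDerivAt (fun x : ℝ => -(x - 0) ^ 2 / (2 * ((1 : NNReal) : ℝ))) (-x) x := by
      refine (((((hasDerivAt_id x).sub_const 0).pow 2).neg).div_const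
        (2 * ((1 : NNReal) : ℝ))).congr_deriv ?_
      simp; ring
    exact ((h.exp).const_mul ((√(2 * Real.pi * ((1 : NNReal) : ℝ)))⁻¹)).congr_deriv (by ring)
  -- The derivative of density times `p` integrates to zero; since the density `ρ` satisfies `ρ' =
  -- -x ρ`, this is the claim.
  have key := integral_eq_zero_of_hasDerivAt_of_integrable
    (f := fun x => gaussianPDFReal 0 1 x * p.eval x)
    (f' := fun x => gaussianPDFReal 0 1 x * (derivative p).eval x
      - gaussianPDFReal 0 1 x * (X * p).eval x)
    (fun x => by
      refine ((hd x).mul (p.hasDerivAt x)).congr_deriv ?_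
      rw [eval_mul, eval_X]; ring) (i2.sub i3) i1
  rw [integral_sub i2 i3] at key
  rw [integral_gaussianReal_eq, integral_gaussianReal_eq]
  simp only [eval_mul, eval_X] at key
  linarith

/-! ### Hermite polynomials -/

open Polynomial in
theorem derivative_hermite_succ (n : ℕ) :
    derivative (hermite (n + 1)) = ((n + 1 : ℕ) : ℤ[X]) * hermite n := by
  induction n with
  | zero => simp [hermite_succ]
  | succ n ih =>
    have h := hermite_succ n
    rw [hermite_succ (n + 1), derivative_sub, derivative_mul, derivative_X, ih, derivative_mul,
      derivative_natCast, h]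
    push_cast
    ring

/-- The Hermite polynomials with real coefficients. -/
def hermiteReal (k : ℕ) : Polynomial ℝ := (Polynomial.hermite k).map (Int.castRingHom ℝ)

@[simp] theorem hermiteReal_zero : hermiteReal 0 = 1 := by simp [hermiteReal]

open Polynomial in
theorem hermiteReal_succ (n : ℕ) :
    hermiteReal (n + 1) = X * hermiteReal n - derivative (hermiteReal n) := by
  simp [hermiteReal, hermite_succ, Polynomial.derivative_map]

open Polynomial in
theorem derivative_hermiteReal_succ (n : ℕ) :
    derivative (hermiteReal (n + 1)) = ((n + 1 : ℕ) : ℝ[X]) * hermiteReal n := by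
  rw [hermiteReal, Polynomial.derivative_map, derivative_hermite_succ]
  simp [hermiteReal]

open Polynomial in
-- The operator `p ↦ X p - p'` that raises the Hermite index is the adjoint of differentiation in
-- Gaussian `L²`. Orthogonality follows by iterating this.
theorem integral_hermiteReal_succ_mul (n : ℕ) (q : ℝ[X]) :
    ∫ x, (hermiteReal (n + 1) * q).eval x ∂(gaussianReal 0 1) =
      ∫ x, (hermiteReal n * derivative q).eval x ∂(gaussianReal 0 1) := by
  have h := integral_mul_eval_gaussianReal (hermiteReal n * q)
  have e1 : ∀ x : ℝ, (hermiteReal (n + 1) * q).eval x =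
      x * (hermiteReal n * q).eval x - (derivative (hermiteReal n) * q).eval x := by
    intro x; rw [hermiteReal_succ]; simp; ring
  have e2 : ∀ x : ℝ, (derivative (hermiteReal n * q)).eval x =
      (derivative (hermiteReal n) * q).eval x + (hermiteReal n * derivative q).eval x := by
    intro x; simp
  have i1 : Integrable (fun x => x * (hermiteReal n * q).eval x) (gaussianReal 0 1) := by
    refine (integrable_eval_gaussianReal (X * (hermiteReal n * q))).congr (ae_of_all _ fun x => ?_)
    simp only [eval_mul, eval_X]
  simp_rw [e2] at h
  simp_rw [e1]
  rw [integral_sub i1 (integrable_eval_gaussianReal _), h,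
    integral_add (integrable_eval_gaussianReal _) (integrable_eval_gaussianReal _)]
  ring

open Polynomial in
theorem integral_hermiteReal_mul (n m : ℕ) :
    ∫ x, (hermiteReal n * hermiteReal m).eval x ∂(gaussianReal 0 1) =
      if n = m then (n.factorial : ℝ) else 0 := by
  induction n generalizing m with
  | zero =>
    cases m with
    | zero => simp
    | succ m =>
      have := integral_hermiteReal_succ_mul m 1
      simpa using this
  | succ n ih =>
    rw [integral_hermiteReal_succ_mul]
    cases m with
    | zero => simp
    | succ m =>
      rw [derivative_hermiteReal_succ]
      have : ∀ x : ℝ, (hermiteReal n * (((m + 1 : ℕ) : ℝ[X]) * hermiteReal m)).eval x =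
          (m + 1 : ℝ) * (hermiteReal n * hermiteReal m).eval x := by
        intro x; simp; ring
      simp_rw [this]
      rw [integral_const_mul, ih]
      by_cases h : n = m
      · subst h; simp [Nat.factorial_succ]
      · simp [h]

open Polynomial in
-- With `q` the shift of the `n`-th polynomial, the next one shifted is `(x + m) q - q'`.
-- Integration by parts cancels `x q` against `q'`, so each step contributes one factor `m`. This is
-- why Hermite coefficients of a shifted Gaussian are moments of the shift.
theorem integral_hermiteReal_add (n : ℕ) (m : ℝ) :
    ∫ x, (hermiteReal n).eval (x + m) ∂(gaussianReal 0 1) = m ^ n := by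
  induction n with
  | zero => simp
  | succ n ih =>
    have h := integral_mul_eval_gaussianReal ((hermiteReal n).comp (X + C m))
    have e1 : ∀ x : ℝ, (hermiteReal (n + 1)).eval (x + m) =
        x * ((hermiteReal n).comp (X + C m)).eval x + m * ((hermiteReal n).comp (X + C m)).eval x
          - (derivative ((hermiteReal n).comp (X + C m))).eval x := by
      intro x; rw [hermiteReal_succ]; simp [derivative_comp]; ring
    have i1 : Integrable (fun x => x * ((hermiteReal n).comp (X + C m)).eval x)
        (gaussianReal 0 1) := by
      refine (integrable_eval_gaussianReal (X * ((hermiteReal n).comp (X + C m)))).congr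
        (ae_of_all _ fun x => ?_)
      simp only [eval_mul, eval_X]
    have i2 := (integrable_eval_gaussianReal ((hermiteReal n).comp (X + C m))).const_mul m
    have i3 : Integrable (fun x => x * ((hermiteReal n).comp (X + C m)).eval x +
      m * ((hermiteReal n).comp (X + C m)).eval x) (gaussianReal 0 1) := i1.add i2
    simp_rw [e1]
    rw [integral_sub i3 (integrable_eval_gaussianReal _), integral_add i1 i2, h,
      integral_const_mul]
    simp only [eval_comp, eval_add, eval_X, eval_C, ih]
    ring

open Polynomial in
-- Three-term recurrence; for `k = 0` the truncated index `k - 1` is harmless because of the factor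
-- `k`.
theorem mul_eval_hermiteReal (k : ℕ) (x : ℝ) :
    x * (hermiteReal k).eval x =
      (hermiteReal (k + 1)).eval x + k * (hermiteReal (k - 1)).eval x := by
  cases k with
  | zero => simp [hermiteReal_succ]
  | succ k =>
    rw [hermiteReal_succ (k + 1), derivative_hermiteReal_succ]
    simp

/-! ### Several variables -/

/-- The standard Gaussian measure on `ι → ℝ`. -/
def stdGauss (ι : Type*) [Fintype ι] : Measure (ι → ℝ) := Measure.pi fun _ => gaussianReal 0 1

instance (ι : Type*) [Fintype ι] : IsProbabilityMeasure (stdGauss ι) := by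
  unfold stdGauss; infer_instance

section MultiHermite

variable {ι : Type*} [Fintype ι]

/-- Products of Hermite polynomials. -/
def multiHermite (α : ι → ℕ) (g : ι → ℝ) : ℝ := ∏ i, (hermiteReal (α i)).eval (g i)

theorem integrable_multiHermite_mul (α β : ι → ℕ) :
    Integrable (fun g => multiHermite α g * multiHermite β g) (stdGauss ι) := by
  simp only [multiHermite, ← Finset.prod_mul_distrib, stdGauss]
  refine Integrable.fintype_prod
    (f := fun i x => (hermiteReal (α i)).eval x * (hermiteReal (β i)).eval x) fun i => ?_
  simpa using integrable_eval_gaussianReal (hermiteReal (α i) * hermiteReal (β i))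

theorem integral_multiHermite_mul [DecidableEq ι] (α β : ι → ℕ) :
    ∫ g, multiHermite α g * multiHermite β g ∂(stdGauss ι) =
      if α = β then ∏ i, ((α i).factorial : ℝ) else 0 := by
  simp only [multiHermite, ← Finset.prod_mul_distrib, stdGauss]
  rw [integral_fintype_prod_eq_prod
    (f := fun i x => (hermiteReal (α i)).eval x * (hermiteReal (β i)).eval x)]
  have := fun i => integral_hermiteReal_mul (α i) (β i)
  simp only [Polynomial.eval_mul] at this
  simp only [this]
  split_ifs with h
  · subst h; simp
  · obtain ⟨i, hi⟩ := Function.ne_iff.1 h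
    exact Finset.prod_eq_zero (Finset.mem_univ i) (by simp [hi])

theorem integral_multiHermite_add (α : ι → ℕ) (m : ι → ℝ) :
    ∫ g, multiHermite α (g + m) ∂(stdGauss ι) = ∏ i, m i ^ α i := by
  simp only [multiHermite, stdGauss, Pi.add_apply]
  rw [integral_fintype_prod_eq_prod (f := fun i x => (hermiteReal (α i)).eval (x + m i))]
  simp only [integral_hermiteReal_add]

theorem mul_multiHermite [DecidableEq ι] (α : ι → ℕ) (i : ι) (g : ι → ℝ) :
    g i * multiHermite α g = multiHermite (Function.update α i (α i + 1)) g +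
      α i * multiHermite (Function.update α i (α i - 1)) g := by
  have key : ∀ k, multiHermite (Function.update α i k) g =
      (hermiteReal k).eval (g i) * ∏ j ∈ Finset.univ.erase i, (hermiteReal (α j)).eval (g j) := by
    intro k
    rw [multiHermite, ← Finset.mul_prod_erase _ _ (Finset.mem_univ i), Function.update_self]
    congr 1
    refine Finset.prod_congr rfl fun j hj => ?_
    rw [Function.update_of_ne (Finset.ne_of_mem_erase hj)]
  have h0 := key (α i)
  rw [Function.update_eq_self] at h0
  rw [h0, key, key, ← mul_assoc, mul_eval_hermiteReal]
  ring

/-- The span of the products of Hermite polynomials of total degree at most `D`. -/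
def hermiteSpan (ι : Type*) [Fintype ι] (D : ℕ) : Submodule ℝ ((ι → ℝ) → ℝ) :=
  Submodule.span ℝ (multiHermite '' {α : ι → ℕ | ∑ i, α i ≤ D})

theorem hermiteSpan_mono {D E : ℕ} (h : D ≤ E) : hermiteSpan ι D ≤ hermiteSpan ι E :=
  Submodule.span_mono (Set.image_mono fun _ hα => le_trans hα h)

theorem coord_mul_mem_hermiteSpan {D : ℕ} (i : ι) {f : (ι → ℝ) → ℝ} (hf : f ∈ hermiteSpan ι D) :
    (fun g => g i * f g) ∈ hermiteSpan ι (D + 1) := by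
  classical
  refine Submodule.span_induction (p := fun f _ => (fun g => g i * f g) ∈ hermiteSpan ι (D + 1))
    ?_ ?_ ?_ ?_ hf
  · rintro _ ⟨α, hα, rfl⟩
    have e : (fun g : ι → ℝ => g i * multiHermite α g) =
        multiHermite (Function.update α i (α i + 1)) +
          (α i : ℝ) • multiHermite (Function.update α i (α i - 1)) := by
      funext g; simp [mul_multiHermite]
    have hs : ∀ k, ∑ j, Function.update α i k j = k + ∑ j ∈ Finset.univ.erase i, α j := by
      intro k
      rw [← Finset.add_sum_erase _ _ (Finset.mem_univ i), Function.update_self]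
      congr 1
      exact Finset.sum_congr rfl fun j hj => Function.update_of_ne (Finset.ne_of_mem_erase hj) _ _
    have h0 := hs (α i)
    rw [Function.update_eq_self] at h0
    have hα' : ∑ i, α i ≤ D := hα
    rw [e]
    refine Submodule.add_mem _ (Submodule.subset_span ⟨_, ?_, rfl⟩)
      (Submodule.smul_mem _ _ (Submodule.subset_span ⟨_, ?_, rfl⟩))
    · simp only [Set.mem_ofPred_eq, hs]; omega
    · simp only [Set.mem_ofPred_eq, hs]; omega
  · have : (fun g : ι → ℝ => g i * (0 : (ι → ℝ) → ℝ) g) = 0 := by funext g; simp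
    rw [this]; exact Submodule.zero_mem _
  · intro x y _ _ hx hy
    have : (fun g : ι → ℝ => g i * (x + y) g) = (fun g => g i * x g) + fun g => g i * y g := by
      funext g; simp [mul_add]
    rw [this]; exact Submodule.add_mem _ hx hy
  · intro a x _ hx
    have : (fun g : ι → ℝ => g i * (a • x) g) = a • fun g => g i * x g := by
      funext g; simp; ring
    rw [this]; exact Submodule.smul_mem _ _ hx

/-- Monomials are built by multiplying with one coordinate at a time, each of which raises the
Hermite degree by at most one. -/
theorem eval_mem_hermiteSpan (h : MvPolynomial ι ℝ) {D : ℕ} (hD : h.totalDegree ≤ D) :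
    (fun g => MvPolynomial.eval g h) ∈ hermiteSpan ι D := by
  classical
  have mono : ∀ (d : ℕ) (s : ι → ℕ), ∑ i, s i = d →
      (fun g : ι → ℝ => ∏ i, g i ^ s i) ∈ hermiteSpan ι d := by
    intro d
    induction d with
    | zero =>
      intro s hs
      have h0 : ∀ i, s i = 0 := by simpa using hs
      refine Submodule.subset_span ⟨0, by simp, ?_⟩
      funext g
      simp [multiHermite, h0]
    | succ d ih =>
      intro s hs
      obtain ⟨i, hi⟩ : ∃ i, s i ≠ 0 := by
        by_contra! hc
        simp [hc] at hs
      have hsum : s i + ∑ j ∈ Finset.univ.erase i, s j = ∑ j, s j :=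
        Finset.add_sum_erase _ s (Finset.mem_univ i)
      have hupd : ∑ j, Function.update s i (s i - 1) j = d := by
        have he : ∑ j ∈ Finset.univ.erase i, Function.update s i (s i - 1) j =
            ∑ j ∈ Finset.univ.erase i, s j :=
          Finset.sum_congr rfl fun j hj =>
            Function.update_of_ne (Finset.ne_of_mem_erase hj) (s i - 1) s
        rw [← Finset.add_sum_erase _ _ (Finset.mem_univ i), Function.update_self, he]
        omega
      convert coord_mul_mem_hermiteSpan i (ih _ hupd) using 1
      funext g
      rw [← Finset.mul_prod_erase _ _ (Finset.mem_univ i),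
        ← Finset.mul_prod_erase _ (fun j => g j ^ Function.update s i (s i - 1) j)
          (Finset.mem_univ i), Function.update_self, ← mul_assoc, mul_pow_sub_one hi]
      congr 1
      refine Finset.prod_congr rfl fun j hj => ?_
      rw [Function.update_of_ne (Finset.ne_of_mem_erase hj)]
  have e : (fun g => MvPolynomial.eval g h) =
      ∑ s ∈ h.support, h.coeff s • fun g : ι → ℝ => ∏ i, g i ^ s i := by
    funext g
    rw [MvPolynomial.eval_eq']
    simp
  rw [e]
  exact Submodule.sum_mem _ fun s hs => Submodule.smul_mem _ _
    (hermiteSpan_mono ((MvPolynomial.le_totalDegree hs).trans hD)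
      (mono _ s (Finsupp.sum_fintype s (fun _ e => e) fun _ => rfl).symm))

/-- Multi-indices of total degree at most `D`. -/
def multiIdx (ι : Type*) [Fintype ι] [DecidableEq ι] (D : ℕ) : Finset (ι → ℕ) :=
  (Finset.range (D + 1)).biUnion fun d => Finset.piAntidiag Finset.univ d

theorem mem_multiIdx [DecidableEq ι] {D : ℕ} {α : ι → ℕ} :
    α ∈ multiIdx ι D ↔ ∑ i, α i ≤ D := by
  simp [multiIdx]

/-- The multinomial theorem, degree by degree. With `x i` a product of two shift coordinates it
collapses the sum over multi-indices into a function of the inner product alone. -/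
theorem sum_multiIdx [DecidableEq ι] (D : ℕ) (x : ι → ℝ) :
    ∑ α ∈ multiIdx ι D, (∏ i, x i ^ α i) / ∏ i, ((α i).factorial : ℝ) =
      ∑ d ∈ Finset.range (D + 1), (∑ i, x i) ^ d / (d.factorial : ℝ) := by
  rw [multiIdx, Finset.sum_biUnion]
  · refine Finset.sum_congr rfl fun d _ => ?_
    rw [Finset.sum_pow_eq_sum_piAntidiag, Finset.sum_div]
    refine Finset.sum_congr rfl fun α hα => ?_
    have hs : ∑ i, α i = d := by simpa using hα
    have h := Nat.multinomial_spec Finset.univ α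
    rw [hs] at h
    rw [← h]
    have : (∏ i, ((α i).factorial : ℝ)) ≠ 0 :=
      Finset.prod_ne_zero_iff.2 fun i _ => by positivity
    have h2 : (Nat.multinomial Finset.univ α : ℝ) ≠ 0 := by
      exact_mod_cast (Nat.multinomial_pos _ _).ne'
    push_cast
    field_simp
  · intro a _ b _ hab
    refine Finset.disjoint_left.2 fun α h1 h2 => hab ?_
    have h1' : ∑ i, α i = a := by simpa using h1
    have h2' : ∑ i, α i = b := by simpa using h2
    omega

theorem exists_hermite_expansion [DecidableEq ι] (h : MvPolynomial ι ℝ) {D : ℕ}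
    (hD : h.totalDegree ≤ D) :
    ∃ c : (ι → ℕ) → ℝ, ∀ g, MvPolynomial.eval g h =
      ∑ α ∈ multiIdx ι D, c α * multiHermite α g := by
  have h1 := eval_mem_hermiteSpan h hD
  have h2 : {α : ι → ℕ | ∑ i, α i ≤ D} = (multiIdx ι D : Set (ι → ℕ)) := by
    ext α; simp [mem_multiIdx]
  rw [hermiteSpan, h2, Submodule.mem_span_image_finset_iff_exists_fun'] at h1
  obtain ⟨c, hc⟩ := h1
  refine ⟨c, fun g => ?_⟩
  have := congrFun hc g
  simpa using this.symm

theorem integral_sq_hermite_expansion [DecidableEq ι] (D : ℕ) (c : (ι → ℕ) → ℝ) :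
    ∫ g, (∑ α ∈ multiIdx ι D, c α * multiHermite α g) ^ 2 ∂(stdGauss ι) =
      ∑ α ∈ multiIdx ι D, c α ^ 2 * ∏ i, ((α i).factorial : ℝ) := by
  simp_rw [sq, Finset.sum_mul_sum]
  have hi : ∀ α β, Integrable (fun g => c α * multiHermite α g * (c β * multiHermite β g))
      (stdGauss ι) := by
    intro α β
    refine ((integrable_multiHermite_mul α β).const_mul (c α * c β)).congr (ae_of_all _ fun g => ?_)
    ring
  rw [integral_finsetSum _ fun α _ => integrable_finsetSum _ fun β _ => hi α β]
  refine Finset.sum_congr rfl fun α hα => ?_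
  rw [integral_finsetSum _ fun β _ => hi α β]
  have e : ∀ β, ∫ g, c α * multiHermite α g * (c β * multiHermite β g) ∂(stdGauss ι) =
      if α = β then c α * c α * ∏ i, ((α i).factorial : ℝ) else 0 := by
    intro β
    have : ∀ g, c α * multiHermite α g * (c β * multiHermite β g) =
        c α * c β * (multiHermite α g * multiHermite β g) := fun g => by ring
    simp_rw [this]
    rw [integral_const_mul, integral_multiHermite_mul]
    split_ifs with h
    · rw [h]
    · simp
  simp_rw [e]
  rw [Finset.sum_ite_eq, if_pos hα]

end MultiHermite

/-! ### Low-degree bound for a random shift of a Gaussian vector. -/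

open Polynomial in
-- A dominating polynomial that is uniform in bounded shifts, so that Hermite products of the
-- shifted vector are integrable jointly in the shift and the noise.
theorem exists_abs_eval_add_le (p : ℝ[X]) (B : ℝ) :
    ∃ q : ℝ[X], ∀ x m : ℝ, |m| ≤ B → |p.eval (x + m)| ≤ q.eval x := by
  refine ⟨C ((∑ k ∈ Finset.range (p.natDegree + 1), |p.coeff k|) * (1 + B) ^ p.natDegree) *
    (C 2 + X ^ 2) ^ p.natDegree, fun x m hm => ?_⟩
  have hB : 0 ≤ B := (abs_nonneg m).trans hm
  have hx : |x| ≤ 1 + x ^ 2 := by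
    rw [← sq_abs x]; nlinarith [abs_nonneg x, sq_nonneg (|x| - 1)]
  have h1 : 1 ≤ (1 + B) * (2 + x ^ 2) := by nlinarith [sq_nonneg x]
  have h2 : |x + m| ≤ (1 + B) * (2 + x ^ 2) := by
    have := abs_add_le x m
    nlinarith [sq_nonneg x]
  rw [Polynomial.eval_eq_sum_range]
  simp only [eval_mul, eval_C, eval_pow, eval_add, eval_X]
  rw [mul_assoc, ← mul_pow, Finset.sum_mul]
  refine (Finset.abs_sum_le_sum_abs _ _).trans (Finset.sum_le_sum fun k hk => ?_)
  rw [abs_mul, abs_pow]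
  refine mul_le_mul_of_nonneg_left ?_ (abs_nonneg _)
  calc |x + m| ^ k ≤ ((1 + B) * (2 + x ^ 2)) ^ k := pow_le_pow_left₀ (abs_nonneg _) h2 k
    _ ≤ _ := pow_le_pow_right₀ h1 (Nat.lt_succ_iff.1 (Finset.mem_range.1 hk))

section LowDegree

variable {ι Φ : Type*} [Fintype ι] [MeasurableSpace Φ] {ν : Measure Φ} [IsProbabilityMeasure ν]
  {μ : Φ → ι → ℝ} {B : ℝ}

theorem integrable_multiHermite_add (hμ : Measurable μ) (hB : ∀ φ i, |μ φ i| ≤ B) (α : ι → ℕ) :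
    Integrable (fun z : Φ × (ι → ℝ) => multiHermite α (z.2 + μ z.1)) (ν.prod (stdGauss ι)) := by
  choose q hq using fun i => exists_abs_eval_add_le (hermiteReal (α i)) B
  have h1 : Integrable (fun g : ι → ℝ => ∏ i, (q i).eval (g i)) (stdGauss ι) :=
    Integrable.fintype_prod (f := fun i x => (q i).eval x)
      fun i => integrable_eval_gaussianReal (q i)
  refine (h1.comp_snd ν).mono' ?_ (ae_of_all _ fun z => ?_)
  · refine Measurable.aestronglyMeasurable ?_
    unfold multiHermite
    refine Finset.measurable_prod _ fun i _ => ?_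
    refine (Polynomial.continuous _).measurable.comp ?_
    simp only [Pi.add_apply]
    fun_prop
  · rw [multiHermite, Real.norm_eq_abs, Finset.abs_prod]
    exact Finset.prod_le_prod (fun i _ => abs_nonneg _) fun i _ => hq i _ _ (hB _ i)

theorem integrable_prod_pow (hμ : Measurable μ) (hB : ∀ φ i, |μ φ i| ≤ B) (α : ι → ℕ) :
    Integrable (fun φ => ∏ i, μ φ i ^ α i) ν := by
  refine Integrable.of_bound (by fun_prop) (∏ i, B ^ α i) (ae_of_all _ fun φ => ?_)
  rw [Real.norm_eq_abs, Finset.abs_prod]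
  refine Finset.prod_le_prod (fun i _ => abs_nonneg _) fun i _ => ?_
  rw [abs_pow]
  exact pow_le_pow_left₀ (abs_nonneg _) (hB φ i) _

/-- Low-degree bound for a randomly shifted standard Gaussian vector. -/
theorem sq_integral_eval_add_le [DecidableEq ι] (hμ : Measurable μ) (hB : ∀ φ i, |μ φ i| ≤ B)
    (h : MvPolynomial ι ℝ) {D : ℕ} (hD : h.totalDegree ≤ D) :
    (∫ z, MvPolynomial.eval (z.2 + μ z.1) h ∂(ν.prod (stdGauss ι))) ^ 2 ≤
      (∫ g, MvPolynomial.eval g h ^ 2 ∂(stdGauss ι)) *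
        ∫ φ, ∫ φ', ∑ d ∈ Finset.range (D + 1), (∑ i, μ φ i * μ φ' i) ^ d / (d.factorial : ℝ)
          ∂ν ∂ν := by
  obtain ⟨c, hc⟩ := exists_hermite_expansion h hD
  simp_rw [hc]
  rw [integral_sq_hermite_expansion,
    integral_finsetSum _ fun α _ => (integrable_multiHermite_add hμ hB α).const_mul _]
  have e1 : ∀ α, ∫ z, c α * multiHermite α (z.2 + μ z.1) ∂(ν.prod (stdGauss ι)) =
      c α * ∫ φ, ∏ i, μ φ i ^ α i ∂ν := by
    intro α
    rw [integral_const_mul, integral_prod _ (integrable_multiHermite_add hμ hB α)]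
    simp_rw [integral_multiHermite_add]
  simp_rw [e1]
  have hintg := fun α => integrable_prod_pow (ν := ν) hμ hB α
  -- A squared moment of the shift is the mean over two independent copies (replicas).
  have e2 : ∫ φ, ∫ φ', ∑ d ∈ Finset.range (D + 1), (∑ i, μ φ i * μ φ' i) ^ d / (d.factorial : ℝ)
      ∂ν ∂ν = ∑ α ∈ multiIdx ι D, (∫ φ, ∏ i, μ φ i ^ α i ∂ν) ^ 2 /
        ∏ i, ((α i).factorial : ℝ) := by
    simp_rw [← sum_multiIdx, mul_pow, Finset.prod_mul_distrib]
    have e3 : ∀ φ, ∫ φ', ∑ α ∈ multiIdx ι D, ((∏ i, μ φ i ^ α i) * ∏ i, μ φ' i ^ α i) /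
        ∏ i, ((α i).factorial : ℝ) ∂ν = ∑ α ∈ multiIdx ι D, ((∏ i, μ φ i ^ α i) *
          ∫ φ', ∏ i, μ φ' i ^ α i ∂ν) / ∏ i, ((α i).factorial : ℝ) := by
      intro φ
      rw [integral_finsetSum _ fun α _ => ((hintg α).const_mul _).div_const _]
      simp_rw [integral_div, integral_const_mul]
    simp_rw [e3]
    rw [integral_finsetSum _ fun α _ => ((hintg α).mul_const _).div_const _]
    simp_rw [integral_div, integral_mul_const, sq]
  rw [e2]
  -- Cauchy–Schwarz with weights `α!`: the factor `c α ^ 2 * α!` belongs to the second moment under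
  -- the null, the rest to the shift.
  refine Finset.sum_sq_le_sum_mul_sum_of_sq_le_mul _ (fun α _ => by positivity)
    (fun α _ => by positivity) fun α _ => ?_
  have : (∏ i, ((α i).factorial : ℝ)) ≠ 0 := Finset.prod_ne_zero_iff.2 fun i _ => by positivity
  refine le_of_eq ?_
  field_simp

end LowDegree

/-! ### Moments of Gaussian vectors -/

section Moments

variable {ι : Type*} [Fintype ι]

theorem integral_pow_gaussianReal (d : ℕ) :
    ∫ x, x ^ (2 * d) ∂(gaussianReal 0 1) = ((2 * d).factorial : ℝ) / (2 ^ d * d.factorial) := by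
  induction d with
  | zero => simp
  | succ d ih =>
    have h := integral_mul_eval_gaussianReal ((Polynomial.X : Polynomial ℝ) ^ (2 * d + 1))
    simp only [Polynomial.eval_pow, Polynomial.eval_X, Polynomial.derivative_X_pow,
      Polynomial.eval_mul, Polynomial.eval_C, Nat.add_sub_cancel, integral_const_mul, ih] at h
    have e : ∀ x : ℝ, x ^ (2 * (d + 1)) = x * x ^ (2 * d + 1) := fun x => by ring
    simp_rw [e, h]
    have e2 : 2 * (d + 1) = (2 * d + 1) + 1 := by ring
    rw [e2, Nat.factorial_succ (2 * d + 1), Nat.factorial_succ (2 * d), Nat.factorial_succ d]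
    push_cast
    field_simp
    ring

/-- Both sides have the characteristic function `exp (-t² |ζ|² / 2)`. This reduces moments of a
linear form to those of one Gaussian. -/
theorem stdGauss_map_sum (ζ : ι → ℝ) :
    (stdGauss ι).map (fun u => ∑ i, ζ i * u i) =
      (gaussianReal 0 1).map fun x => √(∑ i, ζ i ^ 2) * x := by
  have hm : Measurable fun u : ι → ℝ => ∑ i, ζ i * u i := by fun_prop
  have : IsProbabilityMeasure ((stdGauss ι).map fun u => ∑ i, ζ i * u i) :=
    Measure.isProbabilityMeasure_map hm.aemeasurable
  have hc : ∀ s : ℝ, ∫ x : ℝ, Complex.exp (s * x * Complex.I) ∂(gaussianReal 0 1) =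
      Complex.exp (-(s ^ 2 / 2)) := by
    intro s
    have := charFun_gaussianReal (μ := 0) (v := 1) s
    rw [charFun_apply_real] at this
    rw [this]
    congr 1
    push_cast
    simp
  have : IsProbabilityMeasure ((gaussianReal 0 1).map fun x => √(∑ i, ζ i ^ 2) * x) :=
    Measure.isProbabilityMeasure_map (by fun_prop)
  refine Measure.ext_of_charFun (funext fun t => ?_)
  rw [charFun_apply_real, charFun_apply_real, integral_map hm.aemeasurable (by fun_prop),
    integral_map (by fun_prop) (by fun_prop)]
  have e1 : ∀ u : ι → ℝ, Complex.exp (t * ((∑ i, ζ i * u i : ℝ) : ℂ) * Complex.I) =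
      ∏ i, Complex.exp (((t * ζ i : ℝ) : ℂ) * u i * Complex.I) := by
    intro u
    rw [← Complex.exp_sum]
    congr 1
    push_cast
    rw [Finset.mul_sum, Finset.sum_mul]
    exact Finset.sum_congr rfl fun i _ => by ring
  have e2 : ∀ x : ℝ, Complex.exp (t * ((√(∑ i, ζ i ^ 2) * x : ℝ) : ℂ) * Complex.I) =
      Complex.exp (((t * √(∑ i, ζ i ^ 2) : ℝ) : ℂ) * x * Complex.I) := by
    intro x; push_cast; ring_nf
  simp_rw [e1, e2, hc]
  rw [stdGauss, integral_fintype_prod_eq_prod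
    (f := fun i (x : ℝ) => Complex.exp (((t * ζ i : ℝ) : ℂ) * x * Complex.I))]
  simp_rw [hc]
  rw [← Complex.exp_sum]
  congr 1
  have h0 : (√(∑ i, ζ i ^ 2)) ^ 2 = ∑ i, ζ i ^ 2 := Real.sq_sqrt (by positivity)
  have : ∑ i, -((t * ζ i) ^ 2 / 2) = -((t * √(∑ i, ζ i ^ 2)) ^ 2 / 2) := by
    rw [mul_pow, h0, Finset.mul_sum, Finset.sum_div, Finset.sum_neg_distrib]
    simp_rw [mul_pow]
  exact_mod_cast this

theorem integral_sum_pow_stdGauss (ζ : ι → ℝ) (d : ℕ) :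
    ∫ u, (∑ i, ζ i * u i) ^ (2 * d) ∂(stdGauss ι) =
      ((2 * d).factorial : ℝ) / (2 ^ d * d.factorial) * (∑ i, ζ i ^ 2) ^ d := by
  have hm : Measurable fun u : ι → ℝ => ∑ i, ζ i * u i := by fun_prop
  rw [← integral_map (f := fun x : ℝ => x ^ (2 * d)) hm.aemeasurable (by fun_prop),
    stdGauss_map_sum, integral_map (by fun_prop) (by fun_prop)]
  simp_rw [mul_pow]
  rw [integral_const_mul, integral_pow_gaussianReal, pow_mul (√(∑ i, ζ i ^ 2)),
    Real.sq_sqrt (by positivity)]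
  ring

theorem integral_exp_sum_stdGauss (ζ : ι → ℝ) :
    Integrable (fun u => Real.exp (∑ i, ζ i * u i)) (stdGauss ι) ∧
    ∫ u, Real.exp (∑ i, ζ i * u i) ∂(stdGauss ι) = Real.exp ((∑ i, ζ i ^ 2) / 2) := by
  simp_rw [Real.exp_sum]
  refine ⟨Integrable.fintype_prod (f := fun i x => Real.exp (ζ i * x))
    fun i => integrable_exp_mul_gaussianReal _, ?_⟩
  rw [stdGauss, integral_fintype_prod_eq_prod (f := fun i x => Real.exp (ζ i * x))]
  have : ∀ s : ℝ, ∫ x, Real.exp (s * x) ∂(gaussianReal 0 1) = Real.exp (s ^ 2 / 2) := by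
    intro s
    have := congrFun (mgf_id_gaussianReal (μ := 0) (v := 1)) s
    simpa [mgf] using this
  simp_rw [this]
  rw [← Real.exp_sum, Finset.sum_div]

theorem integral_exp_sq_gaussianReal {s : ℝ} (hs : s < 1) :
    Integrable (fun x => Real.exp (s * x ^ 2 / 2)) (gaussianReal 0 1) ∧
    ∫ x, Real.exp (s * x ^ 2 / 2) ∂(gaussianReal 0 1) = √(1 - s)⁻¹ := by
  have e : ∀ x : ℝ, gaussianPDFReal 0 1 x * Real.exp (s * x ^ 2 / 2) =
      (√(2 * Real.pi))⁻¹ * Real.exp (-((1 - s) / 2) * x ^ 2) := by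
    intro x
    rw [gaussianPDFReal_def]
    simp only [NNReal.coe_one, mul_one, sub_zero]
    rw [mul_assoc, ← Real.exp_add]
    ring_nf
  have h2 : 0 < (1 - s) / 2 := by linarith
  refine ⟨?_, ?_⟩
  · rw [integrable_gaussianReal_iff]
    simp_rw [e]
    exact (integrable_exp_neg_mul_sq h2).const_mul _
  · rw [integral_gaussianReal_eq]
    simp_rw [e]
    rw [integral_const_mul, integral_gaussian, ← Real.sqrt_inv, ← Real.sqrt_mul (by positivity)]
    congr 1
    have : 1 - s ≠ 0 := by linarith
    field_simp

/-- Apply `x ^ d / d! ≤ exp x` to `x = s |u|² / 2` and use the chi-square exponential moment. The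
free parameter `s` will be placed between `λ²` and `1`. -/
theorem integral_sum_sq_pow_le {s : ℝ} (hs0 : 0 < s) (hs : s < 1) (d : ℕ) :
    Integrable (fun u : ι → ℝ => (∑ i, u i ^ 2) ^ d) (stdGauss ι) ∧
    ∫ u, (∑ i, u i ^ 2) ^ d ∂(stdGauss ι) ≤
      d.factorial * (2 / s) ^ d * (√(1 - s)⁻¹) ^ Fintype.card ι := by
  have hb : ∀ u : ι → ℝ, (∑ i, u i ^ 2) ^ d ≤
      d.factorial * (2 / s) ^ d * ∏ i, Real.exp (s * u i ^ 2 / 2) := by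
    intro u
    rw [← Real.exp_sum]
    have h0 : 0 ≤ ∑ i, s * u i ^ 2 / 2 := Finset.sum_nonneg fun i _ => by positivity
    have h1 := Real.pow_div_factorial_le_exp _ h0 d
    have h2 : ∑ i, s * u i ^ 2 / 2 = (s / 2) * ∑ i, u i ^ 2 := by
      rw [Finset.mul_sum]; exact Finset.sum_congr rfl fun i _ => by ring
    have h3 : (∑ i, u i ^ 2) ^ d = d.factorial * (2 / s) ^ d *
        ((∑ i, s * u i ^ 2 / 2) ^ d / d.factorial) := by
      rw [h2, mul_pow, div_pow, div_pow]
      have := Nat.factorial_ne_zero d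
      field_simp
    rw [h3]
    exact mul_le_mul_of_nonneg_left h1 (by positivity)
  have hi : Integrable (fun u : ι → ℝ => d.factorial * (2 / s) ^ d *
      ∏ i, Real.exp (s * u i ^ 2 / 2)) (stdGauss ι) := by
    refine Integrable.const_mul ?_ _
    exact Integrable.fintype_prod (f := fun _ x => Real.exp (s * x ^ 2 / 2))
      fun i => (integral_exp_sq_gaussianReal hs).1
  have hi2 : Integrable (fun u : ι → ℝ => (∑ i, u i ^ 2) ^ d) (stdGauss ι) := by
    refine hi.mono' (by fun_prop : Measurable _).aestronglyMeasurable (ae_of_all _ fun u => ?_)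
    rw [Real.norm_of_nonneg (by positivity)]
    exact hb u
  refine ⟨hi2, (integral_mono hi2 hi hb).trans_eq ?_⟩
  rw [integral_const_mul, stdGauss,
    integral_fintype_prod_eq_prod (f := fun _ x => Real.exp (s * x ^ 2 / 2))]
  simp [(integral_exp_sq_gaussianReal hs).2]

end Moments

/-! ### Trigonometric polynomials at uniform phases -/

/-- The uniform law on `[0, 2π)`. -/
abbrev uniformPhase : Measure ℝ := volume[|Set.Ico (0 : ℝ) (2 * Real.pi)]

instance : IsProbabilityMeasure uniformPhase :=
  cond_isProbabilityMeasure_of_finite (by simp [Real.pi_pos])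
    (by rw [Real.volume_Ico]; exact ENNReal.ofReal_ne_top)

instance (n : ℕ) : IsProbabilityMeasure (phaseLaw n) := by
  unfold phaseLaw; infer_instance

theorem integral_uniformPhase {E : Type*} [NormedAddCommGroup E] [NormedSpace ℝ E] (f : ℝ → E) :
    ∫ x, f x ∂uniformPhase = (2 * Real.pi)⁻¹ • ∫ x in (0 : ℝ)..(2 * Real.pi), f x := by
  rw [uniformPhase, ProbabilityTheory.cond, integral_smul_measure,
    intervalIntegral.integral_of_le (by positivity), integral_Ico_eq_integral_Ioc]
  simp [Real.pi_pos.le]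

theorem integrable_uniformPhase {E : Type*} [NormedAddCommGroup E] {f : ℝ → E}
    (hf : Continuous f) : Integrable f uniformPhase := by
  rw [uniformPhase, ProbabilityTheory.cond]
  refine Integrable.smul_measure ?_ (by simp [Real.pi_pos])
  exact (hf.continuousOn.integrableOn_Icc (a := 0) (b := 2 * Real.pi)).mono_set
    Set.Ico_subset_Icc_self

theorem integral_exp_int_uniformPhase (m : ℤ) :
    ∫ x : ℝ, Complex.exp (Complex.I * (m * x)) ∂uniformPhase = if m = 0 then 1 else 0 := by
  split_ifs with h
  · simp [h]
  · rw [integral_uniformPhase]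
    have hm : Complex.I * (m : ℂ) ≠ 0 := mul_ne_zero Complex.I_ne_zero (by exact_mod_cast h)
    have := integral_exp_mul_complex (a := 0) (b := 2 * Real.pi) hm
    simp_rw [← mul_assoc]
    rw [this]
    have e : Complex.I * (m : ℂ) * ((2 * Real.pi : ℝ) : ℂ) = m * (2 * Real.pi * Complex.I) := by
      push_cast; ring
    rw [e, Complex.exp_int_mul_two_pi_mul_I]
    simp

/-- The analytic trigonometric polynomial with coefficients `c` at the frequencies `1, 2, …`. -/
def trigPoly {L : ℕ} (c : Fin L → ℂ) (x : ℝ) : ℂ :=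
  ∑ k, c k * Complex.exp (Complex.I * ((((k : ℕ) + 1 : ℤ) : ℂ) * x))

section TrigPoly

variable {L : ℕ} (c : Fin L → ℂ)

theorem continuous_trigPoly : Continuous (trigPoly c) := by
  unfold trigPoly; fun_prop

theorem norm_trigPoly_le (x : ℝ) : ‖trigPoly c x‖ ≤ √L * √(∑ k, ‖c k‖ ^ 2) := by
  have h1 : ‖trigPoly c x‖ ≤ ∑ k, 1 * ‖c k‖ := by
    refine (norm_sum_le _ _).trans (Finset.sum_le_sum fun k _ => ?_)
    rw [norm_mul, one_mul]
    have : Complex.I * ((((k : ℕ) + 1 : ℤ) : ℂ) * x) =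
        ((((k : ℕ) + 1 : ℤ) * x : ℝ) : ℂ) * Complex.I := by push_cast; ring
    rw [this, Complex.norm_exp_ofReal_mul_I, mul_one]
  refine h1.trans ((Real.sum_mul_le_sqrt_mul_sqrt _ _ _).trans ?_)
  simp

theorem integral_trigPoly : ∫ x, trigPoly c x ∂uniformPhase = 0 := by
  unfold trigPoly
  rw [integral_finsetSum _ fun k _ => integrable_uniformPhase (by fun_prop)]
  refine Finset.sum_eq_zero fun k _ => ?_
  rw [integral_const_mul, integral_exp_int_uniformPhase, if_neg (by omega), mul_zero]

/-- All frequencies are strictly positive, so the square has no constant term. Hence the real part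
carries exactly half of the energy, the source of the threshold at strength one. -/
theorem integral_trigPoly_sq : ∫ x, trigPoly c x ^ 2 ∂uniformPhase = 0 := by
  have e : ∀ x, trigPoly c x ^ 2 = ∑ k, ∑ l : Fin L, (c k * c l) *
      Complex.exp (Complex.I * ((((k : ℕ) + 1 + ((l : ℕ) + 1) : ℤ) : ℂ) * x)) := by
    intro x
    rw [sq, trigPoly, Finset.sum_mul_sum]
    refine Finset.sum_congr rfl fun k _ => Finset.sum_congr rfl fun l _ => ?_
    rw [mul_mul_mul_comm, ← Complex.exp_add]
    congr 2
    push_cast; ring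
  simp_rw [e]
  rw [integral_finsetSum _ fun k _ => integrable_finsetSum _ fun l _ =>
    integrable_uniformPhase (by fun_prop)]
  refine Finset.sum_eq_zero fun k _ => ?_
  rw [integral_finsetSum _ fun l _ => integrable_uniformPhase (by fun_prop)]
  refine Finset.sum_eq_zero fun l _ => ?_
  rw [integral_const_mul, integral_exp_int_uniformPhase, if_neg (by omega), mul_zero]

theorem integral_trigPoly_mul_conj :
    ∫ x, trigPoly c x * (starRingEnd ℂ) (trigPoly c x) ∂uniformPhase =
      ((∑ k, ‖c k‖ ^ 2 : ℝ) : ℂ) := by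
  have e : ∀ x, trigPoly c x * (starRingEnd ℂ) (trigPoly c x) = ∑ k, ∑ l : Fin L,
      (c k * (starRingEnd ℂ) (c l)) *
      Complex.exp (Complex.I * ((((k : ℕ) + 1 - ((l : ℕ) + 1) : ℤ) : ℂ) * x)) := by
    intro x
    rw [trigPoly, map_sum, Finset.sum_mul_sum]
    refine Finset.sum_congr rfl fun k _ => Finset.sum_congr rfl fun l _ => ?_
    rw [map_mul, mul_mul_mul_comm, ← Complex.exp_conj, ← Complex.exp_add]
    congr 2
    simp
    ring
  simp_rw [e]
  rw [integral_finsetSum _ fun k _ => integrable_finsetSum _ fun l _ =>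
    integrable_uniformPhase (by fun_prop)]
  rw [Complex.ofReal_sum]
  refine Finset.sum_congr rfl fun k _ => ?_
  rw [integral_finsetSum _ fun l _ => integrable_uniformPhase (by fun_prop),
    Finset.sum_eq_single k]
  · rw [integral_const_mul, integral_exp_int_uniformPhase, if_pos (by omega), mul_one,
      Complex.mul_conj', Complex.ofReal_pow]
  · intro l _ hl
    rw [integral_const_mul, integral_exp_int_uniformPhase, if_neg, mul_zero]
    intro h
    exact hl (Fin.ext (by omega))
  · simp

theorem integral_re_trigPoly : ∫ x, (trigPoly c x).re ∂uniformPhase = 0 := by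
  have := integral_re (integrable_uniformPhase (continuous_trigPoly c))
  simp only [RCLike.re_eq_complex_re] at this
  rw [this, integral_trigPoly]; simp

theorem integral_re_trigPoly_sq :
    ∫ x, (trigPoly c x).re ^ 2 ∂uniformPhase = (∑ k, ‖c k‖ ^ 2) / 2 := by
  have hc := continuous_trigPoly c
  have e : ∀ x, (trigPoly c x).re ^ 2 =
      (trigPoly c x ^ 2 + trigPoly c x * (starRingEnd ℂ) (trigPoly c x)).re / 2 := by
    intro x
    simp [sq]
  have i1 : Integrable (fun x => trigPoly c x ^ 2) uniformPhase :=
    integrable_uniformPhase (by fun_prop)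
  have i2 : Integrable (fun x => trigPoly c x * (starRingEnd ℂ) (trigPoly c x)) uniformPhase :=
    integrable_uniformPhase (by fun_prop)
  have := integral_re (i1.add i2)
  simp only [RCLike.re_eq_complex_re, Pi.add_apply] at this
  simp_rw [e]
  rw [integral_div, this, integral_add i1 i2, integral_trigPoly_sq, integral_trigPoly_mul_conj]
  rw [zero_add, Complex.ofReal_re]

/-- The difference of the two sides vanishes at `0` and is monotone, because `1 - x ≤ exp (-x)`. -/
theorem exp_sub_le_of_nonneg {a : ℝ} (ha : 0 ≤ a) :
    Real.exp a - 1 - a ≤ a ^ 2 / 2 * Real.exp a := by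
  have hd : ∀ x : ℝ, HasDerivAt (fun x => x ^ 2 / 2 * Real.exp x - (Real.exp x - 1 - x))
      (x ^ 2 / 2 * Real.exp x + (x * Real.exp x - Real.exp x + 1)) x := by
    intro x
    refine ((((hasDerivAt_pow 2 x).div_const 2).mul (Real.hasDerivAt_exp x)).sub
      (((Real.hasDerivAt_exp x).sub_const 1).sub (hasDerivAt_id x))).congr_deriv ?_
    simp; ring
  have hm : MonotoneOn (fun x => x ^ 2 / 2 * Real.exp x - (Real.exp x - 1 - x)) (Set.Ici 0) := by
    refine monotoneOn_of_deriv_nonneg (convex_Ici 0)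
      (fun x _ => (hd x).continuousAt.continuousWithinAt)
      (fun x _ => (hd x).differentiableAt.differentiableWithinAt) fun x _ => ?_
    rw [(hd x).deriv]
    have h1 : 1 - x ≤ Real.exp (-x) := by linarith [Real.add_one_le_exp (-x)]
    have h2 := mul_le_mul_of_nonneg_right h1 (Real.exp_pos x).le
    rw [← Real.exp_add, neg_add_cancel, Real.exp_zero] at h2
    have : 0 ≤ x ^ 2 / 2 * Real.exp x := by positivity
    nlinarith
  have := hm (Set.mem_Ici.2 le_rfl) (Set.mem_Ici.2 ha) ha
  simp at this
  linarith

theorem exp_le_one_add_sq (y : ℝ) : Real.exp y ≤ 1 + y + y ^ 2 / 2 * Real.exp |y| := by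
  have h := Complex.norm_exp_sub_sum_le_exp_norm_sub_sum y 2
  simp only [Finset.sum_range_succ, Finset.sum_range_zero] at h
  norm_num at h
  have e : Complex.exp y - (1 + y) = ((Real.exp y - (1 + y) : ℝ) : ℂ) := by push_cast; rfl
  rw [e, Complex.norm_real, Real.norm_eq_abs] at h
  have h1 := (le_abs_self _).trans h
  have h2 := exp_sub_le_of_nonneg (abs_nonneg y)
  rw [sq_abs] at h2
  linarith

/-- Second-order Taylor bound with mean zero and second moment `∑ |c k|² / 2`. The exponential
remainder factor is controlled by the sup norm and is close to `1` once `s` is rescaled by `1 / √n`,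
so the leading constant is the Gaussian one. -/
theorem integral_exp_re_trigPoly_le (s : ℝ) :
    ∫ x, Real.exp (s * (trigPoly c x).re) ∂uniformPhase ≤
      Real.exp (s ^ 2 * (∑ k, ‖c k‖ ^ 2) / 4 *
        Real.exp (|s| * (√L * √(∑ k, ‖c k‖ ^ 2)))) := by
  have hc := continuous_trigPoly c
  set E := Real.exp (|s| * (√L * √(∑ k, ‖c k‖ ^ 2))) with hE
  have hb : ∀ x, Real.exp (s * (trigPoly c x).re) ≤
      1 + s * (trigPoly c x).re + (s ^ 2 * E / 2) * (trigPoly c x).re ^ 2 := by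
    intro x
    refine (exp_le_one_add_sq _).trans ?_
    have h1 : Real.exp |s * (trigPoly c x).re| ≤ E := by
      refine Real.exp_le_exp.2 ?_
      rw [abs_mul]
      exact mul_le_mul_of_nonneg_left
        ((Complex.abs_re_le_norm _).trans (norm_trigPoly_le c x)) (abs_nonneg s)
    have h2 : 0 ≤ (s * (trigPoly c x).re) ^ 2 / 2 := by positivity
    nlinarith [mul_le_mul_of_nonneg_left h1 h2]
  have i1 : Integrable (fun x => (trigPoly c x).re) uniformPhase :=
    integrable_uniformPhase (by fun_prop)
  have i2 : Integrable (fun x => (trigPoly c x).re ^ 2) uniformPhase :=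
    integrable_uniformPhase (by fun_prop)
  have i3 : Integrable (fun x => 1 + s * (trigPoly c x).re) uniformPhase :=
    integrable_uniformPhase (by fun_prop)
  refine (integral_mono (integrable_uniformPhase (by fun_prop))
    (i3.add (i2.const_mul _)) hb).trans ?_
  simp only [Pi.add_apply]
  rw [integral_add i3 (i2.const_mul _), integral_add (integrable_const 1) (i1.const_mul s), integral_const_mul, integral_const_mul,
    integral_re_trigPoly, integral_re_trigPoly_sq]
  refine le_trans (le_of_eq ?_) (Real.add_one_le_exp _)
  simp
  ring

end TrigPoly

theorem integral_exp_sum_re_trigPoly_le {L n : ℕ} (c : Fin n → Fin L → ℂ) (C : ℝ)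
    (hC : ∀ i, ∑ k, ‖c i k‖ ^ 2 = C) (s : ℝ) :
    ∫ φ, Real.exp (s * ∑ i, (trigPoly (c i) (φ i)).re) ∂(phaseLaw n) ≤
      Real.exp (n * (s ^ 2 * C / 4 * Real.exp (|s| * (√L * √C)))) := by
  simp_rw [Finset.mul_sum, Real.exp_sum]
  rw [phaseLaw, integral_fintype_prod_eq_prod
    (f := fun i x => Real.exp (s * (trigPoly (c i) x).re))]
  rw [← smul_eq_mul (n : ℝ), Nat.cast_smul_eq_nsmul, Real.exp_nsmul]
  refine (Finset.prod_le_prod (fun i _ => integral_nonneg fun x => (Real.exp_pos _).le)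
    fun i _ => integral_exp_re_trigPoly_le (c i) s).trans_eq ?_
  simp [hC]

/-! ### Moments of the overlap of two independent signals -/

section Overlap

variable {L n : ℕ}

/-- The sums `∑ i, (x_i / y_i) ^ (k + 1)`, where `x` and `y` have the phases `φ` and `θ`. -/
def phaseSum (k : Fin L) (φ θ : Fin n → ℝ) : ℂ :=
  ∑ i, Complex.exp (Complex.I * ((((k : ℕ) + 1 : ℤ) : ℂ) * ((φ i - θ i : ℝ) : ℂ)))

/-- The overlap of two signals of strength one, summed over all frequencies. -/
def phaseOverlap (L : ℕ) {n : ℕ} (φ θ : Fin n → ℝ) : ℝ :=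
  (∑ k : Fin L, ‖phaseSum k φ θ‖ ^ 2) / n

/-- Real and imaginary parts of the normalized phase sums. -/
def phaseVec (φ θ : Fin n → ℝ) : Fin L × Bool → ℝ
  | (k, true) => (phaseSum k φ θ).re / √n
  | (k, false) => (phaseSum k φ θ).im / √n

theorem norm_phaseSum_le (k : Fin L) (φ θ : Fin n → ℝ) : ‖phaseSum k φ θ‖ ≤ n := by
  refine (norm_sum_le _ _).trans ((Finset.sum_le_sum fun i _ => ?_).trans_eq (b := ∑ _i : Fin n, 1)
    (by simp))
  have : Complex.I * ((((k : ℕ) + 1 : ℤ) : ℂ) * ((φ i - θ i : ℝ) : ℂ)) =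
      ((((k : ℕ) + 1 : ℤ) * (φ i - θ i) : ℝ) : ℂ) * Complex.I := by push_cast; ring
  rw [this, Complex.norm_exp_ofReal_mul_I]

theorem continuous_phaseSum (k : Fin L) :
    Continuous fun z : (Fin n → ℝ) × (Fin n → ℝ) => phaseSum k z.1 z.2 := by
  unfold phaseSum; fun_prop

theorem continuous_phaseOverlap :
    Continuous fun z : (Fin n → ℝ) × (Fin n → ℝ) => phaseOverlap L z.1 z.2 := by
  have := fun k : Fin L => continuous_phaseSum (n := n) k
  unfold phaseOverlap; fun_prop

theorem phaseOverlap_nonneg (φ θ : Fin n → ℝ) : 0 ≤ phaseOverlap L φ θ := by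
  unfold phaseOverlap; positivity

theorem phaseOverlap_le (φ θ : Fin n → ℝ) : phaseOverlap L φ θ ≤ L * n := by
  rcases Nat.eq_zero_or_pos n with rfl | hn
  · simp [phaseOverlap]
  have hn' : (0 : ℝ) < n := by exact_mod_cast hn
  rw [phaseOverlap, div_le_iff₀ hn']
  calc ∑ k : Fin L, ‖phaseSum k φ θ‖ ^ 2 ≤ ∑ _k : Fin L, (n : ℝ) ^ 2 :=
        Finset.sum_le_sum fun k _ => pow_le_pow_left₀ (norm_nonneg _) (norm_phaseSum_le k φ θ) 2
    _ = _ := by simp; ring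

theorem continuous_phaseVec (θ : Fin n → ℝ) (j : Fin L × Bool) :
    Continuous fun φ => phaseVec φ θ j := by
  have h : Continuous fun φ => phaseSum j.1 φ θ := by
    unfold phaseSum; fun_prop
  obtain ⟨k, b⟩ := j
  cases b <;> simp only [phaseVec] <;> fun_prop

theorem sum_phaseVec_sq (φ θ : Fin n → ℝ) :
    ∑ j : Fin L × Bool, phaseVec φ θ j ^ 2 = phaseOverlap L φ θ := by
  rw [Fintype.sum_prod_type, phaseOverlap, Finset.sum_div]
  refine Finset.sum_congr rfl fun k _ => ?_
  simp only [Fintype.sum_bool, phaseVec, div_pow, Real.sq_sqrt (Nat.cast_nonneg n)]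
  rw [← add_div, Complex.sq_norm, Complex.normSq_apply]
  ring

/-- For fixed `θ` the pairing is a sum of functions of the independent phases `φ i`. The phases `θ`
only rotate the coefficients, so their moduli, and all later bounds, do not depend on `θ`. -/
theorem sum_phaseVec_mul (φ θ : Fin n → ℝ) (u : Fin L × Bool → ℝ) :
    ∑ j, phaseVec φ θ j * u j = (√n)⁻¹ * ∑ i, (trigPoly (fun k : Fin L =>
      (u (k, true) - u (k, false) * Complex.I : ℂ) *
        Complex.exp (((-(((k : ℕ) + 1 : ℤ) : ℝ) * θ i : ℝ) : ℂ) * Complex.I)) (φ i)).re := by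
  have e : ∀ i, (trigPoly (fun k : Fin L => (u (k, true) - u (k, false) * Complex.I : ℂ) *
        Complex.exp (((-(((k : ℕ) + 1 : ℤ) : ℝ) * θ i : ℝ) : ℂ) * Complex.I)) (φ i)) =
      ∑ k : Fin L, (u (k, true) - u (k, false) * Complex.I : ℂ) *
        Complex.exp (Complex.I * ((((k : ℕ) + 1 : ℤ) : ℂ) * ((φ i - θ i : ℝ) : ℂ))) := by
    intro i
    refine Finset.sum_congr rfl fun k _ => ?_
    rw [mul_assoc, ← Complex.exp_add]
    congr 2
    push_cast; ring
  simp_rw [e]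
  rw [← Complex.re_sum, Finset.sum_comm, Fintype.sum_prod_type, Complex.re_sum, Finset.mul_sum]
  refine Finset.sum_congr rfl fun k _ => ?_
  rw [← Finset.mul_sum]
  change _ = (√n)⁻¹ * ((u (k, true) - u (k, false) * Complex.I : ℂ) * phaseSum k φ θ).re
  simp [phaseVec]
  ring

theorem integral_exp_sum_phaseVec_le (hn : 0 < n) (θ : Fin n → ℝ) (u : Fin L × Bool → ℝ) (s : ℝ) :
    ∫ φ, Real.exp (s * ∑ j, phaseVec φ θ j * u j) ∂(phaseLaw n) ≤
      Real.exp (s ^ 2 * (∑ j, u j ^ 2) / 4 *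
        Real.exp (|s| * √(∑ j, u j ^ 2) * √(L / n))) := by
  have hn' : (0 : ℝ) < n := by exact_mod_cast hn
  have h := integral_exp_sum_re_trigPoly_le (L := L) (n := n) (fun i k =>
    (u (k, true) - u (k, false) * Complex.I : ℂ) *
      Complex.exp (((-(((k : ℕ) + 1 : ℤ) : ℝ) * θ i : ℝ) : ℂ) * Complex.I)) (∑ j, u j ^ 2)
    (fun i => by
      rw [Fintype.sum_prod_type]
      refine Finset.sum_congr rfl fun k _ => ?_
      rw [norm_mul, Complex.norm_exp_ofReal_mul_I, mul_one, Complex.sq_norm,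
        Complex.normSq_apply]
      simp
      ring) (s * (√n)⁻¹)
  simp_rw [sum_phaseVec_mul, ← mul_assoc]
  refine h.trans (Real.exp_le_exp.2 (le_of_eq ?_))
  rw [abs_mul, abs_inv, abs_of_nonneg (Real.sqrt_nonneg (n : ℝ)), mul_pow, inv_pow,
    Real.sq_sqrt hn'.le, Real.sqrt_div' _ hn'.le]
  have : |s| * (√n)⁻¹ * (√L * √(∑ j, u j ^ 2)) = |s| * √(∑ j, u j ^ 2) * (√L / √n) := by ring
  rw [this]
  field_simp

theorem pow_le_factorial_mul_exp (x : ℝ) (d : ℕ) :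
    x ^ (2 * d) ≤ (2 * d).factorial * (Real.exp x + Real.exp (-x)) := by
  have h := Real.pow_div_factorial_le_exp |x| (abs_nonneg x) (2 * d)
  have h2 : Real.exp |x| ≤ Real.exp x + Real.exp (-x) := by
    rcases abs_cases x with ⟨h, _⟩ | ⟨h, _⟩ <;> rw [h] <;> linarith [Real.exp_pos x, Real.exp_pos (-x)]
  rw [div_le_iff₀ (by positivity), pow_mul, sq_abs, ← pow_mul] at h
  refine h.trans ?_
  rw [mul_comm]
  exact mul_le_mul_of_nonneg_left h2 (by positivity)

theorem integrable_phaseLaw {f : (Fin n → ℝ) → ℝ} (hf : Continuous f) {C : ℝ}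
    (hC : ∀ φ, |f φ| ≤ C) : Integrable f (phaseLaw n) :=
  Integrable.of_bound hf.aestronglyMeasurable C (ae_of_all _ hC)

theorem abs_sum_phaseVec_mul_le (φ θ : Fin n → ℝ) (u : Fin L × Bool → ℝ) :
    |∑ j, phaseVec φ θ j * u j| ≤ √(L * n) * √(∑ j, u j ^ 2) := by
  have h := Finset.sum_mul_sq_le_sq_mul_sq Finset.univ (fun j => phaseVec φ θ j) u
  rw [sum_phaseVec_sq] at h
  rw [← Real.sqrt_mul (by positivity)]
  refine Real.abs_le_sqrt (h.trans ?_)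
  exact mul_le_mul_of_nonneg_right (phaseOverlap_le φ θ) (by positivity)

/-- Chernoff-type moment bound: `x ^ (2d) ≤ (2d)! (exp x + exp (-x))` after scaling by `s`, combined
with the exponential moments. -/
theorem integral_sum_phaseVec_pow_le (hn : 0 < n) (θ : Fin n → ℝ) (u : Fin L × Bool → ℝ) {d : ℕ}
    (hd : 1 ≤ d) :
    ∫ φ, (∑ j, phaseVec φ θ j * u j) ^ (2 * d) ∂(phaseLaw n) ≤
      (2 * d).factorial * (2 * Real.exp (d * Real.exp (2 * √(d * (L / n)))) / (4 * d) ^ d) *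
        (∑ j, u j ^ 2) ^ d := by
  have hd' : (0 : ℝ) < d := by exact_mod_cast hd
  have hcont : Continuous fun φ => ∑ j, phaseVec φ θ j * u j :=
    continuous_finsetSum _ fun j _ => (continuous_phaseVec θ j).mul continuous_const
  rcases (Finset.sum_nonneg fun j _ => sq_nonneg (u j) :
    0 ≤ ∑ j, u j ^ 2).eq_or_lt with h0 | hpos
  · have hu : ∀ φ, ∑ j, phaseVec φ θ j * u j = 0 := by
      intro φ
      have := abs_sum_phaseVec_mul_le φ θ u
      rw [← h0, Real.sqrt_zero, mul_zero] at this
      exact abs_eq_zero.1 (le_antisymm this (abs_nonneg _))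
    simp_rw [hu]
    rw [zero_pow (by omega), integral_zero]
    positivity
  set q := ∑ j, u j ^ 2 with hq
  -- This `s` minimizes `exp (s² q / 4) / s ^ (2d)`, the bound without the correction factor.
  set s := 2 * √d / √q with hs
  have hqs : 0 < √q := Real.sqrt_pos.2 hpos
  have hs0 : 0 < s := by positivity
  have hs2 : s ^ 2 = 4 * d / q := by
    rw [hs, div_pow, mul_pow, Real.sq_sqrt hd'.le, Real.sq_sqrt hpos.le]; norm_num
  have hexp : ∀ r : ℝ, |r| = s → ∫ φ, Real.exp (r * ∑ j, phaseVec φ θ j * u j) ∂(phaseLaw n) ≤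
      Real.exp (d * Real.exp (2 * √(d * (L / n)))) := by
    intro r hr
    refine (integral_exp_sum_phaseVec_le hn θ u r).trans (Real.exp_le_exp.2 (le_of_eq ?_))
    rw [hr, ← sq_abs r, hr, hs2, ← hq, Real.sqrt_mul hd'.le]
    have e1 : 4 * (d : ℝ) / q * q / 4 = d := by field_simp
    have e2 : s * √q * √(L / n) = 2 * (√d * √(L / n)) := by rw [hs]; field_simp
    rw [e1, e2]
  have hintg : ∀ r : ℝ, Integrable (fun φ => Real.exp (r * ∑ j, phaseVec φ θ j * u j))
      (phaseLaw n) := by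
    intro r
    refine integrable_phaseLaw (by fun_prop) (C := Real.exp (|r| * (√(L * n) * √q))) fun φ => ?_
    rw [Real.abs_exp]
    refine Real.exp_le_exp.2 ((le_abs_self _).trans ?_)
    rw [abs_mul]
    exact mul_le_mul_of_nonneg_left (abs_sum_phaseVec_mul_le φ θ u) (abs_nonneg r)
  have hb : ∀ φ, (∑ j, phaseVec φ θ j * u j) ^ (2 * d) ≤
      ((2 * d).factorial / s ^ (2 * d)) * (Real.exp (s * ∑ j, phaseVec φ θ j * u j) +
        Real.exp (-s * ∑ j, phaseVec φ θ j * u j)) := by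
    intro φ
    have := pow_le_factorial_mul_exp (s * ∑ j, phaseVec φ θ j * u j) d
    rw [mul_pow] at this
    rw [div_mul_eq_mul_div, le_div_iff₀ (by positivity), neg_mul]
    linarith
  have hI : Integrable (fun φ => (∑ j, phaseVec φ θ j * u j) ^ (2 * d)) (phaseLaw n) := by
    refine integrable_phaseLaw (by fun_prop) (C := (√(L * n) * √q) ^ (2 * d)) fun φ => ?_
    rw [abs_pow]
    exact pow_le_pow_left₀ (abs_nonneg _) (abs_sum_phaseVec_mul_le φ θ u) _
  refine (integral_mono hI (((hintg s).add (hintg (-s))).const_mul _) hb).trans ?_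
  simp only [Pi.add_apply]
  rw [integral_const_mul, integral_add (hintg s) (hintg (-s))]
  have h1 := hexp s (abs_of_pos hs0)
  have h2 := hexp (-s) (by rw [abs_neg, abs_of_pos hs0])
  have h3 : (2 * d).factorial * (2 * Real.exp (d * Real.exp (2 * √(d * (L / n)))) / (4 * d) ^ d) *
      q ^ d = ((2 * d).factorial / s ^ (2 * d)) *
        (2 * Real.exp (d * Real.exp (2 * √(d * (L / n))))) := by
    rw [pow_mul s, hs2, div_pow]
    field_simp
  rw [h3]
  exact mul_le_mul_of_nonneg_left (by linarith) (by positivity)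

/-- Stirling's sequence is decreasing, so it is bounded by its value `exp 1 / √2` at one. Only the
loss `√d`, not an exponential one, is tolerable in the moment bound. -/
theorem factorial_mul_exp_le {d : ℕ} (hd : 1 ≤ d) :
    (d.factorial : ℝ) * Real.exp d ≤ Real.exp 1 * √d * (d : ℝ) ^ d := by
  have hd' : (0 : ℝ) < d := by exact_mod_cast hd
  have h := Stirling.stirlingSeq'_antitone (Nat.zero_le (d - 1))
  simp only [Function.comp, Nat.succ_eq_add_one, Nat.sub_add_cancel hd, zero_add,
    Stirling.stirlingSeq_one] at h
  rw [Stirling.stirlingSeq, div_le_iff₀ (by positivity), div_pow, ← Real.exp_nat_mul, mul_one,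
    Real.sqrt_mul (by norm_num)] at h
  have h2 : Real.exp 1 / √2 * (√2 * √d * ((d : ℝ) ^ d / Real.exp d)) =
      Real.exp 1 * √d * (d : ℝ) ^ d / Real.exp d := by
    field_simp
  rw [h2, le_div_iff₀ (Real.exp_pos _)] at h
  exact h

/-- An independent Gaussian vector `u` linearizes the overlap: the `2d`-th moment of `⟨v, u⟩` over
`u` is `(2d)! / (2^d d!)` times `|v|^(2d)`. After exchanging the integrals, the phases are
integrated first for fixed `u`, and then only moments of `|u|²` in dimension `2 L` remain. -/
theorem integral_phaseOverlap_pow_le (hn : 0 < n) (θ : Fin n → ℝ) {d : ℕ} (hd : 1 ≤ d) {s : ℝ}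
    (hs0 : 0 < s) (hs : s < 1) :
    ∫ φ, phaseOverlap L φ θ ^ d ∂(phaseLaw n) ≤
      d.factorial * (2 * (Real.exp 1 * √d) *
        (Real.exp (Real.exp (2 * √(d * (L / n))) - 1) / s) ^ d * ((1 - s)⁻¹) ^ L) := by
  have hd' : (0 : ℝ) < d := by exact_mod_cast hd
  set E := Real.exp (2 * √(d * (L / n))) with hE
  obtain ⟨hi, hle⟩ := integral_sum_sq_pow_le (ι := Fin L × Bool) hs0 hs d
  set K := ((2 * d).factorial : ℝ) / (2 ^ d * d.factorial) with hK
  have hK0 : 0 < K := by positivity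
  have hjoint : Integrable (fun z : (Fin n → ℝ) × (Fin L × Bool → ℝ) =>
      (∑ j, phaseVec z.1 θ j * z.2 j) ^ (2 * d)) ((phaseLaw n).prod (stdGauss (Fin L × Bool))) := by
    refine ((hi.comp_snd (phaseLaw n)).const_mul ((L * n : ℝ) ^ d)).mono' ?_
      (ae_of_all _ fun z => ?_)
    · refine Continuous.aestronglyMeasurable ?_
      refine (continuous_finsetSum _ fun j _ => ?_).pow _
      exact ((continuous_phaseVec θ j).comp continuous_fst).mul
        ((continuous_apply j).comp continuous_snd)
    · rw [Real.norm_eq_abs, abs_pow]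
      refine (pow_le_pow_left₀ (abs_nonneg _) (abs_sum_phaseVec_mul_le z.1 θ z.2) _).trans_eq ?_
      rw [pow_mul, mul_pow, Real.sq_sqrt (by positivity), Real.sq_sqrt (by positivity), mul_pow]
  -- Fubini: the same double integral, computed over `u` first on the left and over the phases first
  -- on the right.
  have h1 : K * ∫ φ, phaseOverlap L φ θ ^ d ∂(phaseLaw n) =
      ∫ u, ∫ φ, (∑ j, phaseVec φ θ j * u j) ^ (2 * d) ∂(phaseLaw n) ∂(stdGauss (Fin L × Bool)) := by
    rw [← integral_const_mul, ← integral_prod_symm _ hjoint, integral_prod _ hjoint]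
    simp_rw [integral_sum_pow_stdGauss, sum_phaseVec_sq, ← hK]
  have h2 : K * ∫ φ, phaseOverlap L φ θ ^ d ∂(phaseLaw n) ≤
      (2 * d).factorial * (2 * Real.exp (d * E) / (4 * d) ^ d) *
        (d.factorial * (2 / s) ^ d * (√(1 - s)⁻¹) ^ Fintype.card (Fin L × Bool)) := by
    rw [h1]
    refine (integral_mono hjoint.integral_prod_right (hi.const_mul _)
      fun u => integral_sum_phaseVec_pow_le hn θ u hd).trans ?_
    rw [integral_const_mul]
    exact mul_le_mul_of_nonneg_left hle (by positivity)
  have hcard : (√(1 - s)⁻¹) ^ Fintype.card (Fin L × Bool) = ((1 - s)⁻¹) ^ L := by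
    rw [Fintype.card_prod, Fintype.card_fin, Fintype.card_bool, mul_comm, pow_mul,
      Real.sq_sqrt (inv_nonneg.2 (by linarith))]
  rw [hcard, mul_comm K, ← le_div_iff₀ hK0] at h2
  refine h2.trans ?_
  have hst := factorial_mul_exp_le hd
  have hexp : Real.exp (d * E) = Real.exp (E - 1) ^ d * Real.exp d := by
    rw [← Real.exp_nat_mul, ← Real.exp_add]; congr 1; ring
  have e : ((2 * d).factorial * (2 * Real.exp (d * E) / (4 * d) ^ d) *
        (d.factorial * (2 / s) ^ d * ((1 - s)⁻¹) ^ L)) / K =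
      d.factorial * (2 * (d.factorial * Real.exp d / d ^ d) *
        (Real.exp (E - 1) / s) ^ d * ((1 - s)⁻¹) ^ L) := by
    rw [hK, hexp, div_pow, div_pow, mul_pow, show (4 : ℝ) ^ d = 2 ^ d * 2 ^ d by
      rw [← mul_pow]; norm_num]
    field_simp
  rw [e]
  have h1s : 0 < (1 - s)⁻¹ := inv_pos.2 (by linarith)
  gcongr
  rw [div_le_iff₀ (by positivity)]
  exact hst

end Overlap

/-! ### Hermitian matrices and real arrays -/

section Hermitian

variable {n : ℕ}

/-- The adjoint of `hermitianOf`. -/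
def toArr (A : CMat n) : Fin n → Fin n → ℝ := fun i j =>
  if i = j then (A i i).re
  else if i < j then ((A i j).re + (A j i).re) / √2
  else ((A j i).im - (A i j).im) / √2

/-- A Hermitian entry above the diagonal mixes the array entries at `(i, j)` and `(j, i)`, so sums
are only comparable after pairing these two positions. -/
theorem sum_sum_le_of_symm {x y : Fin n → Fin n → ℝ}
    (h : ∀ i j, i ≤ j → x i j + x j i ≤ y i j + y j i) : ∑ i, ∑ j, x i j ≤ ∑ i, ∑ j, y i j := by
  have hx : ∑ i, ∑ j, x i j = (∑ i, ∑ j, (x i j + x j i)) / 2 := by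
    simp_rw [Finset.sum_add_distrib]
    rw [Finset.sum_comm (f := fun i j => x j i)]; ring
  have hy : ∑ i, ∑ j, y i j = (∑ i, ∑ j, (y i j + y j i)) / 2 := by
    simp_rw [Finset.sum_add_distrib]
    rw [Finset.sum_comm (f := fun i j => y j i)]; ring
  rw [hx, hy]
  refine div_le_div_of_nonneg_right (Finset.sum_le_sum fun i _ => Finset.sum_le_sum fun j _ => ?_)
    (by norm_num)
  rcases le_total i j with hij | hij
  · exact h i j hij
  · linarith [h j i hij]

theorem sum_sum_eq_of_symm {x y : Fin n → Fin n → ℝ}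
    (h : ∀ i j, i ≤ j → x i j + x j i = y i j + y j i) : ∑ i, ∑ j, x i j = ∑ i, ∑ j, y i j :=
  le_antisymm (sum_sum_le_of_symm fun i j hij => (h i j hij).le)
    (sum_sum_le_of_symm fun i j hij => (h i j hij).ge)

theorem hermitianOf_re (g : Fin n → Fin n → ℝ) (i j : Fin n) :
    (hermitianOf g i j).re =
      if i = j then g i i else if i < j then g i j / √2 else g j i / √2 := by
  unfold hermitianOf
  split_ifs <;> simp

theorem hermitianOf_im (g : Fin n → Fin n → ℝ) (i j : Fin n) :
    (hermitianOf g i j).im =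
      if i = j then 0 else if i < j then g j i / √2 else -(g i j / √2) := by
  unfold hermitianOf
  split_ifs <;> simp [neg_div]

/-- The map `hermitianOf` is an isometry onto Hermitian matrices, so its adjoint inverts it there.
-/
theorem hermitianOf_toArr {A : CMat n} (hA : ∀ i j, A j i = star (A i j)) :
    hermitianOf (toArr A) = A := by
  have h2 : √2 ^ 2 = (2 : ℝ) := Real.sq_sqrt (by norm_num)
  have hs : √2 ≠ (0 : ℝ) := by positivity
  funext i j
  have hre : (A j i).re = (A i j).re := by rw [hA]; simp
  have him : (A j i).im = -(A i j).im := by rw [hA]; simp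
  refine Complex.ext ?_ ?_
  · rw [hermitianOf_re]
    split_ifs with h1 h2'
    · subst h1; simp [toArr]
    · simp only [toArr, if_neg h1, if_pos h2', hre]
      field_simp; rw [h2]; ring
    · have h3 : j < i := lt_of_le_of_ne (not_lt.1 h2') (Ne.symm h1)
      simp only [toArr, if_neg (Ne.symm h1), if_pos h3, hre]
      field_simp; rw [h2]; ring
  · rw [hermitianOf_im]
    split_ifs with h1 h2'
    · subst h1; linarith
    · simp only [toArr, if_neg (Ne.symm h1), if_neg (not_lt.2 h2'.le), him]
      field_simp; rw [h2]; ring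
    · simp only [toArr, if_neg h1, if_neg h2', him]
      field_simp; rw [h2]; ring

theorem frobInner_eq (A B : CMat n) :
    frobInner A B = ∑ i, ∑ j, ((A i j).re * (B i j).re + (A i j).im * (B i j).im) := by
  simp [frobInner]

theorem frobInner_hermitianOf (A : CMat n) (g : Fin n → Fin n → ℝ) :
    frobInner A (hermitianOf g) = ∑ i, ∑ j, toArr A i j * g i j := by
  have hs : √2 ≠ (0 : ℝ) := by positivity
  rw [frobInner_eq]
  refine sum_sum_eq_of_symm fun i j hij => ?_
  simp only [hermitianOf_re, hermitianOf_im, toArr]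
  rcases hij.eq_or_lt with rfl | h
  · simp
  · simp only [if_neg h.ne, if_neg h.ne', if_pos h, if_neg (not_lt.2 h.le)]
    field_simp
    ring

theorem frobNorm_sq (A : CMat n) : frobNorm A ^ 2 = ∑ i, ∑ j, ‖A i j‖ ^ 2 :=
  Real.sq_sqrt (by positivity)

theorem frobNorm_nonneg (A : CMat n) : 0 ≤ frobNorm A := Real.sqrt_nonneg _

/-- The adjoint of an isometry is a contraction. The inequality allows estimators that are not
Hermitian. -/
theorem sum_toArr_sq_le (A : CMat n) : ∑ i, ∑ j, toArr A i j ^ 2 ≤ frobNorm A ^ 2 := by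
  have h2 : √2 ^ 2 = (2 : ℝ) := Real.sq_sqrt (by norm_num)
  rw [frobNorm_sq]
  refine sum_sum_le_of_symm fun i j hij => ?_
  simp only [Complex.sq_norm, Complex.normSq_apply, toArr]
  rcases hij.eq_or_lt with rfl | h
  · simp
    nlinarith [mul_self_nonneg (A i i).im]
  · simp only [if_neg h.ne, if_neg h.ne', if_pos h, if_neg (not_lt.2 h.le), div_pow, h2]
    nlinarith [sq_nonneg ((A i j).re - (A j i).re), sq_nonneg ((A i j).im + (A j i).im)]

theorem hermitianOf_add (g h : Fin n → Fin n → ℝ) :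
    hermitianOf (g + h) = hermitianOf g + hermitianOf h := by
  funext i j
  refine Complex.ext ?_ ?_
  · simp only [Pi.add_apply, Complex.add_re, hermitianOf_re]
    split_ifs <;> ring
  · simp only [Pi.add_apply, Complex.add_im, hermitianOf_im]
    split_ifs <;> ring

theorem hermitianOf_smul (a : ℝ) (g : Fin n → Fin n → ℝ) :
    hermitianOf (a • g) = a • hermitianOf g := by
  funext i j
  refine Complex.ext ?_ ?_
  · simp only [Pi.smul_apply, Complex.smul_re, hermitianOf_re, smul_eq_mul]
    split_ifs <;> ring
  · simp only [Pi.smul_apply, Complex.smul_im, hermitianOf_im, smul_eq_mul]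
    split_ifs <;> ring

end Hermitian

/-! ### The signal in the coordinates of the noise. -/

section Signal

variable {L n : ℕ}

/-- The array of the signal in the coordinates of the noise. -/
def signalArr (lam : ℝ) (φ : Fin n → ℝ) : Fin L → Fin n → Fin n → ℝ :=
  fun k => toArr (signal lam φ k)

theorem signal_hermitian (lam : ℝ) (φ : Fin n → ℝ) (k : Fin L) (i j : Fin n) :
    signal lam φ k j i = star (signal lam φ k i j) := by
  simp only [signal, star_mul', RCLike.star_def, Complex.conj_conj, Complex.conj_ofReal]
  ring

theorem noise_signalArr (lam : ℝ) (φ : Fin n → ℝ) :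
    noise (signalArr (L := L) lam φ) = signal lam φ := by
  funext k
  exact hermitianOf_toArr (signal_hermitian lam φ k)

theorem noise_add (g h : Fin L → Fin n → Fin n → ℝ) : noise (g + h) = noise g + noise h := by
  funext k; exact hermitianOf_add _ _

theorem noise_smul (a : ℝ) (g : Fin L → Fin n → Fin n → ℝ) : noise (a • g) = a • noise g := by
  funext k; exact hermitianOf_smul _ _

theorem observe_eq_add (lam : ℝ) (φ : Fin n → ℝ) (g : Fin L → Fin n → Fin n → ℝ) :
    observe lam φ g = signal lam φ + noise g := rfl

/-- The observation is a linear image of a shifted standard Gaussian array; this puts the model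
within reach of the bound for random shifts. -/
theorem observe_eq_noise (lam : ℝ) (φ : Fin n → ℝ) (g : Fin L → Fin n → Fin n → ℝ) :
    observe lam φ g = noise (g + signalArr lam φ) := by
  rw [noise_add, noise_signalArr, observe_eq_add, add_comm]

theorem signal_eq_smul (lam : ℝ) (φ : Fin n → ℝ) :
    signal (L := L) lam φ = lam • signal 1 φ := by
  funext k i j
  simp only [signal, Pi.smul_apply, Complex.real_smul]
  push_cast
  ring

theorem norm_signal (lam : ℝ) (φ : Fin n → ℝ) (k : Fin L) (i j : Fin n) :
    ‖signal lam φ k i j‖ = |lam| / √n := by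
  have h : ∀ x : ℝ, ‖Complex.exp (Complex.I * x)‖ = 1 := by
    intro x; rw [mul_comm, Complex.norm_exp_ofReal_mul_I]
  simp only [signal, norm_mul, norm_star, norm_pow, h, one_pow, mul_one, Complex.norm_real,
    Real.norm_eq_abs, abs_div, abs_of_nonneg (Real.sqrt_nonneg _)]

theorem frobNorm_signal (lam : ℝ) (φ : Fin n → ℝ) (k : Fin L) :
    frobNorm (signal lam φ k) = |lam| * √n := by
  rcases Nat.eq_zero_or_pos n with rfl | hn
  · simp [frobNorm]
  have hn' : (0 : ℝ) < n := by exact_mod_cast hn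
  unfold frobNorm
  simp only [norm_signal, Finset.sum_const, Finset.card_univ, Fintype.card_fin, nsmul_eq_mul]
  rw [show (n : ℝ) * (n * (|lam| / √n) ^ 2) = (|lam| * √n) ^ 2 by
    rw [div_pow, mul_pow, Real.sq_sqrt hn'.le]; field_simp]
  exact Real.sqrt_sq (by positivity)

theorem frobInner_signal (lam : ℝ) (φ θ : Fin n → ℝ) (k : Fin L) :
    frobInner (signal lam φ k) (signal lam θ k) = lam ^ 2 * (‖phaseSum k φ θ‖ ^ 2 / n) := by
  have e : ∀ i j, signal lam φ k i j * star (signal lam θ k i j) =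
      ((lam ^ 2 / n : ℝ) : ℂ) *
        (Complex.exp (Complex.I * ((((k : ℕ) + 1 : ℤ) : ℂ) * ((φ i - θ i : ℝ) : ℂ))) *
        (starRingEnd ℂ)
          (Complex.exp (Complex.I * ((((k : ℕ) + 1 : ℤ) : ℂ) * ((φ j - θ j : ℝ) : ℂ))))) := by
    intro i j
    have hsq : (lam / √n) * (lam / √n) = lam ^ 2 / n := by
      rw [div_mul_div_comm, Real.mul_self_sqrt (Nat.cast_nonneg n), sq]
    rw [← hsq]
    simp only [signal, ← Complex.exp_nat_mul, star_mul', RCLike.star_def,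
      ← Complex.exp_conj, Complex.ofReal_mul, map_mul, Complex.conj_ofReal, Complex.conj_I,
      map_natCast, map_intCast, map_neg, neg_neg]
    rw [show ∀ a b c d e f : ℂ, a * (b * c) * (d * (e * f)) = a * d * ((b * c) * (e * f)) by
      intros; ring]
    simp only [← Complex.exp_add]
    congr 2
    push_cast
    ring
  unfold frobInner
  simp_rw [e, ← Finset.mul_sum]
  rw [← Finset.sum_mul, ← map_sum]
  change ((((lam ^ 2 / n : ℝ) : ℂ) * (phaseSum k φ θ * (starRingEnd ℂ) (phaseSum k φ θ))).re = _)
  rw [Complex.mul_conj', ← Complex.ofReal_pow, ← Complex.ofReal_mul, Complex.ofReal_re]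
  ring

theorem sum_signalArr_mul (lam : ℝ) (φ θ : Fin n → ℝ) :
    ∑ k : Fin L, ∑ i, ∑ j, signalArr lam φ k i j * signalArr lam θ k i j =
      lam ^ 2 * phaseOverlap L φ θ := by
  rw [phaseOverlap, Finset.sum_div, Finset.mul_sum]
  refine Finset.sum_congr rfl fun k _ => ?_
  rw [← frobInner_signal]
  refine (frobInner_hermitianOf _ _).symm.trans ?_
  congr 1
  exact hermitianOf_toArr (signal_hermitian lam θ k)

theorem continuous_signal (lam : ℝ) (k : Fin L) (i j : Fin n) :
    Continuous fun φ : Fin n → ℝ => signal lam φ k i j := by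
  unfold signal; fun_prop

theorem measurable_signalArr (lam : ℝ) :
    Measurable (signalArr lam : (Fin n → ℝ) → Fin L → Fin n → Fin n → ℝ) := by
  refine measurable_pi_iff.2 fun k => measurable_pi_iff.2 fun i => measurable_pi_iff.2 fun j => ?_
  have h := fun i j => (continuous_signal (n := n) lam k i j).measurable
  have hre := fun i j => Complex.measurable_re.comp (h i j)
  have him := fun i j => Complex.measurable_im.comp (h i j)
  simp only [Function.comp_def] at hre him
  simp only [signalArr, toArr]
  split_ifs
  · exact hre _ _
  · exact ((hre _ _).add (hre _ _)).div_const _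
  · exact ((him _ _).sub (him _ _)).div_const _

theorem abs_signalArr_le (lam : ℝ) (φ : Fin n → ℝ) (k : Fin L) (i j : Fin n) :
    |signalArr lam φ k i j| ≤ |lam| * √n := by
  have h := sum_toArr_sq_le (signal lam φ k)
  rw [frobNorm_signal] at h
  refine abs_le_of_sq_le_sq ?_ (by positivity)
  refine le_trans ?_ h
  refine (Finset.single_le_sum (f := fun j => toArr (signal lam φ k) i j ^ 2)
    (fun j _ => sq_nonneg _) (Finset.mem_univ j)).trans ?_
  exact Finset.single_le_sum (f := fun i => ∑ j, toArr (signal lam φ k) i j ^ 2)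
    (fun i _ => Finset.sum_nonneg fun j _ => sq_nonneg _) (Finset.mem_univ i)

theorem measurable_noise : Measurable (noise : (Fin L → Fin n → Fin n → ℝ) → Obs L n) := by
  refine measurable_pi_iff.2 fun k => measurable_pi_iff.2 fun i => measurable_pi_iff.2 fun j => ?_
  simp only [noise, hermitianOf]
  split_ifs <;> fun_prop

theorem measurable_observe (lam : ℝ) :
    Measurable fun z : (Fin n → ℝ) × (Fin L → Fin n → Fin n → ℝ) => observe lam z.1 z.2 := by
  simp_rw [observe_eq_noise]
  exact measurable_noise.comp (measurable_snd.add ((measurable_signalArr lam).comp measurable_fst))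

instance : IsProbabilityMeasure (gaussArrayLaw L n) := by
  unfold gaussArrayLaw; infer_instance

instance : IsProbabilityMeasure (nullLaw L n) :=
  Measure.isProbabilityMeasure_map measurable_noise.aemeasurable

instance (lam : ℝ) : IsProbabilityMeasure (plantedLaw L n lam) :=
  Measure.isProbabilityMeasure_map (measurable_observe lam).aemeasurable

end Signal

/-! ### Representation of the hidden-sample laws -/

theorem pi_map_curry {α β X : Type*} [Fintype α] [Fintype β] [MeasurableSpace X] (μ : Measure X)
    [IsProbabilityMeasure μ] :
    (Measure.pi fun _ : α × β => μ).map Function.curry =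
      Measure.pi fun _ : α => Measure.pi fun _ : β => μ := by
  have := Measure.infinitePi_map_curry (fun (_ : α) (_ : β) => μ)
  simp only [Measure.infinitePi_eq_pi] at this
  exact this

theorem stdGauss_map_curry (L n : ℕ) :
    (stdGauss (Fin L × Fin n × Fin n)).map (fun g k i j => g (k, i, j)) = gaussArrayLaw L n := by
  have h1 := pi_map_curry (α := Fin L) (β := Fin n × Fin n) (gaussianReal 0 1)
  have h2 := pi_map_curry (α := Fin n) (β := Fin n) (gaussianReal 0 1)
  rw [gaussArrayLaw, ← h2, ← Measure.pi_map_pi (fun _ => by fun_prop), ← h1, stdGauss,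
    Measure.map_map (by fun_prop) (by fun_prop)]
  rfl

section HiddenLaws

variable {M L n : ℕ}

theorem pi_gaussArrayLaw_eq_map :
    (Measure.pi fun _ : Fin M => gaussArrayLaw L n) =
      (stdGauss (Fin M × Fin L × Fin n × Fin n)).map fun g m k i j => g (m, k, i, j) := by
  have h1 := pi_map_curry (α := Fin M) (β := Fin L × Fin n × Fin n) (gaussianReal 0 1)
  have hm : Measurable fun (g : Fin L × Fin n × Fin n → ℝ) (k : Fin L) (i j : Fin n) =>
    g (k, i, j) := by fun_prop
  rw [← stdGauss_map_curry L n, ← Measure.pi_map_pi fun _ => hm.aemeasurable]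
  unfold stdGauss
  rw [← h1, Measure.map_map (by fun_prop) (by fun_prop)]
  rfl

theorem measurable_pi_noise :
    Measurable fun (g : Fin M → Fin L → Fin n → Fin n → ℝ) m => (noise (g m) : Obs L n) :=
  measurable_pi_iff.2 fun m => measurable_noise.comp (measurable_pi_apply m)

theorem hiddenNull_eq_map_pi :
    hiddenNull M L n =
      (Measure.pi fun _ : Fin M => gaussArrayLaw L n).map fun g m => noise (g m) := by
  unfold hiddenNull nullLaw
  rw [← Measure.pi_map_pi fun _ => measurable_noise.aemeasurable]

theorem hiddenNull_eq_map :
    hiddenNull M L n = (stdGauss (Fin M × Fin L × Fin n × Fin n)).map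
      fun g m => noise fun k i j => g (m, k, i, j) := by
  rw [hiddenNull_eq_map_pi, pi_gaussArrayLaw_eq_map,
    Measure.map_map measurable_pi_noise (by fun_prop)]
  rfl

theorem plantedLaw_apply (lam : ℝ) {s : Set (Obs L n)} (hs : MeasurableSet s) :
    plantedLaw L n lam s = ∫⁻ φ, gaussArrayLaw L n
      {g | noise (g + signalArr lam φ) ∈ s} ∂(phaseLaw n) := by
  rw [plantedLaw, Measure.map_apply (measurable_observe lam) hs,
    Measure.prod_apply (measurable_observe lam hs)]
  refine lintegral_congr fun φ => ?_
  congr 1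
  ext g
  simp [observe_eq_noise]

theorem measurable_hidden_shift (lam : ℝ) (κ : Fin M) :
    Measurable fun (z : (Fin n → ℝ) × (Fin M → Fin L → Fin n → Fin n → ℝ)) (m : Fin M) =>
      (noise (z.2 m + if m = κ then signalArr lam z.1 else 0) : Obs L n) := by
  refine measurable_pi_iff.2 fun m => measurable_noise.comp ?_
  refine Measurable.add (by fun_prop) ?_
  split_ifs
  · exact (measurable_signalArr lam).comp measurable_fst
  · exact measurable_const

/-- One set of phases and `M` independent Gaussian arrays, with the shift inserted only at position
`κ`. The two laws are compared on boxes, where they factorize once the phases are fixed. -/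
theorem pi_planted_eq_map (lam : ℝ) (κ : Fin M) :
    (Measure.pi fun m => if m = κ then plantedLaw L n lam else nullLaw L n) =
      ((phaseLaw n).prod (Measure.pi fun _ : Fin M => gaussArrayLaw L n)).map
        fun z m => noise (z.2 m + if m = κ then signalArr lam z.1 else 0) := by
  have hp : ∀ m, IsProbabilityMeasure (if m = κ then plantedLaw L n lam else nullLaw L n) := by
    intro m; split_ifs <;> infer_instance
  refine Measure.pi_eq fun s hs => ?_
  have hbox : MeasurableSet (Set.univ.pi s) := MeasurableSet.univ_pi hs
  rw [Measure.map_apply (measurable_hidden_shift lam κ) hbox,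
    Measure.prod_apply (measurable_hidden_shift lam κ hbox)]
  have e : ∀ φ : Fin n → ℝ, (Measure.pi fun _ : Fin M => gaussArrayLaw L n) (Prod.mk φ ⁻¹'
      ((fun (z : (Fin n → ℝ) × (Fin M → Fin L → Fin n → Fin n → ℝ)) (m : Fin M) =>
        (noise (z.2 m + if m = κ then signalArr lam z.1 else 0) : Obs L n)) ⁻¹' Set.univ.pi s)) =
      gaussArrayLaw L n {g | noise (g + signalArr lam φ) ∈ s κ} *
        ∏ m ∈ Finset.univ.erase κ, nullLaw L n (s m) := by
    intro φ
    have h1 : (Prod.mk φ ⁻¹'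
      ((fun (z : (Fin n → ℝ) × (Fin M → Fin L → Fin n → Fin n → ℝ)) (m : Fin M) =>
        (noise (z.2 m + if m = κ then signalArr lam z.1 else 0) : Obs L n)) ⁻¹' Set.univ.pi s)) =
        Set.univ.pi fun m => {g | noise (g + if m = κ then signalArr lam φ else 0) ∈ s m} := by
      ext g; simp
    rw [h1, Measure.pi_pi, ← Finset.mul_prod_erase _ _ (Finset.mem_univ κ)]
    simp only [if_true]
    congr 1
    refine Finset.prod_congr rfl fun m hm => ?_
    simp only [if_neg (Finset.ne_of_mem_erase hm), add_zero]
    rw [nullLaw, Measure.map_apply measurable_noise (hs m)]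
    rfl
  simp_rw [e]
  have hmeas : Measurable fun φ => gaussArrayLaw L n {g | noise (g + signalArr lam φ) ∈ s κ} := by
    have : MeasurableSet {z : (Fin n → ℝ) × (Fin L → Fin n → Fin n → ℝ) |
        noise (z.2 + signalArr lam z.1) ∈ s κ} := by
      have h := measurable_observe (L := L) (n := n) lam (hs κ)
      simpa [Set.preimage, observe_eq_noise] using h
    exact measurable_measure_prodMk_left this
  rw [lintegral_mul_const _ hmeas, ← plantedLaw_apply lam (hs κ),
    ← Finset.mul_prod_erase _ _ (Finset.mem_univ κ)]
  simp only [if_true]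
  congr 1
  exact Finset.prod_congr rfl fun m hm => by rw [if_neg (Finset.ne_of_mem_erase hm)]

end HiddenLaws

/-! ### The low-degree advantage of the hidden-sample problem -/

section Advantage

variable {M L n : ℕ}

/-- The coordinates of the noise as linear forms in the underlying Gaussian array. -/
def coordForm : Fin M × Fin L × Fin n × Fin n × Bool →
    MvPolynomial (Fin M × Fin L × Fin n × Fin n) ℝ
  | (m, k, i, j, true) =>
      if i = j then MvPolynomial.X (m, k, i, i)
      else if i < j then MvPolynomial.C (√2)⁻¹ * MvPolynomial.X (m, k, i, j)
      else MvPolynomial.C (√2)⁻¹ * MvPolynomial.X (m, k, j, i)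
  | (m, k, i, j, false) =>
      if i = j then 0
      else if i < j then MvPolynomial.C (√2)⁻¹ * MvPolynomial.X (m, k, j, i)
      else MvPolynomial.C (-(√2)⁻¹) * MvPolynomial.X (m, k, i, j)

theorem totalDegree_coordForm_le (c : Fin M × Fin L × Fin n × Fin n × Bool) :
    (coordForm c).totalDegree ≤ 1 := by
  have h : ∀ (a : ℝ) (x : Fin M × Fin L × Fin n × Fin n),
      (MvPolynomial.C a * MvPolynomial.X x).totalDegree ≤ 1 := fun a x =>
    (MvPolynomial.totalDegree_mul _ _).trans (by simp)
  obtain ⟨m, k, i, j, b⟩ := c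
  cases b <;> simp only [coordForm] <;> split_ifs <;> first | exact h _ _ | simp

theorem eval_coordForm (g : Fin M × Fin L × Fin n × Fin n → ℝ)
    (c : Fin M × Fin L × Fin n × Fin n × Bool) :
    MvPolynomial.eval g (coordForm c) =
      hiddenCoord (fun m => noise fun k i j => g (m, k, i, j)) c := by
  obtain ⟨m, k, i, j, b⟩ := c
  cases b
  · simp only [coordForm, hiddenCoord, noise, hermitianOf_im]
    split_ifs <;> simp <;> ring
  · simp only [coordForm, hiddenCoord, noise, hermitianOf_re]
    split_ifs <;> simp <;> ring

/-- Needed because polynomials in the matrix entries are rewritten as polynomials in the Gaussian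
array: a linear substitution does not raise the degree. -/
theorem totalDegree_bind₁_le {σ τ : Type*} (f : σ → MvPolynomial τ ℝ)
    (hf : ∀ i, (f i).totalDegree ≤ 1) (p : MvPolynomial σ ℝ) :
    (MvPolynomial.bind₁ f p).totalDegree ≤ p.totalDegree := by
  rw [MvPolynomial.bind₁, MvPolynomial.aeval_eq_eval₂Hom, MvPolynomial.coe_eval₂Hom,
    MvPolynomial.eval₂_eq]
  refine MvPolynomial.totalDegree_finsetSum_le fun s hs => ?_
  refine (MvPolynomial.totalDegree_mul _ _).trans ?_
  rw [MvPolynomial.algebraMap_eq, MvPolynomial.totalDegree_C, zero_add]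
  refine (MvPolynomial.totalDegree_finsetProd _ _).trans ?_
  refine le_trans (Finset.sum_le_sum fun i _ => ?_) (MvPolynomial.le_totalDegree hs)
  exact (MvPolynomial.totalDegree_pow _ _).trans (by simpa using Nat.mul_le_mul_left (s i) (hf i))

/-- The uniform mixture over the position of the hidden sample, together with the phases. -/
def hiddenParam (M n : ℕ) : Measure (Fin M × (Fin n → ℝ)) :=
  (M : ENNReal)⁻¹ • ∑ κ : Fin M, (phaseLaw n).map (Prod.mk κ)

/-- The shift of the Gaussian array under the planted law of the hidden-sample problem. -/
def hiddenShift (L : ℕ) (lam : ℝ) (z : Fin M × (Fin n → ℝ)) : Fin M × Fin L × Fin n × Fin n → ℝ :=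
  fun c => if c.1 = z.1 then signalArr lam z.2 c.2.1 c.2.2.1 c.2.2.2 else 0

theorem integral_hiddenParam {f : Fin M × (Fin n → ℝ) → ℝ} (hf : Measurable f)
    (hi : ∀ κ, Integrable (fun φ => f (κ, φ)) (phaseLaw n)) :
    ∫ z, f z ∂(hiddenParam M n) = (M : ℝ)⁻¹ * ∑ κ, ∫ φ, f (κ, φ) ∂(phaseLaw n) := by
  have hm : ∀ κ : Fin M, Measurable (Prod.mk κ : (Fin n → ℝ) → Fin M × (Fin n → ℝ)) :=
    fun κ => measurable_prodMk_left
  rw [hiddenParam, integral_smul_measure, integral_finsetSum_measure]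
  · simp only [ENNReal.toReal_inv, ENNReal.toReal_natCast, smul_eq_mul]
    congr 1
    refine Finset.sum_congr rfl fun κ _ => ?_
    rw [integral_map (hm κ).aemeasurable hf.aestronglyMeasurable]
  · intro κ _
    rw [integrable_map_measure hf.aestronglyMeasurable (hm κ).aemeasurable]
    exact hi κ

theorem isProbabilityMeasure_hiddenParam (hM : 1 ≤ M) :
    IsProbabilityMeasure (hiddenParam M n) := by
  have hm : ∀ κ : Fin M, Measurable (Prod.mk κ : (Fin n → ℝ) → Fin M × (Fin n → ℝ)) :=
    fun κ => measurable_prodMk_left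
  refine ⟨?_⟩
  have : ∀ κ : Fin M, ((phaseLaw n).map (Prod.mk κ)) Set.univ = 1 := fun κ => by
    rw [Measure.map_apply (hm κ) MeasurableSet.univ]; simp
  simp only [hiddenParam, Measure.smul_apply, Measure.finsetSum_apply, this, smul_eq_mul]
  simp only [Finset.sum_const, Finset.card_univ, Fintype.card_fin, nsmul_eq_mul, mul_one]
  exact ENNReal.inv_mul_cancel (by simpa using by omega) (by simp)

theorem measurable_hiddenShift (lam : ℝ) :
    Measurable (hiddenShift (M := M) (n := n) L lam) := by
  refine measurable_pi_iff.2 fun c => ?_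
  refine Measurable.ite (measurableSet_eq_fun measurable_const measurable_fst) ?_ measurable_const
  have := (measurable_signalArr (L := L) (n := n) lam).comp
    (measurable_snd : Measurable (Prod.snd : Fin M × (Fin n → ℝ) → _))
  exact (measurable_pi_apply _).comp ((measurable_pi_apply _).comp ((measurable_pi_apply _).comp this))

theorem hiddenPlanted_eq_map (lam : ℝ) :
    hiddenPlanted M L n lam =
      ((hiddenParam M n).prod (stdGauss (Fin M × Fin L × Fin n × Fin n))).map
        fun z m => noise fun k i j => (z.2 + hiddenShift L lam z.1) (m, k, i, j) := by
  have hm : ∀ κ : Fin M, Measurable (Prod.mk κ : (Fin n → ℝ) → Fin M × (Fin n → ℝ)) :=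
    fun κ => measurable_prodMk_left
  have hmn : Measurable fun (g : Fin M × Fin L × Fin n × Fin n → ℝ) (m : Fin M) =>
      (noise fun k i j => g (m, k, i, j) : Obs L n) :=
    measurable_pi_iff.2 fun m => measurable_noise.comp (by fun_prop)
  have hmp : Measurable fun (z : (Fin M × (Fin n → ℝ)) × (Fin M × Fin L × Fin n × Fin n → ℝ))
      (m : Fin M) => (noise fun k i j => (z.2 + hiddenShift L lam z.1) (m, k, i, j) : Obs L n) :=
    hmn.comp (measurable_snd.add ((measurable_hiddenShift lam).comp measurable_fst))
  have hcur : Measurable fun (g : Fin M × Fin L × Fin n × Fin n → ℝ) (m : Fin M) (k : Fin L)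
    (i j : Fin n) => g (m, k, i, j) := by fun_prop
  ext s hs
  rw [Measure.map_apply hmp hs, Measure.prod_apply (hmp hs), hiddenParam, lintegral_smul_measure,
    lintegral_finsetSum_measure, hiddenPlanted, Measure.smul_apply, Measure.finsetSum_apply]
  congr 1
  refine Finset.sum_congr rfl fun κ _ => ?_
  rw [lintegral_map (measurable_measure_prodMk_left (hmp hs)) (hm κ), pi_planted_eq_map,
    Measure.map_apply (measurable_hidden_shift lam κ) hs,
    Measure.prod_apply (measurable_hidden_shift lam κ hs)]
  refine lintegral_congr fun φ => ?_
  rw [pi_gaussArrayLaw_eq_map, Measure.map_apply hcur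
    (measurable_prodMk_left (measurable_hidden_shift lam κ hs))]
  congr 1
  ext g
  simp only [Set.mem_preimage]
  refine iff_of_eq (congrArg (· ∈ s) (funext fun m => congrArg noise ?_))
  funext k i j
  simp only [hiddenShift, Pi.add_apply]
  split_ifs <;> rfl

theorem abs_hiddenShift_le (lam : ℝ) (z : Fin M × (Fin n → ℝ)) (c) :
    |hiddenShift L lam z c| ≤ |lam| * √n := by
  unfold hiddenShift
  split_ifs
  · exact abs_signalArr_le _ _ _ _ _
  · simp; positivity

theorem sum_hiddenShift_mul (lam : ℝ) (z w : Fin M × (Fin n → ℝ)) :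
    ∑ c, hiddenShift L lam z c * hiddenShift L lam w c =
      if z.1 = w.1 then lam ^ 2 * phaseOverlap L z.2 w.2 else 0 := by
  rw [Fintype.sum_prod_type]
  simp only [hiddenShift, Fintype.sum_prod_type]
  rw [Finset.sum_eq_single z.1]
  · by_cases h : z.1 = w.1
    · simp only [h, if_true]
      exact sum_signalArr_mul lam z.2 w.2
    · simp [h]
  · intro m _ hm
    simp [hm]
  · simp

/-- Shifts at different positions are orthogonal, so beyond the degree-zero term only the event of
equal positions, of probability `1 / M`, contributes. -/
theorem integral_hiddenShift_eq (hM : 1 ≤ M) (lam : ℝ) (D : ℕ) :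
    ∫ z, ∫ w, ∑ d ∈ Finset.range (D + 1),
        (∑ c, hiddenShift L lam z c * hiddenShift L lam w c) ^ d / (d.factorial : ℝ)
        ∂(hiddenParam M n) ∂(hiddenParam M n) =
      1 + (M : ℝ)⁻¹ * ∑ d ∈ Finset.Icc 1 D, lam ^ (2 * d) / d.factorial *
        ∫ θ, ∫ φ, phaseOverlap L φ θ ^ d ∂(phaseLaw n) ∂(phaseLaw n) := by
  have hM' : (M : ℝ) ≠ 0 := by exact_mod_cast (by omega : M ≠ 0)
  have hc := continuous_phaseOverlap (L := L) (n := n)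
  have hcθ : ∀ θ : Fin n → ℝ, Continuous fun φ => phaseOverlap L φ θ := fun θ => by
    unfold phaseOverlap phaseSum; fun_prop
  have hbd : ∀ (d : ℕ) (φ θ : Fin n → ℝ), |phaseOverlap L φ θ ^ d| ≤ ((L : ℝ) * n) ^ d := by
    intro d φ θ
    rw [abs_pow, abs_of_nonneg (phaseOverlap_nonneg φ θ)]
    exact pow_le_pow_left₀ (phaseOverlap_nonneg φ θ) (phaseOverlap_le φ θ) d
  have hintg : ∀ (d : ℕ) (θ : Fin n → ℝ),
      Integrable (fun φ => phaseOverlap L φ θ ^ d) (phaseLaw n) := fun d θ =>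
    integrable_phaseLaw ((hcθ θ).pow d) fun φ => hbd d φ θ
  have hmeas : ∀ d : ℕ, Measurable fun θ => ∫ φ, phaseOverlap L φ θ ^ d ∂(phaseLaw n) := by
    intro d
    have : StronglyMeasurable fun z : (Fin n → ℝ) × (Fin n → ℝ) => phaseOverlap L z.2 z.1 ^ d :=
      ((hc.comp continuous_swap).pow d).stronglyMeasurable
    exact this.integral_prod_right.measurable
  have hintg2 : ∀ d : ℕ, Integrable (fun θ => ∫ φ, phaseOverlap L φ θ ^ d ∂(phaseLaw n))
      (phaseLaw n) := by
    intro d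
    refine Integrable.of_bound (hmeas d).aestronglyMeasurable (((L : ℝ) * n) ^ d)
      (ae_of_all _ fun θ => ?_)
    refine (norm_integral_le_of_norm_le_const (ae_of_all _ fun φ => hbd d φ θ)).trans_eq ?_
    simp
  set H : (Fin n → ℝ) → ℝ := fun θ => ∑ d ∈ Finset.Icc 1 D, lam ^ (2 * d) / d.factorial *
    ∫ φ, phaseOverlap L φ θ ^ d ∂(phaseLaw n) with hH
  have hHm : Measurable H := Finset.measurable_sum _ fun d _ => (hmeas d).const_mul _
  have hHi : Integrable H (phaseLaw n) := integrable_finsetSum _ fun d _ => (hintg2 d).const_mul _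
  have hrange : ∀ x : ℕ → ℝ, ∑ d ∈ Finset.range (D + 1), x d = x 0 + ∑ d ∈ Finset.Icc 1 D, x d := by
    intro x
    rw [Finset.range_eq_Ico, Finset.sum_eq_sum_Ico_succ_bot (by omega)]
    rfl
  have inner : ∀ z : Fin M × (Fin n → ℝ), ∫ w, ∑ d ∈ Finset.range (D + 1),
        (∑ c, hiddenShift L lam z c * hiddenShift L lam w c) ^ d / (d.factorial : ℝ)
        ∂(hiddenParam M n) = 1 + (M : ℝ)⁻¹ * H z.2 := by
    intro z
    have e : ∀ w : Fin M × (Fin n → ℝ), ∑ d ∈ Finset.range (D + 1),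
        (∑ c, hiddenShift L lam z c * hiddenShift L lam w c) ^ d / (d.factorial : ℝ) =
        1 + if w.1 = z.1 then ∑ d ∈ Finset.Icc 1 D,
          lam ^ (2 * d) / d.factorial * phaseOverlap L w.2 z.2 ^ d else 0 := by
      intro w
      simp_rw [mul_comm (hiddenShift L lam z _), sum_hiddenShift_mul]
      rw [hrange, pow_zero, Nat.factorial_zero, Nat.cast_one, div_one]
      congr 1
      split_ifs with h
      · exact Finset.sum_congr rfl fun d _ => by rw [mul_pow, ← pow_mul]; ring
      · refine Finset.sum_eq_zero fun d hd => ?_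
        rw [zero_pow (by have := (Finset.mem_Icc.1 hd).1; omega), zero_div]
    have hSi : Integrable (fun φ => ∑ d ∈ Finset.Icc 1 D,
          lam ^ (2 * d) / d.factorial * phaseOverlap L φ z.2 ^ d) (phaseLaw n) :=
      integrable_finsetSum _ fun d _ => (hintg d z.2).const_mul _
    simp_rw [e]
    rw [integral_hiddenParam]
    · have e2 : ∀ κ : Fin M, ∫ φ, (1 + if κ = z.1 then ∑ d ∈ Finset.Icc 1 D,
          lam ^ (2 * d) / d.factorial * phaseOverlap L φ z.2 ^ d else 0) ∂(phaseLaw n) =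
          1 + if κ = z.1 then H z.2 else 0 := by
        intro κ
        split_ifs with h
        · rw [integral_add (integrable_const _) hSi, integral_finsetSum _ fun d _ =>
            (hintg d z.2).const_mul _]
          simp_rw [integral_const_mul]
          simp [hH]
        · simp
      simp_rw [e2]
      rw [Finset.sum_add_distrib, Finset.sum_ite_eq' Finset.univ z.1, if_pos (Finset.mem_univ _)]
      simp
      field_simp
    · refine measurable_const.add (Measurable.ite
        (measurableSet_eq_fun measurable_fst measurable_const) ?_ measurable_const)
      refine Finset.measurable_sum _ fun d _ => Measurable.const_mul ?_ _
      exact (((hcθ z.2).measurable.comp measurable_snd).pow_const d)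
    · intro κ
      refine (integrable_const _).add ?_
      simp only
      split_ifs
      · exact hSi
      · exact integrable_const _
  simp_rw [inner]
  rw [integral_hiddenParam (f := fun z => 1 + (M : ℝ)⁻¹ * H z.2)
    (measurable_const.add ((hHm.comp measurable_snd).const_mul _))
    (fun κ => (integrable_const _).add (hHi.const_mul _))]
  simp only
  rw [integral_add (integrable_const _) (hHi.const_mul _), integral_const_mul,
    integral_finsetSum _ fun d _ => (hintg2 d).const_mul _]
  simp_rw [integral_const_mul]
  simp
  field_simp

theorem sq_integral_hiddenPlanted_le (hM : 1 ≤ M) (lam : ℝ) {D : ℕ}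
    (f : MvPolynomial (Fin M × Fin L × Fin n × Fin n × Bool) ℝ) (hf : f.totalDegree ≤ D) :
    (∫ y, MvPolynomial.eval (hiddenCoord y) f ∂(hiddenPlanted M L n lam)) ^ 2 ≤
      (∫ y, MvPolynomial.eval (hiddenCoord y) f ^ 2 ∂(hiddenNull M L n)) *
        (1 + (M : ℝ)⁻¹ * ∑ d ∈ Finset.Icc 1 D, lam ^ (2 * d) / d.factorial *
          ∫ θ, ∫ φ, phaseOverlap L φ θ ^ d ∂(phaseLaw n) ∂(phaseLaw n)) := by
  have := isProbabilityMeasure_hiddenParam (n := n) hM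
  have hev : ∀ g : Fin M × Fin L × Fin n × Fin n → ℝ,
      MvPolynomial.eval (hiddenCoord fun m => (noise fun k i j => g (m, k, i, j) : Obs L n)) f =
        MvPolynomial.eval g (MvPolynomial.bind₁ coordForm f) := by
    intro g
    change _ = MvPolynomial.eval₂Hom (RingHom.id ℝ) g (MvPolynomial.bind₁ coordForm f)
    rw [MvPolynomial.eval₂Hom_bind₁]
    change MvPolynomial.eval _ f = MvPolynomial.eval (fun c => MvPolynomial.eval g (coordForm c)) f
    simp_rw [eval_coordForm]
  have hcm : Measurable fun y : Fin M → Obs L n => MvPolynomial.eval (hiddenCoord y) f := by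
    have hc : ∀ c, Measurable fun y : Fin M → Obs L n => hiddenCoord y c := by
      rintro ⟨m, k, i, j, b⟩
      cases b <;> simp only [hiddenCoord] <;> fun_prop
    simp_rw [MvPolynomial.eval_eq']
    fun_prop
  have h := sq_integral_eval_add_le (ν := hiddenParam M n) (μ := hiddenShift L lam)
    (measurable_hiddenShift lam) (abs_hiddenShift_le lam) (MvPolynomial.bind₁ coordForm f)
    ((totalDegree_bind₁_le _ totalDegree_coordForm_le f).trans hf)
  have hmn : Measurable fun (g : Fin M × Fin L × Fin n × Fin n → ℝ) (m : Fin M) =>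
      (noise fun k i j => g (m, k, i, j) : Obs L n) :=
    measurable_pi_iff.2 fun m => measurable_noise.comp (by fun_prop)
  rw [integral_hiddenShift_eq hM] at h
  have hmp : Measurable fun (z : (Fin M × (Fin n → ℝ)) × (Fin M × Fin L × Fin n × Fin n → ℝ))
      (m : Fin M) => (noise fun k i j => (z.2 + hiddenShift L lam z.1) (m, k, i, j) : Obs L n) :=
    hmn.comp (measurable_snd.add ((measurable_hiddenShift lam).comp measurable_fst))
  rw [hiddenPlanted_eq_map, hiddenNull_eq_map, integral_map hmn.aemeasurable
    (hcm.pow_const 2).aestronglyMeasurable, integral_map hmp.aemeasurable hcm.aestronglyMeasurable]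
  simp_rw [hev]
  exact h

/-- Under the assumption on `lam` the geometric factor `(lam² q / s)^d` in each moment term is at
most one. The sum then has `D` terms, each with a loss `√d ≤ D`. -/
theorem lowDegAdv_hidden_le (hn : 0 < n) (hM : 1 ≤ M) {lam s : ℝ} {D : ℕ} (hs0 : 0 < s) (hs : s < 1)
    (hlam : lam ^ 2 * Real.exp (Real.exp (2 * √(D * (L / n))) - 1) ≤ s) :
    lowDegAdv hiddenCoord (hiddenPlanted M L n lam) (hiddenNull M L n) D ≤
      (√(1 + (M : ℝ)⁻¹ * (2 * Real.exp 1 * D ^ 2 * ((1 - s)⁻¹) ^ L)) : ℝ) := by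
  have h1s : 0 < (1 - s)⁻¹ := inv_pos.2 (by linarith)
  have hR : ∑ d ∈ Finset.Icc 1 D, lam ^ (2 * d) / d.factorial *
      ∫ θ, ∫ φ, phaseOverlap L φ θ ^ d ∂(phaseLaw n) ∂(phaseLaw n) ≤
      2 * Real.exp 1 * D ^ 2 * ((1 - s)⁻¹) ^ L := by
    have hterm : ∀ d ∈ Finset.Icc 1 D, lam ^ (2 * d) / d.factorial *
        ∫ θ, ∫ φ, phaseOverlap L φ θ ^ d ∂(phaseLaw n) ∂(phaseLaw n) ≤
        2 * Real.exp 1 * D * ((1 - s)⁻¹) ^ L := by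
      intro d hd
      obtain ⟨hd1, hdD⟩ := Finset.mem_Icc.1 hd
      set q := Real.exp (Real.exp (2 * √(d * (L / n))) - 1) with hq
      -- The correction `q` is monotone in `d`, so the assumption at degree `D` covers all smaller
      -- degrees.
      have hqs : lam ^ 2 * q / s ≤ 1 := by
        rw [div_le_one hs0]
        refine le_trans ?_ hlam
        rw [hq]
        gcongr
      have h1 : ∫ θ, ∫ φ, phaseOverlap L φ θ ^ d ∂(phaseLaw n) ∂(phaseLaw n) ≤
          d.factorial * (2 * (Real.exp 1 * √d) * (q / s) ^ d * ((1 - s)⁻¹) ^ L) := by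
        refine (integral_mono_of_nonneg (ae_of_all _ fun θ => integral_nonneg fun φ =>
          pow_nonneg (phaseOverlap_nonneg φ θ) d) (integrable_const _)
          (ae_of_all _ fun θ => integral_phaseOverlap_pow_le hn θ hd1 hs0 hs)).trans_eq ?_
        rw [integral_const, probReal_univ, one_smul]
      have h2 : lam ^ (2 * d) / d.factorial *
          (d.factorial * (2 * (Real.exp 1 * √d) * (q / s) ^ d * ((1 - s)⁻¹) ^ L)) =
          2 * Real.exp 1 * √d * (lam ^ 2 * q / s) ^ d * ((1 - s)⁻¹) ^ L := by
        rw [pow_mul, mul_div_assoc, mul_pow]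
        field_simp
      have h3 : (lam ^ 2 * q / s) ^ d ≤ 1 := pow_le_one₀ (by positivity) hqs
      have h4 : √(d : ℝ) ≤ D := by
        rw [Real.sqrt_le_left (by positivity)]
        have : (1 : ℝ) ≤ D := by exact_mod_cast hd1.trans hdD
        have : (d : ℝ) ≤ D := by exact_mod_cast hdD
        nlinarith
      calc _ ≤ lam ^ (2 * d) / d.factorial *
          (d.factorial * (2 * (Real.exp 1 * √d) * (q / s) ^ d * ((1 - s)⁻¹) ^ L)) :=
            mul_le_mul_of_nonneg_left h1 (div_nonneg (by rw [pow_mul]; positivity) (by positivity))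
        _ = 2 * Real.exp 1 * √d * (lam ^ 2 * q / s) ^ d * ((1 - s)⁻¹) ^ L := h2
        _ ≤ 2 * Real.exp 1 * D * 1 * ((1 - s)⁻¹) ^ L := by gcongr
        _ = _ := by ring
    refine (Finset.sum_le_sum hterm).trans_eq ?_
    simp
    ring
  refine iSup_le fun f => ?_
  rw [EReal.coe_le_coe_iff]
  have h := sq_integral_hiddenPlanted_le (L := L) (n := n) hM lam f.1 f.2
  set a := ∫ y, MvPolynomial.eval (hiddenCoord y) f.1 ∂(hiddenPlanted M L n lam)
  set b := ∫ y, MvPolynomial.eval (hiddenCoord y) f.1 ^ 2 ∂(hiddenNull M L n)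
  have hb : 0 ≤ b := integral_nonneg fun y => sq_nonneg _
  refine div_le_of_le_mul₀ (Real.sqrt_nonneg _) (Real.sqrt_nonneg _) ?_
  rw [← Real.sqrt_mul (by positivity)]
  refine Real.le_sqrt_of_sq_le (h.trans ?_)
  rw [mul_comm]
  refine mul_le_mul_of_nonneg_right ?_ hb
  gcongr

/-- The constant polynomial `1` is admissible. -/
theorem one_le_lowDegAdv_hidden (hM : 1 ≤ M) (lam : ℝ) (D : ℕ) :
    1 ≤ lowDegAdv hiddenCoord (hiddenPlanted M L n lam) (hiddenNull M L n) D := by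
  have := isProbabilityMeasure_hiddenParam (n := n) hM
  have hp : IsProbabilityMeasure (hiddenNull M L n) := by unfold hiddenNull; infer_instance
  have hmn : Measurable fun (g : Fin M × Fin L × Fin n × Fin n → ℝ) (m : Fin M) =>
      (noise fun k i j => g (m, k, i, j) : Obs L n) :=
    measurable_pi_iff.2 fun m => measurable_noise.comp (by fun_prop)
  have hq : IsProbabilityMeasure (hiddenPlanted M L n lam) := by
    rw [hiddenPlanted_eq_map]
    exact Measure.isProbabilityMeasure_map (hmn.comp (measurable_snd.add
      ((measurable_hiddenShift lam).comp measurable_fst))).aemeasurable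
  refine le_trans ?_ (le_iSup _ ⟨1, by simp⟩)
  simp

end Advantage

/-! ### Programs -/

/-- Programs without loops, tests and random draws. -/
def Prog.IsStraight : Prog → Prop
  | .prim _ => True
  | .pair f g => f.IsStraight ∧ g.IsStraight
  | .seq f g => f.IsStraight ∧ g.IsStraight
  | _ => False

/-- Output of a straight-line program. -/
def Prog.out : Prog → Data → Data
  | .prim o, v => o.eval v
  | .pair f g, v => .pair (f.out v) (g.out v)
  | .seq f g, v => g.out (f.out v)
  | _, _ => .nil

/-- Running time of a straight-line program. -/
def Prog.cost : Prog → ℕ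
  | .prim _ => 1
  | .pair f g => f.cost + g.cost + 1
  | .seq f g => f.cost + g.cost + 1
  | _ => 0

theorem Prog.IsStraight.eval {f : Prog} (hf : f.IsStraight) (τ : Tape) (v : Data) :
    Eval f τ v (f.out v) f.cost := by
  induction f generalizing τ v with
  | prim o => exact Eval.prim o τ v
  | pair f g hf' hg' => exact Eval.pair (hf' hf.1 _ _) (hg' hf.2 _ _)
  | seq f g hf' hg' => exact Eval.seq (hf' hf.1 _ _) (hg' hf.2 _ _)
  | gauss => exact hf.elim
  | ite => exact hf.elim
  | loop => exact hf.elim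

/-- On input `v` the program `f` gives `w` in at most `t` steps, whatever the tape. -/
def Runs (f : Prog) (v w : Data) (t : ℕ) : Prop := ∀ τ, ∃ s ≤ t, Eval f τ v w s

theorem Prog.IsStraight.runs {f : Prog} (hf : f.IsStraight) (v : Data) :
    Runs f v (f.out v) f.cost := fun τ => ⟨_, le_rfl, hf.eval τ v⟩

theorem Runs.mono {f : Prog} {v w : Data} {s t : ℕ} (h : Runs f v w s) (hst : s ≤ t) :
    Runs f v w t := fun τ => (h τ).imp fun _ hr => ⟨hr.1.trans hst, hr.2⟩

theorem Runs.pair {f g : Prog} {v a b : Data} {s t : ℕ} (hf : Runs f v a s) (hg : Runs g v b t) :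
    Runs (.pair f g) v (.pair a b) (s + t + 1) := fun τ => by
  obtain ⟨s', hs, h1⟩ := hf τ.left
  obtain ⟨t', ht, h2⟩ := hg τ.right
  exact ⟨_, by omega, Eval.pair h1 h2⟩

theorem Runs.seq {f g : Prog} {v a b : Data} {s t : ℕ} (hf : Runs f v a s) (hg : Runs g a b t) :
    Runs (.seq f g) v b (s + t + 1) := fun τ => by
  obtain ⟨s', hs, h1⟩ := hf τ.left
  obtain ⟨t', ht, h2⟩ := hg τ.right
  exact ⟨_, by omega, Eval.seq h1 h2⟩

/-- Apply elementary operations one after the other. -/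
def Prog.ops : List Prim → Prog
  | [] => .prim .id
  | o :: os => .seq (.prim o) (Prog.ops os)

/-! ### Loops over lists and their running times. -/

/-- A list of data. -/
def encList (l : List Data) : Data := l.foldr Data.pair Data.nil

/-- State of a loop over a list. -/
def foldState (env acc : Data) (l : List Data) : Data := .pair env (.pair acc (encList l))

/-- The body of a loop over a list: replace the accumulator and drop the head of the list. -/
def foldBody (f : Prog) : Prog := .pair (.prim .fst) (.pair f (.ops [.snd, .snd, .snd]))

/-- Run over a list; `f` computes the new accumulator from the state. -/
def foldLoop (f : Prog) : Prog := .loop (.ops [.snd, .snd, .isPair]) (foldBody f)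

/-- The part of the tape used by the first execution of the body of `foldLoop`. -/
def Tape.head (τ : Tape) : Tape := τ.right.left.right.left

/-- The part of the tape used by the later executions of the body of `foldLoop`. -/
def Tape.tail (τ : Tape) : Tape := τ.right.right

theorem ops_isStraight (l : List Prim) : (Prog.ops l).IsStraight := by
  induction l with
  | nil => trivial
  | cons o os ih => exact ⟨trivial, ih⟩

theorem foldLoop_nil (f : Prog) (τ : Tape) (env acc : Data) :
    Eval (foldLoop f) τ (foldState env acc []) (foldState env acc []) 8 :=
  Eval.loop_done ((ops_isStraight [.snd, .snd, .isPair]).eval τ.left _)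
    (by simp [Prog.ops, Prog.out, foldState, encList, Prim.eval, Data.Pos])

theorem foldLoop_cons {f : Prog} {τ : Tape} {env acc acc' x w : Data} {l : List Data} {s u : ℕ}
    (h1 : Eval f τ.head (foldState env acc (x :: l)) acc' s)
    (h2 : Eval (foldLoop f) τ.tail (foldState env acc' l) w u) :
    Eval (foldLoop f) τ (foldState env acc (x :: l)) w (s + u + 18) := by
  have h3 := Eval.loop_step ((ops_isStraight [.snd, .snd, .isPair]).eval τ.left
      (foldState env acc (x :: l)))
    (by simp [Prog.ops, Prog.out, foldState, encList, Prim.eval, Data.Pos])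
    (Eval.pair (Eval.prim .fst _ _)
      (Eval.pair h1 ((ops_isStraight [.snd, .snd, .snd]).eval _ _))) h2
  have e : (Prog.ops [.snd, .snd, .isPair]).cost + (1 + (s + (Prog.ops [.snd, .snd, .snd]).cost + 1)
      + 1) + u + 1 = s + u + 18 := by
    simp only [Prog.ops, Prog.cost]; omega
  rw [e] at h3
  exact h3

/-- Reversal of a list. -/
def reverseProg : Prog :=
  .seq (.pair (.prim .nil) (.pair (.prim .nil) (.prim .id)))
    (.seq (foldLoop (.pair (.ops [.snd, .snd, .fst]) (.ops [.snd, .fst]))) (.ops [.snd, .fst]))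

theorem runs_reverseProg (l : List Data) :
    Runs reverseProg (encList l) (encList l.reverse) (31 * l.length + 22) := by
  -- The induction needs an arbitrary accumulator, which already holds the reversed prefix.
  have key : ∀ (l acc : List Data), Runs (foldLoop (.pair (.ops [.snd, .snd, .fst])
      (.ops [.snd, .fst]))) (foldState .nil (encList acc) l)
      (foldState .nil (encList (l.reverse ++ acc)) []) (31 * l.length + 8) := by
    intro l
    induction l with
    | nil => exact fun acc τ => ⟨8, by simp, foldLoop_nil _ τ _ _⟩
    | cons x l ih =>
      intro acc τ
      obtain ⟨u, hu, h2⟩ := ih (x :: acc) τ.tail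
      have hs : (Prog.pair (.ops [.snd, .snd, .fst]) (.ops [.snd, .fst])).IsStraight :=
        ⟨ops_isStraight _, ops_isStraight _⟩
      have h1 := hs.eval τ.head (foldState .nil (encList acc) (x :: l))
      have h3 := foldLoop_cons (acc' := encList (x :: acc)) h1 h2
      refine ⟨_, ?_, by simpa using h3⟩
      simp only [Prog.ops, Prog.cost, List.length_cons]
      omega
  have hs : (Prog.pair (.prim .nil) (.pair (.prim .nil) (.prim .id))).IsStraight :=
    ⟨trivial, trivial, trivial⟩
  have := Runs.seq (hs.runs (encList l)) (Runs.seq (key l [])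
    ((ops_isStraight [.snd, .fst]).runs (foldState .nil (encList (l.reverse ++ [])) [])))
  rw [List.append_nil] at this
  refine Runs.mono this ?_
  simp only [Prog.ops, Prog.cost]
  omega

/-- Run over two lists at the same time, starting from the output of `r`; `h` computes a new
result from the environment, the two heads and the old result. -/
def zipFold (r : Prim) (h : Prog) : Prog :=
  .seq (.pair (.prim .fst) (.pair (.pair (.ops [.snd, .snd]) (.prim r)) (.ops [.snd, .fst])))
    (.seq (foldLoop (.pair (.ops [.snd, .fst, .fst, .snd])
      (.seq (.pair (.prim .fst) (.pair (.pair (.ops [.snd, .snd, .fst])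
        (.ops [.snd, .fst, .fst, .fst])) (.ops [.snd, .fst, .snd]))) h)))
      (.ops [.snd, .fst, .snd]))

/-- The loop invariant is `res ys`, where `ys` lists the entries treated so far, latest first. The
final result is therefore indexed by the reversed list, and entrywise operations need a reversal
afterwards. -/
theorem runs_zipFold {α : Type*} (a b : α → Data) (res : List α → Data) (r : Prim) (h : Prog)
    (env : Data) (t : ℕ) (zs : List α)
    (hr : r.eval (.pair env (.pair (encList (zs.map a)) (encList (zs.map b)))) = res [])
    (hh : ∀ (ys : List α) (z : α), z ∈ zs →
      Runs h (.pair env (.pair (.pair (a z) (b z)) (res ys))) (res (z :: ys)) t) :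
    Runs (zipFold r h) (.pair env (.pair (encList (zs.map a)) (encList (zs.map b))))
      (res zs.reverse) (zs.length * (t + 59) + 36) := by
  have key : ∀ (ws ys : List α), (∀ z ∈ ws, z ∈ zs) →
      Runs (foldLoop (.pair (.ops [.snd, .fst, .fst, .snd])
      (.seq (.pair (.prim .fst) (.pair (.pair (.ops [.snd, .snd, .fst])
        (.ops [.snd, .fst, .fst, .fst])) (.ops [.snd, .fst, .snd]))) h)))
      (foldState env (.pair (encList (ws.map b)) (res ys)) (ws.map a))
      (foldState env (.pair .nil (res (ws.reverse ++ ys))) []) (ws.length * (t + 59) + 8) := by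
    intro ws
    induction ws with
    | nil => exact fun ys _ τ => ⟨8, by simp, foldLoop_nil _ τ _ _⟩
    | cons z ws ih =>
      intro ys hz τ
      obtain ⟨u, hu, h2⟩ := ih (z :: ys) (fun w hw => hz w (List.mem_cons_of_mem _ hw)) τ.tail
      have hs : (Prog.pair (.prim .fst) (.pair (.pair (.ops [.snd, .snd, .fst])
        (.ops [.snd, .fst, .fst, .fst])) (.ops [.snd, .fst, .snd]))).IsStraight :=
        ⟨trivial, ⟨ops_isStraight _, ops_isStraight _⟩, ops_isStraight _⟩
      have h1 := Runs.pair ((ops_isStraight [.snd, .fst, .fst, .snd]).runs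
          (foldState env (.pair (encList ((z :: ws).map b)) (res ys)) ((z :: ws).map a)))
        (Runs.seq (hs.runs _) (hh ys z (hz z List.mem_cons_self)))
      obtain ⟨s, hs', h1⟩ := h1 τ.head
      have h3 := foldLoop_cons (acc' := .pair (encList (ws.map b)) (res (z :: ys))) h1 h2
      refine ⟨_, ?_, by simpa using h3⟩
      simp only [Prog.ops, Prog.cost] at hs'
      rw [List.length_cons, Nat.add_mul]
      omega
  have hs : (Prog.pair (.prim .fst) (.pair (.pair (.ops [.snd, .snd]) (.prim r))
      (.ops [.snd, .fst]))).IsStraight :=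
    ⟨trivial, ⟨ops_isStraight _, trivial⟩, ops_isStraight _⟩
  have h0 := hs.runs (.pair env (.pair (encList (zs.map a)) (encList (zs.map b))))
  have e : (Prog.pair (.prim .fst) (.pair (.pair (.ops [.snd, .snd]) (.prim r))
      (.ops [.snd, .fst]))).out (.pair env (.pair (encList (zs.map a)) (encList (zs.map b)))) =
      foldState env (.pair (encList (zs.map b)) (res [])) (zs.map a) := by
    rw [← hr]; rfl
  rw [e] at h0
  have := Runs.seq h0 (Runs.seq (key zs [] fun z hz => hz)
    ((ops_isStraight [.snd, .fst, .snd]).runs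
      (foldState env (.pair .nil (res (zs.reverse ++ []))) [])))
  rw [List.append_nil] at this
  refine Runs.mono this ?_
  simp only [Prog.ops, Prog.cost]
  omega

/-- Combine two lists entry by entry; `g` maps `(env, (a, b))` to the new entry. -/
def zipWithProg (g : Prog) : Prog :=
  .seq (zipFold .nil (.pair (.seq (.pair (.prim .fst) (.ops [.snd, .fst])) g) (.ops [.snd, .snd])))
    reverseProg

theorem runs_zipWithProg {m : ℕ} (a b c : Fin m → Data) (g : Prog) (env : Data) (t : ℕ)
    (hg : ∀ i, Runs g (.pair env (.pair (a i) (b i))) (c i) t) :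
    Runs (zipWithProg g) (.pair env (.pair (encFin a) (encFin b))) (encFin c)
      (m * (t + 110) + 60) := by
  have h1 := runs_zipFold a b (fun ys => encList (ys.map c)) .nil
    (.pair (.seq (.pair (.prim .fst) (.ops [.snd, .fst])) g) (.ops [.snd, .snd])) env (t + 20)
    (List.ofFn fun i : Fin m => i) rfl (by
      intro ys z _
      have hs : (Prog.pair (.prim .fst) (.ops [.snd, .fst])).IsStraight :=
        ⟨trivial, ops_isStraight _⟩
      refine (Runs.pair (Runs.seq (hs.runs _) (hg z))
        ((ops_isStraight [.snd, .snd]).runs _)).mono ?_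
      simp only [Prog.ops, Prog.cost]
      omega)
  have h2 := runs_reverseProg ((List.ofFn fun i : Fin m => i).reverse.map c)
  have h3 := Runs.seq h1 h2
  simp only [List.map_reverse, List.reverse_reverse, List.map_ofFn, Function.comp_def,
    List.length_reverse, List.length_ofFn] at h3
  refine Runs.mono h3 ?_
  ring_nf
  omega

/-- Sum over two lists; `g` maps `(env, (a, b))` to a summand. -/
def zipSumProg (g : Prog) : Prog :=
  zipFold (.const 0)
    (.seq (.pair (.ops [.snd, .snd]) (.seq (.pair (.prim .fst) (.ops [.snd, .fst])) g))
      (.prim .add))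

theorem runs_zipSumProg {m : ℕ} (a b : Fin m → Data) (c : Fin m → ℝ) (g : Prog) (env : Data)
    (t : ℕ) (hg : ∀ i, Runs g (.pair env (.pair (a i) (b i))) (.num (c i)) t) :
    Runs (zipSumProg g) (.pair env (.pair (encFin a) (encFin b))) (.num (∑ i, c i))
      (m * (t + 90) + 36) := by
  have h1 := runs_zipFold a b (fun ys => .num ((ys.map c).sum)) (.const 0)
    (.seq (.pair (.ops [.snd, .snd]) (.seq (.pair (.prim .fst) (.ops [.snd, .fst])) g))
      (.prim .add)) env (t + 22)
    (List.ofFn fun i : Fin m => i) rfl (by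
      intro ys z _
      have hs : (Prog.pair (.prim .fst) (.ops [.snd, .fst])).IsStraight :=
        ⟨trivial, ops_isStraight _⟩
      have h := Runs.seq (Runs.pair ((ops_isStraight [.snd, .snd]).runs
        (.pair env (.pair (.pair (a z) (b z)) (.num (ys.map c).sum))))
        (Runs.seq (hs.runs _) (hg z))) (Prog.IsStraight.runs (f := .prim .add) trivial _)
      have e : (Prog.prim .add).out (.pair (.num (ys.map c).sum) (.num (c z))) =
          .num (((z :: ys).map c).sum) := by
        simp [Prog.out, Prim.eval, add_comm]
      have h' : Runs _ _ ((Prog.prim .add).out (.pair (.num (ys.map c).sum) (.num (c z)))) _ := h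
      rw [e] at h'
      refine h'.mono ?_
      simp only [Prog.ops, Prog.cost]
      omega)
  simp only [List.map_reverse, List.sum_reverse, List.map_ofFn, Function.comp_def,
    List.length_ofFn, List.sum_ofFn] at h1
  refine Runs.mono h1 ?_
  ring_nf
  omega

/-! ### The test built from a recovery algorithm -/

/-- `(α, β), (z, w) ↦ α z + β w` for complex numbers `z`, `w`. -/
def linProg : Prog :=
  .pair
    (.seq (.pair (.seq (.pair (.ops [.fst, .fst]) (.ops [.snd, .fst, .fst])) (.prim .mul))
      (.seq (.pair (.ops [.fst, .snd]) (.ops [.snd, .snd, .fst])) (.prim .mul))) (.prim .add))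
    (.seq (.pair (.seq (.pair (.ops [.fst, .fst]) (.ops [.snd, .fst, .snd])) (.prim .mul))
      (.seq (.pair (.ops [.fst, .snd]) (.ops [.snd, .snd, .snd])) (.prim .mul))) (.prim .add))

/-- The real part of `z * conj w`. -/
def dotProg : Prog :=
  .seq (.pair (.seq (.pair (.ops [.snd, .fst, .fst]) (.ops [.snd, .snd, .fst])) (.prim .mul))
      (.seq (.pair (.ops [.snd, .fst, .snd]) (.ops [.snd, .snd, .snd])) (.prim .mul))) (.prim .add)

/-- Linear combination of two observations. -/
def combineProg : Prog := zipWithProg (zipWithProg (zipWithProg linProg))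

/-- Frobenius inner product of two matrices. -/
def frobProg : Prog := zipSumProg (zipSumProg dotProg)

theorem linProg_isStraight : linProg.IsStraight := by
  simp [linProg, Prog.IsStraight, ops_isStraight]

theorem dotProg_isStraight : dotProg.IsStraight := by
  simp [dotProg, Prog.IsStraight, ops_isStraight]

/-- Three nested list passes. Only the order `L n²` matters; the numerical constants are generous.
-/
theorem runs_combineProg {L n : ℕ} (α β : ℝ) (Y Z : Obs L n) :
    Runs combineProg (.pair (.pair (.num α) (.num β)) (.pair (encObs Y) (encObs Z)))
      (encObs (α • Y + β • Z)) (L * (n * (n * 200 + 170) + 170) + 60) := by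
  refine runs_zipWithProg _ _ _ _ _ (n * (n * 200 + 170) + 60) fun k => ?_
  refine (runs_zipWithProg _ _ _ _ _ (n * 200 + 60) fun i => ?_)
  refine (runs_zipWithProg _ _ _ _ _ 90 fun j => ?_)
  have h := linProg_isStraight.runs (.pair (.pair (.num α) (.num β))
    (.pair (.pair (.num (Y k i j).re) (.num (Y k i j).im))
      (.pair (.num (Z k i j).re) (.num (Z k i j).im))))
  have e : linProg.out (.pair (.pair (.num α) (.num β))
    (.pair (.pair (.num (Y k i j).re) (.num (Y k i j).im))
      (.pair (.num (Z k i j).re) (.num (Z k i j).im)))) =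
      .pair (.num ((α • Y + β • Z) k i j).re) (.num ((α • Y + β • Z) k i j).im) := by
    simp [linProg, Prog.out, Prog.ops, Prim.eval]
  rw [e] at h
  exact h.mono (by simp only [linProg, Prog.ops, Prog.cost]; omega)

theorem runs_frobProg {n : ℕ} (env : Data) (A B : CMat n) :
    Runs frobProg (.pair env (.pair (encMat A) (encMat B))) (.num (frobInner A B))
      (n * (n * 150 + 126) + 36) := by
  rw [frobInner_eq]
  refine runs_zipSumProg _ _ _ _ _ (n * 150 + 36) fun i => ?_
  refine runs_zipSumProg _ _ _ _ _ 60 fun j => ?_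
  have h := dotProg_isStraight.runs (.pair env
    (.pair (.pair (.num (A i j).re) (.num (A i j).im))
      (.pair (.num (B i j).re) (.num (B i j).im))))
  exact Runs.mono h (by simp only [dotProg, Prog.ops, Prog.cost]; omega)

theorem sqrt_frobInner_self {n : ℕ} (A : CMat n) : √(frobInner A A) = frobNorm A := by
  rw [frobInner_eq, frobNorm]
  congr 1
  refine Finset.sum_congr rfl fun i _ => Finset.sum_congr rfl fun j _ => ?_
  rw [Complex.sq_norm, Complex.normSq_apply]

/-- Statistic of the test: `X, V, n ↦ ⟨X, V⟩ - r √n ‖X‖`. -/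
def scoreProg (r : ℝ) : Prog :=
  .seq (.pair (.seq (.pair (.prim .nil) (.pair (.prim .fst) (.ops [.snd, .fst]))) frobProg)
      (.pair (.seq (.pair (.prim .nil) (.pair (.prim .fst) (.prim .fst))) frobProg)
        (.ops [.snd, .snd])))
    (.seq (.pair (.prim .fst) (.seq (.pair (.seq (.pair (.prim (.const r)) (.ops [.snd, .snd, .sqrt]))
      (.prim .mul)) (.ops [.snd, .fst, .sqrt])) (.prim .mul))) (.prim .sub))

theorem runs_scoreProg {n : ℕ} (r : ℝ) (X V : CMat n) :
    Runs (scoreProg r) (.pair (encMat X) (.pair (encMat V) (.num n)))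
      (.num (frobInner X V - r * √n * frobNorm X)) (n * (n * 300 + 252) + 150) := by
  have h1 : (Prog.pair (.prim .nil) (.pair (.prim .fst) (.ops [.snd, .fst]))).IsStraight :=
    ⟨trivial, trivial, ops_isStraight _⟩
  have h2 : (Prog.pair (.prim .nil) (.pair (.prim .fst) (.prim .fst))).IsStraight :=
    ⟨trivial, trivial, trivial⟩
  have h3 : (Prog.seq (.pair (.prim .fst) (.seq (.pair (.seq (.pair (.prim (.const r))
      (.ops [.snd, .snd, .sqrt])) (.prim .mul)) (.ops [.snd, .fst, .sqrt])) (.prim .mul)))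
      (.prim .sub)).IsStraight := by
    simp [Prog.IsStraight, ops_isStraight]
  have h := Runs.seq (Runs.pair (Runs.seq (h1.runs (.pair (encMat X) (.pair (encMat V) (.num n))))
    (runs_frobProg .nil X V)) (Runs.pair (Runs.seq (h2.runs (.pair (encMat X)
      (.pair (encMat V) (.num n)))) (runs_frobProg .nil X X))
      ((ops_isStraight [.snd, .snd]).runs _))) (h3.runs _)
  have e : (Prog.seq (.pair (.prim .fst) (.seq (.pair (.seq (.pair (.prim (.const r))
      (.ops [.snd, .snd, .sqrt])) (.prim .mul)) (.ops [.snd, .fst, .sqrt])) (.prim .mul)))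
      (.prim .sub)).out (.pair (.num (frobInner X V)) (.pair (.num (frobInner X X)) (.num n))) =
      .num (frobInner X V - r * √n * frobNorm X) := by
    rw [← sqrt_frobInner_self X]
    simp [Prog.out, Prog.ops, Prim.eval]
  have h' : Runs (scoreProg r) _ ((Prog.seq (.pair (.prim .fst) (.seq (.pair (.seq
      (.pair (.prim (.const r))
      (.ops [.snd, .snd, .sqrt])) (.prim .mul)) (.ops [.snd, .fst, .sqrt])) (.prim .mul)))
      (.prim .sub)).out (.pair (.num (frobInner X V)) (.pair (.num (frobInner X X)) (.num n)))) _ :=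
    h
  rw [e] at h'
  refine Runs.mono h' ?_
  simp only [Prog.ops, Prog.cost]
  ring_nf
  omega

theorem Eval.of_eq {p : Prog} {τ : Tape} {v w w' : Data} {t : ℕ} (h : Eval p τ v w t)
    (e : w' = w) : Eval p τ v w' t := e ▸ h

open Classical in
/-- The truth value of a proposition as a number. -/
def flag (P : Prop) : Data := .num (if P then 1 else 0)

theorem flag_congr {P Q : Prop} (h : P ↔ Q) : flag P = flag Q := by rw [propext h]

/-- A loop that records whether one of the events `h j` occurs. -/
theorem eval_foldLoop_any {f : Prog} {env : Data} {x : ℕ → Data} {h : ℕ → Tape → Prop} {t : ℕ}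
    (m j : ℕ) (P : Prop) (τ : Tape)
    (hf : ∀ i, j ≤ i → i < j + m → ∀ (P : Prop) (l : List Data) (σ : Tape), ∃ s ≤ t,
      Eval f σ (foldState env (.pair (flag P) (.num (i + 1))) (x i :: l))
        (.pair (flag (P ∨ h i σ)) (.num ((i + 1 : ℕ) + 1))) s) :
    ∃ s ≤ m * (t + 18) + 8,
      Eval (foldLoop f) τ
        -- The accumulator also carries the one-based index, since the frequency `k + 1` is part of
        -- the input of the recovery algorithm.
        (foldState env (.pair (flag P) (.num (j + 1))) ((List.range' j m).map x))
        (foldState env (.pair (flag (P ∨ ∃ i < m, h (j + i) (Tape.tail^[i] τ).head))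
          (.num ((j + m : ℕ) + 1))) []) s := by
  induction m generalizing j P τ with
  | zero => exact ⟨8, by simp, by simpa using foldLoop_nil f τ env _⟩
  | succ m ih =>
    obtain ⟨s, hs, h1⟩ := hf j le_rfl (by omega) P ((List.range' (j + 1) m).map x) τ.head
    obtain ⟨u, hu, h2⟩ := ih (j + 1) (P ∨ h j τ.head) τ.tail
      fun i hi hi' => hf i (by omega) (by omega)
    have h3 := foldLoop_cons h1 h2
    refine ⟨_, ?_, h3.of_eq ?_⟩
    rotate_left
    · congr 3
      · refine propext ?_
        constructor
        · rintro (hP | ⟨i, hi, hh⟩)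
          · exact Or.inl (Or.inl hP)
          · cases i with
            | zero => exact Or.inl (Or.inr hh)
            | succ i =>
              refine Or.inr ⟨i, by omega, ?_⟩
              rw [Function.iterate_succ_apply] at hh
              rwa [show j + 1 + i = j + (i + 1) by omega]
        · rintro ((hP | hh) | ⟨i, hi, hh⟩)
          · exact Or.inl hP
          · exact Or.inr ⟨0, by omega, hh⟩
          · refine Or.inr ⟨i + 1, by omega, ?_⟩
            rw [Function.iterate_succ_apply]
            rwa [show j + 1 + i = j + (i + 1) by omega] at hh
      · push_cast; ring
    · rw [Nat.add_mul]; omega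

/-- The loop lemma indexes entries by natural numbers; the default `nil` outside the range never
occurs in the list. -/
theorem encFin_eq_encList {m : ℕ} (a : Fin m → Data) :
    encFin a = encList ((List.range' 0 m).map fun j => if h : j < m then a ⟨j, h⟩ else .nil) := by
  unfold encFin encList
  congr 1
  refine List.ext_getElem (by simp) fun i h1 h2 => ?_
  have hi : i < m := by simpa using h1
  simp [hi]

/-- The input of the recovery algorithm. -/
def recoveryInputProg : Prog :=
  .pair (.ops [.fst, .fst, .fst]) (.pair (.ops [.fst, .fst, .snd, .fst])
    (.pair (.ops [.fst, .fst, .snd, .snd]) (.pair (.ops [.snd, .fst, .snd]) (.ops [.fst, .snd]))))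

/-- Body of the loop over the frequencies. -/
def innerBody (p : Prog) (r : ℝ) : Prog :=
  .pair (.ite (.seq (.pair (.seq recoveryInputProg p)
      (.pair (.ops [.snd, .snd, .fst]) (.ops [.fst, .fst, .fst]))) (scoreProg r))
      (.prim (.const 1)) (.ops [.snd, .fst, .fst]))
    (.seq (.pair (.ops [.snd, .fst, .snd]) (.prim (.const 1))) (.prim .add))

/-- The part of the tape of `innerBody` on which the recovery algorithm is run. -/
def Tape.core (τ : Tape) : Tape := τ.left.left.left.left.right

/-- The flag becomes `1` on success and is copied otherwise, so it records a disjunction. The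
recovery algorithm reads only the part `σ.core` of the tape. -/
theorem eval_innerBody {n L T : ℕ} {lam r : ℝ} {p : Prog} {X : Obs L n → Tape → CMat n} (k : Fin L)
    (hp : ∀ Y τ, ∃ t ≤ T, Eval p τ (recoveryInput lam k Y) (encMat (X Y τ)) t)
    (U : Obs L n) (V : CMat n) (P : Prop) (l : List Data) (σ : Tape) :
    ∃ s ≤ T + (n * (n * 300 + 252) + 300),
      Eval (innerBody p r) σ (foldState (.pair (.pair (.num n) (.pair (.num L) (.num lam)))
        (encObs U)) (.pair (flag P) (.num ((k : ℕ) + 1))) (encMat V :: l))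
        (.pair (flag (P ∨ r * √n * frobNorm (X U σ.core) < frobInner (X U σ.core) V))
          (.num (((k : ℕ) + 1 : ℕ) + 1))) s := by
  set v := foldState (.pair (.pair (.num n) (.pair (.num L) (.num lam)))
        (encObs U)) (.pair (flag P) (.num ((k : ℕ) + 1))) (encMat V :: l) with hv
  have hri : recoveryInputProg.IsStraight := by
    simp [recoveryInputProg, Prog.IsStraight, ops_isStraight]
  obtain ⟨t, ht, h1⟩ := hp U σ.core
  have h2 := Eval.pair (Eval.seq (hri.eval σ.left.left.left.left.left v) h1)
    (Eval.pair ((ops_isStraight [.snd, .snd, .fst]).eval σ.left.left.left.right.left v)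
      ((ops_isStraight [.fst, .fst, .fst]).eval σ.left.left.left.right.right v))
  obtain ⟨u, hu, h3⟩ := runs_scoreProg r (X U σ.core) V σ.left.left.right
  have h4 := Eval.seq h2 h3
  have hidx : (Prog.seq (.pair (.ops [.snd, .fst, .snd]) (.prim (.const 1)))
      (.prim .add)).IsStraight := by
    simp [Prog.IsStraight, ops_isStraight]
  have h5 := hidx.eval σ.right v
  have e5 : (Prog.seq (.pair (.ops [.snd, .fst, .snd]) (.prim (.const 1))) (.prim .add)).out v =
      .num (((k : ℕ) + 1 : ℕ) + 1) := by
    simp [hv, foldState, Prog.out, Prog.ops, Prim.eval]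
  rw [e5] at h5
  by_cases hit : r * √n * frobNorm (X U σ.core) < frobInner (X U σ.core) V
  · have h6 := Eval.pair (Eval.ite_pos (g := .ops [.snd, .fst, .fst]) h4 (by
      simpa [Data.Pos] using hit) (Eval.prim (.const 1) σ.left.right v)) h5
    refine ⟨_, ?_, h6.of_eq ?_⟩
    rotate_left
    · congr 1
      simp [flag, hit, Prim.eval]
    · simp only [Prog.ops, Prog.cost, recoveryInputProg]
      ring_nf at hu ⊢
      omega
  · have h6 := Eval.pair (Eval.ite_neg (f := .prim (.const 1)) h4 (by
      simpa [Data.Pos] using hit) ((ops_isStraight [.snd, .fst, .fst]).eval σ.left.right v)) h5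
    refine ⟨_, ?_, h6.of_eq ?_⟩
    rotate_left
    · congr 1
      simp [hit, hv, foldState, Prog.out, Prog.ops, Prim.eval]
    · simp only [Prog.ops, Prog.cost, recoveryInputProg]
      ring_nf at hu ⊢
      omega

/-- Preparation of the loop over the frequencies: splitting of the sample. -/
def splitProg : Prog :=
  .pair (.pair (.ops [.fst, .fst])
      (.seq (.pair (.ops [.fst, .snd, .fst]) (.pair (.ops [.snd, .snd, .fst]) (.ops [.fst, .snd, .snd])))
        combineProg))
    (.pair (.pair (.ops [.snd, .fst, .fst]) (.prim (.const 1)))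
      (.seq (.pair (.pair (.ops [.fst, .snd, .fst, .snd])
          (.seq (.pair (.prim (.const 0)) (.ops [.fst, .snd, .fst, .fst])) (.prim .sub)))
          (.pair (.ops [.snd, .snd, .fst]) (.ops [.fst, .snd, .snd])))
        combineProg))

/-- Body of the loop over the samples. -/
def outerBody (p : Prog) (r : ℝ) : Prog :=
  .pair (.seq splitProg (.seq (foldLoop (innerBody p r)) (.ops [.snd, .fst, .fst])))
    (.seq (.pair (.ops [.snd, .fst, .snd]) (.prim (.const 1))) (.prim .add))

/-- Environment of the loop over the samples. -/
def outerEnv {L n : ℕ} (lam a b : ℝ) (Y₀ : Obs L n) : Data :=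
  .pair (.pair (.num n) (.pair (.num L) (.num lam))) (.pair (.pair (.num a) (.num b)) (encObs Y₀))

/-- The event that the statistic at frequency `k` is large: the estimate from the first part of
the split sample correlates with the second part. -/
def Hit {L n : ℕ} (X : Obs L n → Tape → CMat n) (a b r : ℝ) (k : Fin L) (Y Y₀ : Obs L n)
    (τ : Tape) : Prop :=
  r * √n * frobNorm (X (a • Y + b • Y₀) τ) < frobInner (X (a • Y + b • Y₀) τ) ((b • Y + (-a) • Y₀) k)

theorem runs_splitProg {L n : ℕ} (lam a b : ℝ) (Y Y₀ : Obs L n) (P : Prop) (i : ℝ)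
    (l : List Data) :
    Runs splitProg (foldState (outerEnv lam a b Y₀) (.pair (flag P) (.num i)) (encObs Y :: l))
      (.pair (.pair (.pair (.num n) (.pair (.num L) (.num lam))) (encObs (a • Y + b • Y₀)))
        (.pair (.pair (flag P) (.num 1)) (encObs (b • Y + (-a) • Y₀))))
      (L * (n * (n * 400 + 340) + 340) + 250) := by
  set v := foldState (outerEnv lam a b Y₀) (.pair (flag P) (.num i)) (encObs Y :: l) with hv
  have h1 : (Prog.pair (.ops [.fst, .snd, .fst]) (.pair (.ops [.snd, .snd, .fst])
      (.ops [.fst, .snd, .snd]))).IsStraight :=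
    ⟨ops_isStraight _, ops_isStraight _, ops_isStraight _⟩
  have h2 : (Prog.pair (.ops [.snd, .fst, .fst]) (.prim (.const 1))).IsStraight :=
    ⟨ops_isStraight _, trivial⟩
  have h3 : (Prog.pair (.pair (.ops [.fst, .snd, .fst, .snd])
      (.seq (.pair (.prim (.const 0)) (.ops [.fst, .snd, .fst, .fst])) (.prim .sub)))
      (.pair (.ops [.snd, .snd, .fst]) (.ops [.fst, .snd, .snd]))).IsStraight := by
    simp [Prog.IsStraight, ops_isStraight]
  have h3r := h3.runs v
  have e3 : (Prog.pair (.pair (.ops [.fst, .snd, .fst, .snd])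
      (.seq (.pair (.prim (.const 0)) (.ops [.fst, .snd, .fst, .fst])) (.prim .sub)))
      (.pair (.ops [.snd, .snd, .fst]) (.ops [.fst, .snd, .snd]))).out v =
      .pair (.pair (.num b) (.num (-a))) (.pair (encObs Y) (encObs Y₀)) := by
    simp [hv, foldState, outerEnv, encList, Prog.out, Prog.ops, Prim.eval]
  rw [e3] at h3r
  have h := Runs.pair (Runs.pair ((ops_isStraight [.fst, .fst]).runs v)
    (Runs.seq (h1.runs v) (runs_combineProg a b Y Y₀)))
    (Runs.pair (h2.runs v) (Runs.seq h3r (runs_combineProg b (-a) Y Y₀)))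
  refine Runs.mono h ?_
  simp only [Prog.ops, Prog.cost]
  ring_nf
  omega

theorem eval_outerBody {n L T : ℕ} {lam a b r : ℝ} {p : Prog} {X : Fin L → Obs L n → Tape → CMat n}
    (hp : ∀ k Y τ, ∃ t ≤ T, Eval p τ (recoveryInput lam k Y) (encMat (X k Y τ)) t)
    (Y Y₀ : Obs L n) (P : Prop) (j : ℕ) (l : List Data) (σ : Tape) :
    ∃ s ≤ L * (T + (n * (n * 700 + 600) + 700)) + 300,
      Eval (outerBody p r) σ (foldState (outerEnv lam a b Y₀) (.pair (flag P) (.num (j + 1)))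
        (encObs Y :: l))
        (.pair (flag (P ∨ ∃ k : Fin L, Hit (X k) a b r k Y Y₀
          ((Tape.tail^[k] σ.left.right.left).head.core))) (.num ((j + 1 : ℕ) + 1))) s := by
  obtain ⟨s1, hs1, h1⟩ := runs_splitProg lam a b Y Y₀ P (j + 1) l σ.left.left
  obtain ⟨s2, hs2, h2⟩ := eval_foldLoop_any (f := innerBody p r)
    (env := .pair (.pair (.num n) (.pair (.num L) (.num lam))) (encObs (a • Y + b • Y₀)))
    (x := fun j => if h : j < L then encMat ((b • Y + (-a) • Y₀) ⟨j, h⟩) else .nil)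
    (h := fun j τ => ∃ h : j < L, Hit (X ⟨j, h⟩) a b r ⟨j, h⟩ Y Y₀ τ.core)
    (t := T + (n * (n * 300 + 252) + 300)) L 0 P σ.left.right.left (by
      intro i _ hi P l σ
      have hi' : i < L := by omega
      obtain ⟨s, hs, h⟩ := eval_innerBody (r := r) ⟨i, hi'⟩ (hp ⟨i, hi'⟩) (a • Y + b • Y₀)
        ((b • Y + (-a) • Y₀) ⟨i, hi'⟩) P l σ
      refine ⟨s, hs, ?_⟩
      simp only [dif_pos hi']
      convert h using 2
      refine flag_congr (or_congr_right ?_)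
      simp [Hit, hi'])
  have hidx : (Prog.seq (.pair (.ops [.snd, .fst, .snd]) (.prim (.const 1)))
      (.prim .add)).IsStraight := by
    simp [Prog.IsStraight, ops_isStraight]
  have h5 := hidx.eval σ.right
    (foldState (outerEnv lam a b Y₀) (.pair (flag P) (.num (j + 1))) (encObs Y :: l))
  have e5 : (Prog.seq (.pair (.ops [.snd, .fst, .snd]) (.prim (.const 1))) (.prim .add)).out
      (foldState (outerEnv lam a b Y₀) (.pair (flag P) (.num (j + 1))) (encObs Y :: l)) =
      .num ((j + 1 : ℕ) + 1) := by
    simp [foldState, Prog.out, Prog.ops, Prim.eval]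
  rw [e5] at h5
  have e1 : (Data.pair (.pair (.pair (.num n) (.pair (.num L) (.num lam))) (encObs (a • Y + b • Y₀)))
        (.pair (.pair (flag P) (.num 1)) (encObs (b • Y + (-a) • Y₀)))) =
      foldState (.pair (.pair (.num n) (.pair (.num L) (.num lam))) (encObs (a • Y + b • Y₀)))
        (.pair (flag P) (.num ((0 : ℕ) + 1))) ((List.range' 0 L).map fun j =>
          if h : j < L then encMat ((b • Y + (-a) • Y₀) ⟨j, h⟩) else .nil) := by
    rw [foldState, ← encFin_eq_encList (fun k : Fin L => encMat ((b • Y + (-a) • Y₀) k))]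
    simp [encObs]
  rw [e1] at h1
  have h6 := Eval.pair (Eval.seq h1 (Eval.seq h2
    ((ops_isStraight [.snd, .fst, .fst]).eval σ.left.right.right _))) h5
  refine ⟨_, ?_, h6.of_eq ?_⟩
  rotate_left
  · congr 1
    simp only [foldState, Prog.out, Prog.ops, Prim.eval]
    refine flag_congr (or_congr_right ?_)
    constructor
    · rintro ⟨k, hk⟩
      exact ⟨k, k.2, by simpa using hk⟩
    · rintro ⟨k, hk, h, hh⟩
      exact ⟨⟨k, hk⟩, by simpa using hh⟩
  · simp only [Prog.ops, Prog.cost]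
    ring_nf at hs1 hs2 ⊢
    omega

/-- Preparation of the loop over the samples; `d` is the difference of the signal strengths. -/
def initProg (d : ℝ) : Prog :=
  .seq (.pair (.prim .id) (.seq (.pair (.ops [.snd, .snd, .fst]) (.prim (.const d))) (.prim .sub)))
    (.seq (.pair (.prim .id) (.seq (.pair (.prim .snd) (.ops [.fst, .snd, .snd, .fst])) (.prim .div)))
      (.pair
        (.pair (.pair (.ops [.fst, .fst, .fst]) (.pair (.ops [.fst, .fst, .snd, .fst])
            (.ops [.fst, .snd])))
          (.pair (.pair (.prim .snd) (.seq (.seq (.pair (.prim (.const 1))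
            (.seq (.pair (.prim .snd) (.prim .snd)) (.prim .mul))) (.prim .sub)) (.prim .sqrt)))
            (.ops [.fst, .fst, .snd, .snd, .snd, .snd, .fst])))
        (.pair (.pair (.prim (.const 0)) (.prim (.const 1)))
          (.ops [.fst, .fst, .snd, .snd, .snd, .snd, .snd]))))

/-- The test built from the recovery algorithm `p`. -/
def testProg (p : Prog) (d r : ℝ) : Prog :=
  .seq (initProg d) (.seq (foldLoop (outerBody p r)) (.ops [.snd, .fst, .fst]))

/-- The part of the tape on which the recovery algorithm is run for sample `m`, frequency `k`. -/
def Tape.part (m k : ℕ) (τ : Tape) : Tape :=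
  (Tape.tail^[k] (Tape.tail^[m] τ.right.left).head.left.right.left).head.core

/-- The test is given the strength `lam + d` and recovers `lam` by subtracting its built-in constant
`d`. All frequencies are tried because the relevant one is not part of its input; hence the time
bound on `p` is required for every `k`. -/
theorem eval_testProg {n L T K : ℕ} {lam d r : ℝ} {p : Prog} {X : Fin L → Obs L n → Tape → CMat n}
    (hp : ∀ k Y τ, ∃ t ≤ T, Eval p τ (recoveryInput lam k Y) (encMat (X k Y τ)) t)
    (Y : Fin (K + 1) → Obs L n) (τ : Tape) :
    ∃ s ≤ K * (L * (T + (n * (n * 700 + 600) + 700)) + 400) + 200,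
      Eval (testProg p d r) τ (testInput (lam + d) Y)
        (flag (∃ (m : Fin K) (k : Fin L), Hit (X k) (lam / (lam + d))
          (√(1 - lam / (lam + d) * (lam / (lam + d)))) r k (Y m.succ) (Y 0) (τ.part m k))) s := by
  set a := lam / (lam + d) with ha
  set b := √(1 - a * a) with hb
  have hi : (initProg d).IsStraight := by simp [initProg, Prog.IsStraight, ops_isStraight]
  have h1 := hi.eval τ.left (testInput (lam + d) Y)
  -- The head of the list of samples becomes the reference `Y 0`; the loop runs over the remaining
  -- `K` samples.
  have e1 : (initProg d).out (testInput (lam + d) Y) =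
      foldState (outerEnv lam a b (Y 0)) (.pair (flag False) (.num ((0 : ℕ) + 1)))
        ((List.range' 0 K).map fun j => if h : j < K then encObs (Y (Fin.succ ⟨j, h⟩)) else .nil) := by
    rw [foldState, ← encFin_eq_encList (fun m : Fin K => encObs (Y m.succ))]
    have e2 : encFin (fun m => encObs (Y m)) =
        .pair (encObs (Y 0)) (encFin fun m : Fin K => encObs (Y m.succ)) := by
      simp [encFin, List.ofFn_succ]
    rw [testInput, e2]
    simp [initProg, Prog.out, Prog.ops, Prim.eval, outerEnv, flag, ha, hb]
  rw [e1] at h1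
  obtain ⟨s2, hs2, h2⟩ := eval_foldLoop_any (f := outerBody p r) (env := outerEnv lam a b (Y 0))
    (x := fun j => if h : j < K then encObs (Y (Fin.succ ⟨j, h⟩)) else .nil)
    (h := fun j τ => ∃ h : j < K, ∃ k : Fin L, Hit (X k) a b r k (Y (Fin.succ ⟨j, h⟩)) (Y 0)
      ((Tape.tail^[k] τ.left.right.left).head.core))
    (t := L * (T + (n * (n * 700 + 600) + 700)) + 300) K 0 False τ.right.left (by
      intro i _ hi P l σ
      have hi' : i < K := by omega
      obtain ⟨s, hs, h⟩ := eval_outerBody (a := a) (b := b) (r := r) hp (Y (Fin.succ ⟨i, hi'⟩))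
        (Y 0) P i l σ
      refine ⟨s, hs, ?_⟩
      simp only [dif_pos hi']
      convert h using 2
      refine flag_congr (or_congr_right ?_)
      simp [hi'])
  have h6 := Eval.seq h1 (Eval.seq h2 ((ops_isStraight [.snd, .fst, .fst]).eval τ.right.right _))
  refine ⟨_, ?_, h6.of_eq ?_⟩
  rotate_left
  · simp only [foldState, Prog.out, Prog.ops, Prim.eval]
    refine flag_congr ?_
    constructor
    · rintro ⟨m, k, h⟩
      exact Or.inr ⟨m, m.2, by simpa [Tape.part] using ⟨k, h⟩⟩
    · rintro (h | ⟨m, hm, _, k, h⟩)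
      · exact h.elim
      · exact ⟨⟨m, hm⟩, k, by simpa [Tape.part] using h⟩
  · simp only [initProg, Prog.ops, Prog.cost]
    ring_nf at hs2 ⊢
    omega

/-! ### The random tape -/

instance : IsProbabilityMeasure tapeLaw := by unfold tapeLaw; infer_instance

/-- Selecting distinct entries of an i.i.d. sequence leaves an i.i.d. sequence of the same law. -/
theorem measurePreserving_reindex {ψ : ℕ → ℕ} (hψ : ψ.Injective) :
    MeasurePreserving (fun (τ : Tape) k => τ (ψ k)) tapeLaw tapeLaw := by
  have hm : Measurable fun (τ : Tape) k => τ (ψ k) := by fun_prop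
  refine ⟨hm, Measure.eq_infinitePi _ fun s t ht => ?_⟩
  have e : (fun (τ : Tape) k => τ (ψ k)) ⁻¹' Set.pi s t =
      Set.pi (s.map ⟨ψ, hψ⟩ : Finset ℕ) fun k => t (Function.invFun ψ k) := by
    ext τ
    simp [Set.mem_pi, Function.leftInverse_invFun hψ _]
  rw [Measure.map_apply hm (MeasurableSet.pi (Set.to_countable _) fun i _ => ht i), e, tapeLaw,
    Measure.infinitePi_pi _ fun i _ => ht _, Finset.prod_map]
  simp [Function.leftInverse_invFun hψ _]

theorem measurePreserving_left : MeasurePreserving Tape.left tapeLaw tapeLaw :=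
  measurePreserving_reindex (ψ := fun k => 2 * k) fun a b h => by simpa using h

theorem measurePreserving_right : MeasurePreserving Tape.right tapeLaw tapeLaw :=
  measurePreserving_reindex (ψ := fun k => 2 * k + 1) fun a b h => by simpa using h

theorem measurePreserving_head : MeasurePreserving Tape.head tapeLaw tapeLaw :=
  measurePreserving_left.comp (measurePreserving_right.comp
    (measurePreserving_left.comp measurePreserving_right))

theorem measurePreserving_tail : MeasurePreserving Tape.tail tapeLaw tapeLaw :=
  measurePreserving_right.comp measurePreserving_right

theorem measurePreserving_core : MeasurePreserving Tape.core tapeLaw tapeLaw :=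
  measurePreserving_right.comp (measurePreserving_left.comp (measurePreserving_left.comp
    (measurePreserving_left.comp measurePreserving_left)))

/-- Only the law of each single part matters: the null error uses a union bound, and the planted
error follows one sample and one frequency. Independence between parts plays no role. -/
theorem measurePreserving_part (m k : ℕ) : MeasurePreserving (Tape.part m k) tapeLaw tapeLaw :=
  measurePreserving_core.comp <| measurePreserving_head.comp <|
    (measurePreserving_tail.iterate k).comp <| measurePreserving_left.comp <|
    measurePreserving_right.comp <| measurePreserving_left.comp <| measurePreserving_head.comp <|
    (measurePreserving_tail.iterate m).comp <| measurePreserving_left.comp measurePreserving_right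

/-! ### Rotation invariance -/

theorem isGaussian_pi {ι E : Type*} [Fintype ι] [NormedAddCommGroup E] [NormedSpace ℝ E]
    [MeasurableSpace E] [BorelSpace E] [SecondCountableTopology E] [CompleteSpace E] (μ : Measure E)
    [IsGaussian μ] : IsGaussian (Measure.pi fun _ : ι => μ) := by
  have h := (iIndepFun_pi (μ := fun _ : ι => μ) (X := fun _ => id)
    fun _ => aemeasurable_id).hasGaussianLaw (fun i => ⟨by
      have e : (Measure.pi fun _ : ι => μ).map (fun ω => id (ω i)) = μ :=
        (measurePreserving_eval (fun _ : ι => μ) i).map_eq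
      rw [e]; infer_instance⟩)
  have := h.isGaussian_map
  simpa using this

theorem pi_map_neg {ι E : Type*} [Fintype ι] [AddCommGroup E]
    [MeasurableSpace E] [MeasurableNeg E] (μ : Measure E) [IsProbabilityMeasure μ]
    (h : μ.map (fun x => -x) = μ) :
    (Measure.pi fun _ : ι => μ).map (fun x => -x) = Measure.pi fun _ : ι => μ := by
  have : (fun x : ι → E => -x) = fun x i => -x i := rfl
  have h2 : IsProbabilityMeasure (μ.map fun x => -x) := by rwa [h]
  rw [this, Measure.pi_map_pi (fun _ => by fun_prop), h]

section Rotation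

variable {L n : ℕ}

instance : IsGaussian (gaussArrayLaw L n) := by
  have h1 := isGaussian_pi (ι := Fin n) (gaussianReal 0 1)
  have h2 := isGaussian_pi (ι := Fin n) (Measure.pi fun _ : Fin n => gaussianReal 0 1)
  exact isGaussian_pi _

theorem gaussArrayLaw_map_neg : (gaussArrayLaw L n).map (fun x => -x) = gaussArrayLaw L n :=
  pi_map_neg _ (pi_map_neg _ (pi_map_neg _ (by simp [gaussianReal_map_neg])))

/-- The map is a reflection: a rotation by the angle `arcsin (-a)` followed by a swap. Rotation
invariance needs a centred Gaussian law, and centring comes from symmetry under negation. -/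
theorem measurePreserving_rotation {a b : ℝ} (hb : 0 ≤ b) (hab : a ^ 2 + b ^ 2 = 1) :
    MeasurePreserving (fun z : (Fin L → Fin n → Fin n → ℝ) × (Fin L → Fin n → Fin n → ℝ) =>
        (a • z.1 + b • z.2, b • z.1 + (-a) • z.2))
      ((gaussArrayLaw L n).prod (gaussArrayLaw L n))
      ((gaussArrayLaw L n).prod (gaussArrayLaw L n)) := by
  have h0 : ∀ ψ : StrongDual ℝ (Fin L → Fin n → Fin n → ℝ), (gaussArrayLaw L n)[ψ] = 0 := by
    intro ψ
    have h : ∫ x, ψ x ∂(gaussArrayLaw L n) = -∫ x, ψ x ∂(gaussArrayLaw L n) := by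
      conv_lhs => rw [← gaussArrayLaw_map_neg]
      rw [integral_map (by fun_prop) (by fun_prop)]
      simp [integral_neg]
    linarith
  have hrot := IsGaussian.map_rotation_eq_self_of_forall_strongDual_eq_zero h0 (Real.arcsin (-a))
  have hmp : MeasurePreserving (ContinuousLinearMap.rotation (Real.arcsin (-a)) :
      (Fin L → Fin n → Fin n → ℝ) × (Fin L → Fin n → Fin n → ℝ) → _)
      ((gaussArrayLaw L n).prod (gaussArrayLaw L n))
      ((gaussArrayLaw L n).prod (gaussArrayLaw L n)) :=
    ⟨(ContinuousLinearMap.continuous _).measurable, hrot⟩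
  have hs : Real.sin (Real.arcsin (-a)) = -a := Real.sin_arcsin (by nlinarith) (by nlinarith)
  have hc : Real.cos (Real.arcsin (-a)) = b := by
    rw [Real.cos_arcsin, show 1 - (-a) ^ 2 = b ^ 2 by linarith, Real.sqrt_sq hb]
  have h := (Measure.measurePreserving_swap (μ := gaussArrayLaw L n) (ν := gaussArrayLaw L n)).comp hmp
  convert h using 1
  funext z
  simp only [Function.comp, ContinuousLinearMap.rotation_apply, hs, hc, neg_neg, Prod.swap_prod_mk]

theorem measurePreserving_pair_eval {ι X : Type*} [Fintype ι] [MeasurableSpace X] (μ : Measure X)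
    [IsProbabilityMeasure μ] {i j : ι} (hij : i ≠ j) :
    MeasurePreserving (fun g : ι → X => (g i, g j)) (Measure.pi fun _ => μ) (μ.prod μ) := by
  classical
  refine ⟨by fun_prop, ?_⟩
  have h := (iIndepFun_pi (μ := fun _ : ι => μ) (X := fun _ => id)
    fun _ => aemeasurable_id).indepFun hij
  simp only [id] at h
  rw [indepFun_iff_map_prod_eq_prod_map_map (measurable_pi_apply i).aemeasurable
    (measurable_pi_apply j).aemeasurable] at h
  have e : ∀ i, (Measure.pi fun _ : ι => μ).map (fun ω => ω i) = μ :=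
    fun i => (measurePreserving_eval (fun _ : ι => μ) i).map_eq
  rw [e, e] at h
  exact h

/-- Splitting the samples `i` and `j` by a rotation. -/
theorem measurePreserving_split {ι : Type*} [Fintype ι] {i j : ι} (hij : i ≠ j) {a b : ℝ}
    (hb : 0 ≤ b) (hab : a ^ 2 + b ^ 2 = 1) (m k : ℕ) :
    MeasurePreserving (fun z : ((Fin n → ℝ) × (ι → Fin L → Fin n → Fin n → ℝ)) × Tape =>
        (((z.1.1, a • z.1.2 i + b • z.1.2 j), z.2.part m k), b • z.1.2 i + (-a) • z.1.2 j))
      (((phaseLaw n).prod (Measure.pi fun _ => gaussArrayLaw L n)).prod tapeLaw)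
      ((((phaseLaw n).prod (gaussArrayLaw L n)).prod tapeLaw).prod (gaussArrayLaw L n)) := by
  -- Apart from the rotation and the choice of the tape part, only factors of the product are
  -- rearranged, so that the second rotated array stands alone, independent of everything the
  -- estimator sees.
  have h1 := ((MeasurePreserving.id (phaseLaw n)).prod ((measurePreserving_rotation hb hab).comp
    (measurePreserving_pair_eval (gaussArrayLaw L n) hij))).prod (measurePreserving_part m k)
  have h2 := (measurePreserving_prodAssoc (phaseLaw n) (gaussArrayLaw L n) (gaussArrayLaw L n)).symm
    MeasurableEquiv.prodAssoc
  have h3 := measurePreserving_prodAssoc ((phaseLaw n).prod (gaussArrayLaw L n)) (gaussArrayLaw L n)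
    tapeLaw
  have h4 := (MeasurePreserving.id ((phaseLaw n).prod (gaussArrayLaw L n))).prod
    (Measure.measurePreserving_swap (μ := gaussArrayLaw L n) (ν := tapeLaw))
  have h5 := (measurePreserving_prodAssoc ((phaseLaw n).prod (gaussArrayLaw L n)) tapeLaw
    (gaussArrayLaw L n)).symm MeasurableEquiv.prodAssoc
  exact h5.comp (h4.comp (h3.comp ((h2.prod (MeasurePreserving.id tapeLaw)).comp h1)))

end Rotation

/-! ### Gaussian tails -/

section Tail

variable {L n : ℕ}

theorem abs_frobInner_le (A B : CMat n) : |frobInner A B| ≤ frobNorm A * frobNorm B := by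
  refine (Complex.abs_re_le_norm _).trans ?_
  rw [← Finset.sum_product' Finset.univ Finset.univ (fun i j => A i j * star (B i j))]
  refine (norm_sum_le _ _).trans ?_
  simp_rw [norm_mul, norm_star]
  refine (Real.sum_mul_le_sqrt_mul_sqrt _ (fun p : Fin n × Fin n => ‖A p.1 p.2‖)
    (fun p => ‖B p.1 p.2‖)).trans_eq ?_
  rw [frobNorm, frobNorm, Finset.univ_product_univ, Fintype.sum_prod_type, Fintype.sum_prod_type]

theorem frobInner_add_right (A B C : CMat n) :
    frobInner A (B + C) = frobInner A B + frobInner A C := by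
  simp only [frobInner_eq, ← Finset.sum_add_distrib]
  refine Finset.sum_congr rfl fun i _ => Finset.sum_congr rfl fun j _ => ?_
  simp; ring

theorem frobInner_smul_right (A B : CMat n) (t : ℝ) : frobInner A (t • B) = t * frobInner A B := by
  simp only [frobInner_eq, Finset.mul_sum]
  refine Finset.sum_congr rfl fun i _ => Finset.sum_congr rfl fun j _ => ?_
  simp; ring

theorem frobInner_neg_left (A B : CMat n) : frobInner (-A) B = -frobInner A B := by
  simp only [frobInner_eq, ← Finset.sum_neg_distrib]
  refine Finset.sum_congr rfl fun i _ => Finset.sum_congr rfl fun j _ => ?_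
  simp; ring

theorem frobNorm_neg (A : CMat n) : frobNorm (-A) = frobNorm A := by simp [frobNorm]

/-- In array coordinates the pairing is a linear form with coefficient vector `toArr A`, whose
length is at most `frobNorm A`. -/
theorem integral_exp_frobInner_noise (A : CMat n) (k : Fin L) (t : ℝ) :
    Integrable (fun g => Real.exp (t * frobInner A (noise g k))) (gaussArrayLaw L n) ∧
    ∫ g, Real.exp (t * frobInner A (noise g k)) ∂(gaussArrayLaw L n) ≤
      Real.exp (t ^ 2 * frobNorm A ^ 2 / 2) := by
  set ζ : Fin L × Fin n × Fin n → ℝ := fun p => if p.1 = k then t * toArr A p.2.1 p.2.2 else 0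
    with hζ
  have e : ∀ g : Fin L × Fin n × Fin n → ℝ,
      t * frobInner A (noise (fun k i j => g (k, i, j)) k) = ∑ p, ζ p * g p := by
    intro g
    rw [noise, frobInner_hermitianOf, Fintype.sum_prod_type, Finset.sum_eq_single k]
    · simp only [hζ, if_true, Finset.mul_sum, Fintype.sum_prod_type, mul_assoc]
    · intro k' _ hk'
      simp [hζ, hk']
    · simp
  have e2 : ∑ p, ζ p ^ 2 ≤ t ^ 2 * frobNorm A ^ 2 := by
    rw [Fintype.sum_prod_type, Finset.sum_eq_single k]
    · simp only [hζ, if_true, Fintype.sum_prod_type, mul_pow, ← Finset.mul_sum]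
      exact mul_le_mul_of_nonneg_left (sum_toArr_sq_le A) (sq_nonneg t)
    · intro k' _ hk'
      simp [hζ, hk']
    · simp
  obtain ⟨h1, h2⟩ := integral_exp_sum_stdGauss ζ
  have hm : Measurable fun (g : Fin L × Fin n × Fin n → ℝ) (k : Fin L) (i j : Fin n) =>
    g (k, i, j) := by fun_prop
  have hf : Measurable fun g : Fin L → Fin n → Fin n → ℝ =>
      Real.exp (t * frobInner A (noise g k)) := by
    simp only [noise, frobInner_hermitianOf]; fun_prop
  rw [← stdGauss_map_curry L n]
  constructor
  · rw [integrable_map_measure hf.aestronglyMeasurable hm.aemeasurable]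
    refine h1.congr (Eventually.of_forall fun g => ?_)
    simp only [Function.comp, e]
  · rw [integral_map hm.aemeasurable hf.aestronglyMeasurable]
    simp only [e]
    rw [h2]
    exact Real.exp_le_exp.2 (by linarith)

theorem gaussArrayLaw_tail (A : CMat n) (k : Fin L) {r : ℝ} (hr : 0 ≤ r) :
    gaussArrayLaw L n {g | frobNorm A ≠ 0 ∧ r * √n * frobNorm A ≤ frobInner A (noise g k)} ≤
      ENNReal.ofReal (Real.exp (-(r ^ 2 * n / 2))) := by
  by_cases hA : frobNorm A = 0
  · simp [hA]
  simp only [ne_eq, hA, not_false_eq_true, true_and]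
  have hpos : 0 < frobNorm A := lt_of_le_of_ne (frobNorm_nonneg A) (Ne.symm hA)
  -- The optimal Chernoff parameter. A zero matrix has to be excluded, since then the event `0 ≤ 0`
  -- is certain.
  set t := r * √n / frobNorm A with ht
  obtain ⟨h1, h2⟩ := integral_exp_frobInner_noise A k t
  have h := measure_ge_le_exp_mul_mgf (μ := gaussArrayLaw L n) (X := fun g => frobInner A (noise g k))
    (r * √n * frobNorm A) (t := t) (by positivity) h1
  rw [ENNReal.le_ofReal_iff_toReal_le (measure_ne_top _ _) (Real.exp_nonneg _)]
  refine h.trans ((mul_le_mul_of_nonneg_left h2 (Real.exp_nonneg _)).trans_eq ?_)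
  rw [← Real.exp_add]
  congr 1
  have hs : √(n : ℝ) ^ 2 = n := Real.sq_sqrt (Nat.cast_nonneg n)
  rw [ht]
  field_simp
  rw [hs]; ring

theorem measurable_frobNorm {Ω : Type*} [MeasurableSpace Ω] {A : Ω → CMat n} (hA : Measurable A) :
    Measurable fun ω => frobNorm (A ω) := by
  have h : ∀ i j, Measurable fun ω => A ω i j :=
    fun i j => measurable_pi_iff.1 (measurable_pi_iff.1 hA i) j
  unfold frobNorm; fun_prop

theorem measurable_frobInner {Ω : Type*} [MeasurableSpace Ω] {A B : Ω → CMat n} (hA : Measurable A)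
    (hB : Measurable B) : Measurable fun ω => frobInner (A ω) (B ω) := by
  have h : ∀ i j, Measurable fun ω => A ω i j :=
    fun i j => measurable_pi_iff.1 (measurable_pi_iff.1 hA i) j
  have h' : ∀ i j, Measurable fun ω => B ω i j :=
    fun i j => measurable_pi_iff.1 (measurable_pi_iff.1 hB i) j
  simp only [frobInner_eq]; fun_prop

theorem prod_le_of_section_le {Ω Ω' : Type*} [MeasurableSpace Ω] [MeasurableSpace Ω'] (ν : Measure Ω)
    (μ : Measure Ω') [IsProbabilityMeasure ν] [SFinite μ] {S : Set (Ω × Ω')} (hS : MeasurableSet S)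
    {x : ENNReal} (h : ∀ ω, μ {y | (ω, y) ∈ S} ≤ x) : ν.prod μ S ≤ x := by
  rw [Measure.prod_apply hS]
  exact (lintegral_mono fun ω => h ω).trans (by simp)

theorem prod_gaussArrayLaw_tail {Ω : Type*} [MeasurableSpace Ω] (ν : Measure Ω)
    [IsProbabilityMeasure ν] {A : Ω → CMat n} (hA : Measurable A) (k : Fin L) {r : ℝ} (hr : 0 ≤ r) :
    ν.prod (gaussArrayLaw L n)
      {z | frobNorm (A z.1) ≠ 0 ∧ r * √n * frobNorm (A z.1) ≤ frobInner (A z.1) (noise z.2 k)} ≤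
      ENNReal.ofReal (Real.exp (-(r ^ 2 * n / 2))) := by
  have hA' : Measurable fun z : Ω × (Fin L → Fin n → Fin n → ℝ) => A z.1 := hA.comp measurable_fst
  have hN := measurable_frobNorm hA'
  have hV₀ : Measurable fun z : Ω × (Fin L → Fin n → Fin n → ℝ) => (noise z.2 : Obs L n) :=
    measurable_noise.comp measurable_snd
  have hV := measurable_pi_iff.1 hV₀ k
  have hI := measurable_frobInner hA' hV
  have h0 : MeasurableSet {z : Ω × (Fin L → Fin n → Fin n → ℝ) | frobNorm (A z.1) ≠ 0} :=
    measurableSet_preimage hN (measurableSet_singleton 0).compl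
  have h1 := measurableSet_le (hN.const_mul (r * √n)) hI
  have hS : MeasurableSet {z : Ω × (Fin L → Fin n → Fin n → ℝ) | frobNorm (A z.1) ≠ 0 ∧
      r * √n * frobNorm (A z.1) ≤ frobInner (A z.1) (noise z.2 k)} :=
    h0.inter h1
  exact prod_le_of_section_le ν _ hS fun ω => gaussArrayLaw_tail (A ω) k hr

end Tail

/-! ### Error probabilities of the test -/

section TestError

variable {K L n : ℕ}

theorem measurableSet_hit {X : Obs L n → Tape → CMat n}
    (hX : Measurable fun z : Obs L n × Tape => X z.1 z.2) (a b r : ℝ) (m : Fin K) (k : Fin L) :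
    MeasurableSet {z : (Fin (K + 1) → Obs L n) × Tape |
      Hit X a b r k (z.1 m.succ) (z.1 0) (z.2.part m k)} := by
  have h1 : Measurable fun z : (Fin (K + 1) → Obs L n) × Tape => z.1 m.succ :=
    (measurable_pi_apply m.succ).comp measurable_fst
  have h0 : Measurable fun z : (Fin (K + 1) → Obs L n) × Tape => z.1 0 :=
    (measurable_pi_apply 0).comp measurable_fst
  have hτ : Measurable fun z : (Fin (K + 1) → Obs L n) × Tape => z.2.part m k :=
    (measurePreserving_part m k).measurable.comp measurable_snd
  have hU := (h1.const_smul a).add (h0.const_smul b)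
  have hV := measurable_pi_iff.1 ((h1.const_smul b).add (h0.const_smul (-a))) k
  have hA := hX.comp (hU.prodMk hτ)
  exact measurableSet_lt ((measurable_frobNorm hA).const_mul (r * √n)) (measurable_frobInner hA hV)

/-- The strict inequality in `Hit` excludes a zero estimate, so success lies inside the tail event.
-/
theorem hit_noise {X : Obs L n → Tape → CMat n} {a b r : ℝ} {k : Fin L}
    {g g₀ : Fin L → Fin n → Fin n → ℝ} {τ : Tape} (h : Hit X a b r k (noise g) (noise g₀) τ) :
    frobNorm (X (noise (a • g + b • g₀)) τ) ≠ 0 ∧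
      r * √n * frobNorm (X (noise (a • g + b • g₀)) τ) ≤
        frobInner (X (noise (a • g + b • g₀)) τ) (noise (b • g + (-a) • g₀) k) := by
  simp only [Hit, ← noise_smul, ← noise_add] at h
  refine ⟨fun h0 => ?_, h.le⟩
  have h1 := abs_frobInner_le (X (noise (a • g + b • g₀)) τ) (noise (b • g + (-a) • g₀) k)
  rw [h0, zero_mul] at h1
  rw [h0, mul_zero] at h
  linarith [le_abs_self (frobInner (X (noise (a • g + b • g₀)) τ) (noise (b • g + (-a) • g₀) k))]

/-- Under the null law the two rotated samples are independent, so the tail bound applies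
conditionally on the estimate. -/
theorem hiddenNull_hit_le {X : Obs L n → Tape → CMat n}
    (hX : Measurable fun z : Obs L n × Tape => X z.1 z.2) {a b r : ℝ} (hb : 0 ≤ b)
    (hab : a ^ 2 + b ^ 2 = 1) (hr : 0 ≤ r) (m : Fin K) (k : Fin L) :
    ((hiddenNull (K + 1) L n).prod tapeLaw)
      {z | Hit X a b r k (z.1 m.succ) (z.1 0) (z.2.part m k)} ≤
      ENNReal.ofReal (Real.exp (-(r ^ 2 * n / 2))) := by
  have hmp : MeasurePreserving (fun (g : Fin (K + 1) → Fin L → Fin n → Fin n → ℝ) m =>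
      (noise (g m) : Obs L n)) (Measure.pi fun _ => gaussArrayLaw L n) (hiddenNull (K + 1) L n) :=
    ⟨measurable_pi_noise, hiddenNull_eq_map_pi.symm⟩
  have hΦ := (hmp.comp (measurePreserving_snd (μ := phaseLaw n)
    (ν := Measure.pi fun _ : Fin (K + 1) => gaussArrayLaw L n))).prod
      (MeasurePreserving.id tapeLaw)
  rw [← hΦ.measure_preimage (measurableSet_hit hX a b r m k).nullMeasurableSet]
  have hs := measurePreserving_split (L := L) (n := n) (Fin.succ_ne_zero m) hb hab m k
  have hA : Measurable fun ω : ((Fin n → ℝ) × (Fin L → Fin n → Fin n → ℝ)) × Tape =>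
      X (noise ω.1.2) ω.2 :=
    hX.comp ((measurable_noise.comp (measurable_snd.comp measurable_fst)).prodMk measurable_snd)
  have ht := prod_gaussArrayLaw_tail (((phaseLaw n).prod (gaussArrayLaw L n)).prod tapeLaw) hA k hr
  rw [← hs.map_eq] at ht
  refine le_trans ?_ ((Measure.le_map_apply hs.measurable.aemeasurable _).trans ht)
  refine measure_mono fun z hz => ?_
  exact hit_noise hz

/-- Reverse Markov inequality, from `f ≤ 1_{f ≥ c/2} + c/2`. -/
theorem measure_lt_half_le {Ω : Type*} [MeasurableSpace Ω] {ν : Measure Ω} [IsProbabilityMeasure ν]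
    {f : Ω → ℝ} (hf : Measurable f) (hf1 : ∀ ω, |f ω| ≤ 1) {c : ℝ} (hc : 0 ≤ c) (h : c ≤ ∫ ω, f ω ∂ν) :
    ν {ω | f ω < c / 2} ≤ ENNReal.ofReal (1 - c / 2) := by
  have hS : MeasurableSet {ω | f ω < c / 2} := measurableSet_lt hf measurable_const
  have hi : Integrable (({ω | f ω < c / 2}ᶜ).indicator fun _ => (1 : ℝ)) ν :=
    (integrable_const 1).indicator hS.compl
  have h1 : ∫ ω, f ω ∂ν ≤ ∫ ω, (({ω | f ω < c / 2}ᶜ).indicator (fun _ => (1 : ℝ)) ω + c / 2) ∂ν := by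
    refine integral_mono (Integrable.of_bound hf.aestronglyMeasurable 1
      (Eventually.of_forall hf1)) (hi.add (integrable_const _)) fun ω => ?_
    by_cases hω : f ω < c / 2
    · simp only [Set.indicator, Set.mem_compl_iff, Set.mem_ofPred_eq, hω, not_true, if_false]
      linarith
    · simp only [Set.indicator, Set.mem_compl_iff, Set.mem_ofPred_eq, hω, not_false_eq_true, if_true]
      linarith [(abs_le.1 (hf1 ω)).2]
  rw [integral_add hi (integrable_const _), integral_indicator hS.compl] at h1
  simp only [integral_const, smul_eq_mul, mul_one, probReal_univ, one_mul,
    measureReal_restrict_apply_univ, probReal_compl_eq_one_sub hS] at h1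
  have h2 : ν.real {ω | f ω < c / 2} ≤ 1 - c / 2 := by linarith
  rw [← ofReal_measureReal]
  exact ENNReal.ofReal_le_ofReal h2

theorem abs_correlation_le_one (A B : CMat n) : |correlation A B| ≤ 1 := by
  rw [correlation, abs_div, abs_of_nonneg (mul_nonneg (frobNorm_nonneg A) (frobNorm_nonneg B))]
  exact div_le_one_of_le₀ (abs_frobInner_le A B)
    (mul_nonneg (frobNorm_nonneg A) (frobNorm_nonneg B))

/-- Correlation does not depend on the strength of the signal, so it passes to the second half,
where the strength is at least `d`. Positive correlation excludes `lam = 0`, `n = 0` and a zero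
estimate, for which the quotient is `0`. -/
theorem frobInner_signal_ge {lam d b c : ℝ} (hlam : 0 ≤ lam) (hd : 0 ≤ d) (hc : 0 < c)
    (hbd : d ≤ b * (lam + d)) (φ : Fin n → ℝ) (k : Fin L) {A : CMat n}
    (h : c / 2 ≤ correlation A (signal lam φ k)) :
    frobNorm A ≠ 0 ∧ c * d / 2 * (√n * frobNorm A) ≤
      frobInner A (((b * (lam + d)) • signal (L := L) 1 φ) k) := by
  rw [correlation, frobNorm_signal, abs_of_nonneg hlam, signal_eq_smul, Pi.smul_apply,
    frobInner_smul_right] at h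
  have hA : frobNorm A ≠ 0 := by
    intro h0
    rw [h0, zero_mul, div_zero] at h
    linarith
  have hlam0 : lam ≠ 0 := by
    rintro rfl
    simp at h
    linarith
  have hn0 : √(n : ℝ) ≠ 0 := by
    intro h0
    rw [h0, mul_zero, mul_zero, div_zero] at h
    linarith
  have hApos : 0 < frobNorm A := lt_of_le_of_ne (frobNorm_nonneg A) (Ne.symm hA)
  have hnpos : 0 < √(n : ℝ) := lt_of_le_of_ne (Real.sqrt_nonneg _) (Ne.symm hn0)
  refine ⟨hA, ?_⟩
  rw [Pi.smul_apply, frobInner_smul_right]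
  have h1 : c / 2 * (√n * frobNorm A) ≤ frobInner A (signal 1 φ k) := by
    have e : lam * frobInner A (signal 1 φ k) / (frobNorm A * (lam * √n)) =
        frobInner A (signal 1 φ k) / (√n * frobNorm A) := by
      field_simp
    rwa [e, le_div_iff₀ (by positivity)] at h
  have h2 : 0 ≤ c / 2 * (√n * frobNorm A) := by positivity
  calc c * d / 2 * (√n * frobNorm A) = d * (c / 2 * (√n * frobNorm A)) := by ring
    _ ≤ b * (lam + d) * (c / 2 * (√n * frobNorm A)) := mul_le_mul_of_nonneg_right hbd h2
    _ ≤ b * (lam + d) * frobInner A (signal 1 φ k) :=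
      mul_le_mul_of_nonneg_left h1 (hd.trans hbd)

/-- A miss requires low correlation or a noise term below `-r √n ‖X‖`: otherwise the signal
contributes at least `2 r √n ‖X‖` and the noise removes less than half of it. -/
theorem planted_miss_le {X : Obs L n → Tape → CMat n}
    (hX : Measurable fun z : Obs L n × Tape => X z.1 z.2) {lam d a b c : ℝ} (hlam : 0 ≤ lam)
    (hd : 0 ≤ d) (hc : 0 < c) (hb : 0 ≤ b) (hab : a ^ 2 + b ^ 2 = 1) (ha : a * (lam + d) = lam)
    (hbd : d ≤ b * (lam + d)) (m : Fin K) (k : Fin L) (hcorr : c ≤ expectedCorrelation lam k X) :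
    ((Measure.pi fun i => if i = m.succ then plantedLaw L n (lam + d) else nullLaw L n).prod tapeLaw)
      {z | ¬ Hit X a b (c * d / 4) k (z.1 m.succ) (z.1 0) (z.2.part m k)} ≤
      ENNReal.ofReal (1 - c / 2) + ENNReal.ofReal (Real.exp (-((c * d / 4) ^ 2 * n / 2))) := by
  have hmp : MeasurePreserving (fun (z : (Fin n → ℝ) × (Fin (K + 1) → Fin L → Fin n → Fin n → ℝ))
      (i : Fin (K + 1)) =>
        (noise (z.2 i + if i = m.succ then signalArr (lam + d) z.1 else 0) : Obs L n))
      ((phaseLaw n).prod (Measure.pi fun _ => gaussArrayLaw L n))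
      (Measure.pi fun i => if i = m.succ then plantedLaw L n (lam + d) else nullLaw L n) :=
    ⟨measurable_hidden_shift (lam + d) m.succ, (pi_planted_eq_map (lam + d) m.succ).symm⟩
  have hp : ∀ i, IsProbabilityMeasure
      (if i = m.succ then plantedLaw L n (lam + d) else nullLaw L n) := by
    intro i; split_ifs <;> infer_instance
  have hΦ := hmp.prod (MeasurePreserving.id tapeLaw)
  have hmeas := (measurableSet_hit hX a b (c * d / 4) m k).compl
  rw [← hΦ.measure_preimage (s := {z | ¬ Hit X a b (c * d / 4) k (z.1 m.succ) (z.1 0)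
    (z.2.part m k)}) hmeas.nullMeasurableSet]
  have hs := measurePreserving_split (L := L) (n := n) (Fin.succ_ne_zero m) hb hab m k
  have hA : Measurable fun ω : ((Fin n → ℝ) × (Fin L → Fin n → Fin n → ℝ)) × Tape =>
      X (observe lam ω.1.1 ω.1.2) ω.2 :=
    hX.comp (((measurable_observe lam).comp measurable_fst).prodMk measurable_snd)
  have hsig : Measurable fun ω : ((Fin n → ℝ) × (Fin L → Fin n → Fin n → ℝ)) × Tape =>
      signal lam ω.1.1 k := by
    refine measurable_pi_iff.2 fun i => measurable_pi_iff.2 fun j => ?_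
    exact (continuous_signal lam k i j).measurable.comp (measurable_fst.comp measurable_fst)
  have hcm : Measurable fun ω : ((Fin n → ℝ) × (Fin L → Fin n → Fin n → ℝ)) × Tape =>
      correlation (X (observe lam ω.1.1 ω.1.2) ω.2) (signal lam ω.1.1 k) :=
    (measurable_frobInner hA hsig).div ((measurable_frobNorm hA).mul (measurable_frobNorm hsig))
  have h1 := measure_lt_half_le (ν := ((phaseLaw n).prod (gaussArrayLaw L n)).prod tapeLaw) hcm
    (fun ω => abs_correlation_le_one _ _) hc.le hcorr
  have h1' := (measurePreserving_fst (μ := ((phaseLaw n).prod (gaussArrayLaw L n)).prod tapeLaw)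
    (ν := gaussArrayLaw L n)).measure_preimage
      (measurableSet_lt hcm (measurable_const (a := c / 2))).nullMeasurableSet
  rw [← h1'] at h1
  -- The upper tail bound for the negated estimate is the lower tail bound.
  have h2 := prod_gaussArrayLaw_tail (((phaseLaw n).prod (gaussArrayLaw L n)).prod tapeLaw) hA.neg k
    (r := c * d / 4) (by positivity)
  have h3 := (measure_union_le _ _).trans (add_le_add h1 h2)
  rw [← hs.map_eq] at h3
  refine le_trans ?_ ((Measure.le_map_apply hs.measurable.aemeasurable _).trans h3)
  refine measure_mono fun z hz => ?_
  obtain ⟨⟨φ, g⟩, τ⟩ := z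
  by_contra hcon
  simp only [Set.mem_preimage, Set.mem_union, Set.mem_ofPred_eq, not_or, not_lt, not_and,
    not_le] at hcon
  obtain ⟨hc1, hc2⟩ := hcon
  obtain ⟨hne, hge⟩ := frobInner_signal_ge (L := L) hlam hd hc hbd φ k hc1
  refine hz ?_
  have hc3 := hc2 (by rwa [Pi.neg_apply, frobNorm_neg])
  rw [Pi.neg_apply, frobNorm_neg, frobInner_neg_left] at hc3
  -- The choice of `a` reduces the strength `lam + d` to exactly `lam`, where the estimator is
  -- guaranteed to work.
  have e1 : a • (noise (g m.succ + signalArr (lam + d) φ) : Obs L n) + b • noise (g 0) =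
      observe lam φ (a • g m.succ + b • g 0) := by
    rw [observe_eq_add, signal_eq_smul lam, noise_add, noise_signalArr, noise_add, noise_smul,
      noise_smul, signal_eq_smul (lam + d), smul_add, smul_smul, ha]
    abel
  have e2 : b • (noise (g m.succ + signalArr (lam + d) φ) : Obs L n) + (-a) • noise (g 0) =
      noise (b • g m.succ + (-a) • g 0) + (b * (lam + d)) • signal 1 φ := by
    rw [noise_add, noise_signalArr, noise_add, noise_smul,
      noise_smul, signal_eq_smul (lam + d), smul_add, smul_smul]
    abel
  simp only [Hit, Prod.map_apply, id, if_true, (Fin.succ_ne_zero m).symm, if_false,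
    add_zero]
  rw [e1, e2, Pi.add_apply, frobInner_add_right]
  linarith

open Classical in
/-- The test: some statistic is large. -/
def hitTest (X : Fin L → Obs L n → Tape → CMat n) (a b r : ℝ) (Y : Fin (K + 1) → Obs L n)
    (τ : Tape) : Bool :=
  decide (∃ (m : Fin K) (k : Fin L), Hit (X k) a b r k (Y m.succ) (Y 0) (τ.part m k))

theorem hitTest_eq_true_iff {X : Fin L → Obs L n → Tape → CMat n} {a b r : ℝ}
    {Y : Fin (K + 1) → Obs L n} {τ : Tape} : hitTest X a b r Y τ = true ↔
      ∃ (m : Fin K) (k : Fin L), Hit (X k) a b r k (Y m.succ) (Y 0) (τ.part m k) := by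
  simp [hitTest]

theorem num_ite_eq_flag {A : Bool} {P : Prop} (h : A = true ↔ P) :
    Data.num (if A = true then 1 else 0) = flag P := by
  cases A <;> simp_all [flag]

theorem measurable_hitTest {X : Fin L → Obs L n → Tape → CMat n}
    (hX : ∀ k, Measurable fun z : Obs L n × Tape => X k z.1 z.2) (a b r : ℝ) :
    Measurable fun z : (Fin (K + 1) → Obs L n) × Tape => hitTest X a b r z.1 z.2 := by
  refine measurable_to_bool ?_
  have e : (fun z : (Fin (K + 1) → Obs L n) × Tape => hitTest X a b r z.1 z.2) ⁻¹' {true} =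
      ⋃ (m : Fin K) (k : Fin L), {z | Hit (X k) a b r k (z.1 m.succ) (z.1 0) (z.2.part m k)} := by
    ext z
    simp [hitTest_eq_true_iff]
  rw [e]
  exact MeasurableSet.iUnion fun m => MeasurableSet.iUnion fun k => measurableSet_hit (hX k) a b r m k

theorem hiddenNull_hitTest_le {X : Fin L → Obs L n → Tape → CMat n}
    (hX : ∀ k, Measurable fun z : Obs L n × Tape => X k z.1 z.2) {a b r : ℝ} (hb : 0 ≤ b)
    (hab : a ^ 2 + b ^ 2 = 1) (hr : 0 ≤ r) :
    ((hiddenNull (K + 1) L n).prod tapeLaw).real {z | hitTest X a b r z.1 z.2 = true} ≤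
      K * (L * Real.exp (-(r ^ 2 * n / 2))) := by
  have e : {z : (Fin (K + 1) → Obs L n) × Tape | hitTest X a b r z.1 z.2 = true} =
      ⋃ (m : Fin K) (k : Fin L), {z | Hit (X k) a b r k (z.1 m.succ) (z.1 0) (z.2.part m k)} := by
    ext z
    simp [hitTest_eq_true_iff]
  have h : ((hiddenNull (K + 1) L n).prod tapeLaw) {z | hitTest X a b r z.1 z.2 = true} ≤
      K * (L * ENNReal.ofReal (Real.exp (-(r ^ 2 * n / 2)))) := by
    rw [e]
    refine (measure_iUnion_fintype_le _ _).trans ?_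
    refine (Finset.sum_le_sum fun m _ => (measure_iUnion_fintype_le _ _).trans
      (Finset.sum_le_sum fun k _ => hiddenNull_hit_le (hX k) hb hab hr m k)).trans ?_
    simp
  refine ENNReal.toReal_le_of_le_ofReal (by positivity) (h.trans_eq ?_)
  rw [ENNReal.ofReal_mul (by positivity), ENNReal.ofReal_mul (by positivity),
    ENNReal.ofReal_natCast, ENNReal.ofReal_natCast]

theorem hiddenPlanted_prod_apply (M : ℕ) (lam : ℝ) {S : Set ((Fin M → Obs L n) × Tape)}
    (hS : MeasurableSet S) :
    ((hiddenPlanted M L n lam).prod tapeLaw) S = (M : ENNReal)⁻¹ * ∑ κ : Fin M,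
      ((Measure.pi fun m => if m = κ then plantedLaw L n lam else nullLaw L n).prod tapeLaw) S := by
  rw [Measure.prod_apply hS, hiddenPlanted, lintegral_smul_measure, lintegral_finsetSum_measure]
  simp_rw [Measure.prod_apply hS]
  rfl

theorem hiddenPlanted_hitTest_le {X : Fin L → Obs L n → Tape → CMat n}
    (hX : ∀ k, Measurable fun z : Obs L n × Tape => X k z.1 z.2) {lam d a b c : ℝ} (hlam : 0 ≤ lam)
    (hd : 0 ≤ d) (hc : 0 < c) (hc2 : c ≤ 2) (hb : 0 ≤ b) (hab : a ^ 2 + b ^ 2 = 1)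
    (ha : a * (lam + d) = lam)
    (hbd : d ≤ b * (lam + d)) (k : Fin L) (hcorr : c ≤ expectedCorrelation lam k (X k)) :
    ((hiddenPlanted (K + 1) L n (lam + d)).prod tapeLaw).real
      {z | hitTest X a b (c * d / 4) z.1 z.2 = false} ≤
      ((K : ℝ) + 1)⁻¹ + (1 - c / 2 + Real.exp (-((c * d / 4) ^ 2 * n / 2))) := by
  set B : ℝ := 1 - c / 2 + Real.exp (-((c * d / 4) ^ 2 * n / 2)) with hB
  have hB0 : 0 ≤ B := add_nonneg (by linarith) (Real.exp_nonneg _)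
  have hS : MeasurableSet {z : (Fin (K + 1) → Obs L n) × Tape |
      hitTest X a b (c * d / 4) z.1 z.2 = false} :=
    measurable_hitTest hX a b (c * d / 4) (measurableSet_singleton false)
  have hp : ∀ κ i : Fin (K + 1), IsProbabilityMeasure
      (if i = κ then plantedLaw L n (lam + d) else nullLaw L n) := by
    intro κ i; split_ifs <;> infer_instance
  have h : ((hiddenPlanted (K + 1) L n (lam + d)).prod tapeLaw)
      {z | hitTest X a b (c * d / 4) z.1 z.2 = false} ≤
      ((K + 1 : ℕ) : ENNReal)⁻¹ * (1 + K * ENNReal.ofReal B) := by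
    rw [hiddenPlanted_prod_apply _ _ hS, Fin.sum_univ_succ]
    gcongr
    -- If the hidden sample is the reference sample, nothing is claimed; this costs `1 / (K + 1)`.
    · exact prob_le_one
    · refine (Finset.sum_le_sum fun m _ => ?_).trans (b := ∑ m : Fin K, ENNReal.ofReal B) (by simp)
      rw [hB, ENNReal.ofReal_add (by linarith) (Real.exp_nonneg _)]
      refine le_trans (measure_mono ?_) (planted_miss_le (hX k) hlam hd hc hb hab ha hbd m k hcorr)
      intro z hz hit
      have : hitTest X a b (c * d / 4) z.1 z.2 = true := hitTest_eq_true_iff.2 ⟨m, k, hit⟩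
      simp only [Set.mem_ofPred_eq] at hz
      rw [hz] at this
      exact Bool.noConfusion this
  refine ENNReal.toReal_le_of_le_ofReal (by positivity) (h.trans ?_)
  have e : ((K + 1 : ℕ) : ENNReal)⁻¹ * (1 + K * ENNReal.ofReal B) =
      ENNReal.ofReal (((K : ℝ) + 1)⁻¹ * (1 + K * B)) := by
    rw [ENNReal.ofReal_mul (by positivity), ENNReal.ofReal_inv_of_pos (by positivity),
      ENNReal.ofReal_add zero_le_one (by positivity), ENNReal.ofReal_mul (by positivity),
      ENNReal.ofReal_add (by positivity) zero_le_one]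
    simp
  rw [e]
  refine ENNReal.ofReal_le_ofReal ?_
  rw [mul_add, mul_one]
  gcongr
  rw [← mul_assoc]
  refine mul_le_of_le_one_left hB0 ?_
  rw [inv_mul_le_iff₀ (by positivity)]
  linarith

theorem testError_hitTest_le {X : Fin L → Obs L n → Tape → CMat n}
    (hX : ∀ k, Measurable fun z : Obs L n × Tape => X k z.1 z.2) {lam d c : ℝ} (hlam : 0 ≤ lam)
    (hd : 0 < d) (hc : 0 < c) (hc2 : c ≤ 2) (k : Fin L)
    (hcorr : c ≤ expectedCorrelation lam k (X k)) :
    testError (hiddenPlanted (K + 1) L n (lam + d)) (hiddenNull (K + 1) L n)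
      (hitTest X (lam / (lam + d)) (√(1 - lam / (lam + d) * (lam / (lam + d)))) (c * d / 4)) ≤
      (K * L + 1) * Real.exp (-((c * d / 4) ^ 2 * n / 2)) + ((K : ℝ) + 1)⁻¹ + (1 - c / 2) := by
  have hpos : 0 < lam + d := by linarith
  set a := lam / (lam + d) with ha
  have ha1 : a * (lam + d) = lam := by rw [ha]; field_simp
  have hsq : 0 ≤ 1 - a * a := by
    have h0 : 0 ≤ a := by positivity
    have h1 : a ≤ 1 := by rw [ha, div_le_one hpos]; linarith
    nlinarith
  have hb2 : √(1 - a * a) ^ 2 = 1 - a * a := Real.sq_sqrt hsq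
  -- The squared right side is `(lam + d)² - lam² = d² + 2 lam d`.
  have hbd : d ≤ √(1 - a * a) * (lam + d) := by
    refine abs_le_of_sq_le_sq' ?_ (by positivity) |>.2
    rw [mul_pow, hb2]
    nlinarith [mul_nonneg hlam hd.le]
  have h1 := hiddenNull_hitTest_le (K := K) hX (a := a) (b := √(1 - a * a)) (r := c * d / 4)
    (Real.sqrt_nonneg _) (by rw [hb2]; ring) (by positivity)
  have h2 := hiddenPlanted_hitTest_le (K := K) hX (a := a) (b := √(1 - a * a)) hlam hd.le hc hc2
    (Real.sqrt_nonneg _) (by rw [hb2]; ring) ha1 hbd k hcorr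
  refine (add_le_add h1 h2).trans_eq ?_
  ring

end TestError

/-! ### Asymptotics -/

/-- Here `exp (c y)` stands for `(1 - s)^(-L)`, `exp (-y²)` for the number of samples, and the
polynomial for the squared degree. -/
theorem tendsto_pow_mul_exp_sub_sq (c : ℝ) :
    Tendsto (fun y : ℝ => 2 * Real.exp 1 * (y ^ 4 + 1) ^ 2 * Real.exp (c * y - y ^ 2)) atTop
      (𝓝 0) := by
  have h := (Real.tendsto_pow_mul_exp_neg_atTop_nhds_zero 8).const_mul (8 * Real.exp 1)
  rw [mul_zero] at h
  refine squeeze_zero' (Eventually.of_forall fun y => by positivity) ?_ h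
  filter_upwards [eventually_ge_atTop (1 : ℝ), eventually_ge_atTop (c + 1)] with y h1 h2
  have h4 : (1 : ℝ) ≤ y ^ 4 := one_le_pow₀ h1
  have h5 : (y ^ 4 + 1) ^ 2 ≤ 4 * y ^ 8 := by nlinarith
  have h6 : Real.exp (c * y - y ^ 2) ≤ Real.exp (-y) := Real.exp_le_exp.2 (by nlinarith)
  calc 2 * Real.exp 1 * (y ^ 4 + 1) ^ 2 * Real.exp (c * y - y ^ 2)
      ≤ 2 * Real.exp 1 * (4 * y ^ 8) * Real.exp (-y) := by gcongr
    _ = 8 * Real.exp 1 * (y ^ 8 * Real.exp (-y)) := by ring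

/-- This is `D L / n → 0`, which sends the correction factor in the moment bound to one. -/
theorem tendsto_pow_four_div_pow_eight :
    Tendsto (fun y : ℝ => (y ^ 4 + 1) * (y / y ^ 8)) atTop (𝓝 0) := by
  have h := tendsto_inv_atTop_zero.const_mul (2 : ℝ)
  rw [mul_zero] at h
  refine squeeze_zero' ?_ ?_ h
  · filter_upwards [eventually_ge_atTop (1 : ℝ)] with y h1
    positivity
  filter_upwards [eventually_ge_atTop (1 : ℝ)] with y h1
  have h4 : (1 : ℝ) ≤ y ^ 4 := one_le_pow₀ h1
  have h2 : (1 : ℝ) ≤ y ^ 2 := one_le_pow₀ h1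
  have e : (y ^ 4 + 1) * (y / y ^ 8) = (y ^ 4 + 1) / y ^ 6 * y⁻¹ := by field_simp
  rw [e]
  gcongr
  rw [div_le_iff₀ (by positivity)]
  nlinarith

theorem eventually_time_le {C : ℝ} (hC : 0 < C) :
    ∀ᶠ y : ℝ in atTop,
      (Real.exp (y ^ 2) + 1) *
        (y * (Real.exp y + (y ^ 8 * (y ^ 8 * 700 + 600) + 700)) + 400) + 200 ≤
        Real.exp (y ^ 4 / C) := by
  have hsmall := (Real.tendsto_pow_mul_exp_neg_atTop_nhds_zero 16).eventually_lt_const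
    (show (0 : ℝ) < 1 / 2000 by norm_num)
  filter_upwards [hsmall, eventually_ge_atTop (1 : ℝ), eventually_ge_atTop (4 * C),
    eventually_ge_atTop (1004 : ℝ)] with y h0 h1 h2 h3
  have hE : y ≤ Real.exp y := by linarith [Real.add_one_le_exp y]
  have hE1 : 1 ≤ Real.exp y := h1.trans hE
  have hQ1 : 1 ≤ Real.exp (y ^ 2) := Real.one_le_exp (by positivity)
  have hpoly : y ^ 8 * (y ^ 8 * 700 + 600) + 700 ≤ Real.exp y := by
    have h8 : (1 : ℝ) ≤ y ^ 8 := one_le_pow₀ h1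
    have h16 : y ^ 8 * (y ^ 8 * 700 + 600) + 700 ≤ 2000 * y ^ 16 := by nlinarith
    rw [Real.exp_neg, ← div_eq_mul_inv, div_lt_iff₀ (Real.exp_pos y)] at h0
    linarith
  -- Two factors `exp y` absorb the frequencies, the recovery algorithm and the polynomial overhead;
  -- the third absorbs the constant `1004`.
  have hexp : Real.exp (y ^ 2) * Real.exp y ^ 3 ≤ Real.exp (y ^ 4 / C) := by
    rw [← Real.exp_nat_mul, ← Real.exp_add]
    refine Real.exp_le_exp.2 ?_
    rw [le_div_iff₀ hC]
    have h5 : y ^ 2 + 3 * y ≤ 4 * y ^ 2 := by nlinarith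
    have h6 : 4 * C ≤ y ^ 2 := by nlinarith
    have h7 : y ^ 2 * (4 * C) ≤ y ^ 2 * y ^ 2 := by gcongr
    push_cast
    nlinarith
  refine le_trans ?_ hexp
  set E := Real.exp y
  set Q := Real.exp (y ^ 2)
  have hE2 : 1 ≤ E ^ 2 := one_le_pow₀ hE1
  have hQE : 1 ≤ Q * E ^ 2 := one_le_mul_of_one_le_of_one_le hQ1 hE2
  calc (Q + 1) * (y * (E + (y ^ 8 * (y ^ 8 * 700 + 600) + 700)) + 400) + 200
      ≤ (Q + Q) * (E * (E + E) + 400 * E ^ 2) + 200 * (Q * E ^ 2) := by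
        gcongr
        · linarith
        · linarith
    _ = 1004 * (Q * E ^ 2) := by ring
    _ ≤ E * (Q * E ^ 2) := by gcongr; linarith
    _ = Q * E ^ 3 := by ring

theorem eventually_error_le {κ c : ℝ} (hκ : 0 < κ) (hc : 0 < c) :
    ∀ᶠ y : ℝ in atTop,
      ((Real.exp (y ^ 2) + 1) * y + 1) * Real.exp (-(κ * y ^ 8)) + Real.exp (-y ^ 2) ≤ c := by
  have hsmall := Real.tendsto_exp_neg_atTop_nhds_zero.eventually_lt_const
    (show (0 : ℝ) < c / 2 by positivity)
  filter_upwards [hsmall, eventually_ge_atTop (3 : ℝ), eventually_ge_atTop (4 / κ)] with y h0 h1 h2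
  have hE : y ≤ Real.exp y := by linarith [Real.add_one_le_exp y]
  have hQ1 : 1 ≤ Real.exp (y ^ 2) := Real.one_le_exp (by positivity)
  rw [div_le_iff₀ hκ] at h2
  have h3 : Real.exp (-y ^ 2) ≤ Real.exp (-y) := Real.exp_le_exp.2 (by nlinarith)
  have h4 : (Real.exp (y ^ 2) + 1) * y + 1 ≤ Real.exp (y ^ 2 + 2 * y) := by
    have e : Real.exp (y ^ 2 + 2 * y) = Real.exp (y ^ 2) * Real.exp y ^ 2 := by
      rw [← Real.exp_nat_mul, ← Real.exp_add]; push_cast; rfl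
    rw [e]
    nlinarith [mul_nonneg (sub_nonneg.2 hQ1) (show 0 ≤ Real.exp y ^ 2 by positivity),
      mul_nonneg (sub_nonneg.2 hQ1) (show 0 ≤ Real.exp y ^ 2 - y by nlinarith)]
  have h5 : Real.exp (y ^ 2 + 2 * y) * Real.exp (-(κ * y ^ 8)) ≤ Real.exp (-y) := by
    rw [← Real.exp_add]
    refine Real.exp_le_exp.2 ?_
    have h6 : y ^ 2 * 4 ≤ y ^ 2 * (y * κ) := by gcongr
    have h7 : y ^ 3 ≤ y ^ 8 := pow_le_pow_right₀ (by linarith) (by norm_num)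
    nlinarith
  have h6 : ((Real.exp (y ^ 2) + 1) * y + 1) * Real.exp (-(κ * y ^ 8)) ≤ Real.exp (-y) :=
    (mul_le_mul_of_nonneg_right h4 (Real.exp_nonneg _)).trans h5
  linarith

/-- The scale `n ^ (1 / 8)`. -/
def scale (n : ℕ) : ℝ := (n : ℝ) ^ (1 / 8 : ℝ)

theorem scale_nonneg (n : ℕ) : 0 ≤ scale n := Real.rpow_nonneg (Nat.cast_nonneg n) _

theorem scale_pow (n : ℕ) : scale n ^ 8 = n := by
  rw [scale, ← Real.rpow_natCast, ← Real.rpow_mul (Nat.cast_nonneg n)]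
  norm_num

theorem tendsto_scale : Tendsto scale atTop atTop :=
  (tendsto_rpow_atTop (by norm_num)).comp tendsto_natCast_atTop_atTop

/-- The number of additional samples. -/
def numSamples (n : ℕ) : ℕ := ⌈Real.exp (scale n ^ 2)⌉₊

/-- The degree of the polynomials. -/
def polyDegree (n : ℕ) : ℕ := ⌈scale n ^ 4⌉₊

theorem exp_le_numSamples (n : ℕ) : Real.exp (scale n ^ 2) ≤ numSamples n := Nat.le_ceil _

theorem numSamples_le (n : ℕ) : (numSamples n : ℝ) ≤ Real.exp (scale n ^ 2) + 1 :=
  (Nat.ceil_lt_add_one (Real.exp_nonneg _)).le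

theorem polyDegree_le (n : ℕ) : (polyDegree n : ℝ) ≤ scale n ^ 4 + 1 :=
  (Nat.ceil_lt_add_one (by have := scale_nonneg n; positivity)).le

theorem tendsto_lowDegAdv {L : ℕ → ℕ} (hL : ∀ᶠ n in atTop, (L n : ℝ) ≤ scale n) {lam : ℕ → ℝ} {q : ℝ}
    (hq : q < 1) (hlam : ∀ n, 0 ≤ lam n ∧ lam n < q) :
    Tendsto (fun n => lowDegAdv hiddenCoord (hiddenPlanted (numSamples n + 1) (L n) n (lam n))
      (hiddenNull (numSamples n + 1) (L n) n) (polyDegree n)) atTop (𝓝 1) := by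
  have hq0 : 0 < q := (hlam 0).1.trans_lt (hlam 0).2
  have hq2 : q ^ 2 < 1 := by nlinarith
  obtain ⟨s, hs1, hs2⟩ := exists_between hq2
  have hs0 : 0 < s := lt_trans (by positivity) hs1
  have hR : 1 ≤ (1 - s)⁻¹ := (one_le_inv₀ (by linarith)).2 (by linarith)
  have hbound : Tendsto (fun n => ((√(1 + 2 * Real.exp 1 * (scale n ^ 4 + 1) ^ 2 *
      Real.exp (Real.log (1 - s)⁻¹ * scale n - scale n ^ 2)) : ℝ) : EReal)) atTop (𝓝 1) := by
    have h := ((tendsto_pow_mul_exp_sub_sq (Real.log (1 - s)⁻¹)).comp tendsto_scale).const_add 1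
    have h2 := (Real.continuous_sqrt.tendsto _).comp h
    rw [add_zero, Real.sqrt_one] at h2
    exact (continuous_coe_real_ereal.tendsto 1).comp h2
  -- The left side tends to `q²`, and `s` was chosen strictly between `q²` and `1`.
  have hexp : ∀ᶠ n in atTop, q ^ 2 * Real.exp (Real.exp (2 * √((scale n ^ 4 + 1) *
      (scale n / scale n ^ 8))) - 1) < s := by
    have h1 : Tendsto (fun x : ℝ => q ^ 2 * Real.exp (Real.exp (2 * √x) - 1)) (𝓝 0) (𝓝 (q ^ 2)) := by
      have : Continuous fun x : ℝ => q ^ 2 * Real.exp (Real.exp (2 * √x) - 1) := by fun_prop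
      simpa using this.tendsto 0
    exact ((h1.comp tendsto_pow_four_div_pow_eight).comp tendsto_scale).eventually_lt_const hs1
  refine tendsto_of_tendsto_of_tendsto_of_le_of_le' tendsto_const_nhds hbound
    (Eventually.of_forall fun n => one_le_lowDegAdv_hidden (by omega) _ _) ?_
  filter_upwards [hL, hexp, eventually_ge_atTop 1] with n hLn hen hn
  have hsc := scale_nonneg n
  have hlow : lam n ^ 2 * Real.exp (Real.exp (2 * √((polyDegree n : ℝ) * ((L n : ℝ) / n))) - 1) ≤
      s := by
    refine le_trans ?_ hen.le
    have hl2 : lam n ^ 2 ≤ q ^ 2 := pow_le_pow_left₀ (hlam n).1 (hlam n).2.le 2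
    have hd := polyDegree_le n
    rw [scale_pow]
    gcongr
  refine (lowDegAdv_hidden_le (by omega) (by omega) hs0 hs2 hlow).trans ?_
  refine EReal.coe_le_coe_iff.2 (Real.sqrt_le_sqrt (add_le_add_right ?_ 1))
  have hM : (((numSamples n + 1 : ℕ) : ℝ))⁻¹ ≤ Real.exp (-scale n ^ 2) := by
    rw [Real.exp_neg]
    refine inv_anti₀ (Real.exp_pos _) ((exp_le_numSamples n).trans ?_)
    push_cast; linarith
  have hRL : ((1 - s)⁻¹) ^ L n ≤ Real.exp (Real.log (1 - s)⁻¹ * scale n) := by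
    rw [← Real.rpow_natCast, Real.rpow_def_of_pos (by linarith)]
    have := Real.log_nonneg hR
    gcongr
  have hd := polyDegree_le n
  calc (((numSamples n + 1 : ℕ) : ℝ))⁻¹ *
        (2 * Real.exp 1 * (polyDegree n : ℝ) ^ 2 * ((1 - s)⁻¹) ^ L n)
      ≤ Real.exp (-scale n ^ 2) * (2 * Real.exp 1 * (scale n ^ 4 + 1) ^ 2 *
        Real.exp (Real.log (1 - s)⁻¹ * scale n)) := by gcongr
    _ = 2 * Real.exp 1 * (scale n ^ 4 + 1) ^ 2 *
        Real.exp (Real.log (1 - s)⁻¹ * scale n - scale n ^ 2) := by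
      rw [sub_eq_neg_add (Real.log (1 - s)⁻¹ * scale n), Real.exp_add]; ring

/-! ### The reduction from recovery to detection -/

/-- Stated for a general filter so that it serves the full sequence as well as subsequences. Half of
the gap `δ` is spent on raising the strength, the other half keeps the new strength away from one.
-/
theorem not_weaklyRecovers {F : Filter ℕ} (hF : F ≤ atTop) {δ : ℝ} (hδ : 0 < δ) {L : ℕ → ℕ}
    (hL : ∀ᶠ n in atTop, (L n : ℝ) ≤ scale n) {lam : ℕ → ℝ}
    (hlam : ∀ n, 0 ≤ lam n ∧ lam n < 1 - δ) {ℓ : ∀ n, Fin (L n)} (hheur : LowDegreeHeuristic F L)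
    {p : Prog} {T : ℕ → ℕ} (hT : ∀ᶠ n in F, (T n : ℝ) ≤ Real.exp (scale n)) :
    ¬ WeaklyRecovers F L lam ℓ p T := by
  rintro ⟨X, hX, hrun, c₀, hc₀, hcorr₀⟩
  -- Lowering `c` keeps the error bound `1 - c / 2` nonnegative.
  obtain ⟨c, hc, hc2, hcorr⟩ : ∃ c : ℝ, 0 < c ∧ c ≤ 2 ∧
      ∀ᶠ n in F, c ≤ expectedCorrelation (lam n) (ℓ n) (X n (ℓ n)) :=
    ⟨min c₀ 2, by positivity, min_le_right _ _, hcorr₀.mono fun n h => (min_le_left _ _).trans h⟩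
  have hd : 0 < δ / 2 := by positivity
  have hlam' : ∀ n, 0 ≤ lam n + δ / 2 ∧ lam n + δ / 2 < 1 - δ / 2 := fun n =>
    ⟨by linarith [(hlam n).1], by linarith [(hlam n).2]⟩
  obtain ⟨C, hC, hno⟩ := hheur (fun n => lam n + δ / 2) (fun n => numSamples n + 1) polyDegree
    ⟨δ / 2, hd, hlam'⟩ (fun n => by omega)
    ((tendsto_lowDegAdv hL (by linarith) hlam').mono_left hF)
  refine hno ⟨testProg p (δ / 2) (c * (δ / 2) / 4), fun n => hitTest (X n)
    (lam n / (lam n + δ / 2)) (√(1 - lam n / (lam n + δ / 2) * (lam n / (lam n + δ / 2))))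
    (c * (δ / 2) / 4), fun n => measurable_hitTest (hX n) _ _ _, ?_, c / 4, by positivity, ?_⟩
  · filter_upwards [hrun, hT, hF hL, hF (eventually_ge_atTop 1),
      hF (tendsto_scale.eventually (eventually_time_le hC))] with n hrun hT hL hn htime Y τ
    obtain ⟨t, ht, he⟩ := eval_testProg (d := δ / 2) (r := c * (δ / 2) / 4) hrun Y τ
    refine ⟨t, ?_, he.of_eq ?_⟩
    · have hsc := scale_nonneg n
      have hdim : 1 < hiddenDim (numSamples n + 1) (L n) n := by
        have h1 : (1 : ℝ) ≤ numSamples n :=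
          (Real.one_le_exp (by positivity)).trans (exp_le_numSamples n)
        have h2 : (1 : ℝ) ≤ L n := by exact_mod_cast (ℓ n).pos
        have h3 : (1 : ℝ) ≤ (n : ℝ) ^ 2 := one_le_pow₀ (by exact_mod_cast hn)
        have h4 : (1 : ℝ) ≤ L n * (n : ℝ) ^ 2 := one_le_mul_of_one_le_of_one_le h2 h3
        unfold hiddenDim
        push_cast
        nlinarith
      have hlog := Real.log_pos hdim
      -- Since the dimension exceeds one, its logarithm cancels and the allowed time is `exp (D /
      -- C)`, whatever the dimension.
      have e : hiddenDim (numSamples n + 1) (L n) n ^ ((polyDegree n : ℝ) /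
          (C * Real.log (hiddenDim (numSamples n + 1) (L n) n))) =
          Real.exp ((polyDegree n : ℝ) / C) := by
        rw [Real.rpow_def_of_pos (by linarith)]
        congr 1
        field_simp
      rw [e]
      have hD : scale n ^ 4 / C ≤ (polyDegree n : ℝ) / C :=
        div_le_div_of_nonneg_right (Nat.le_ceil _) hC.le
      refine le_trans ?_ (htime.trans (Real.exp_le_exp.2 hD))
      have ht' : (t : ℝ) ≤ numSamples n * (L n * (T n + (n * (n * 700 + 600) + 700)) + 400) +
          200 := by exact_mod_cast ht
      refine ht'.trans ?_
      have hK := numSamples_le n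
      rw [scale_pow]
      gcongr
    · exact num_ite_eq_flag hitTest_eq_true_iff
  · have hκ : 0 < (c * (δ / 2) / 4) ^ 2 / 2 := by positivity
    filter_upwards [hcorr, hF hL,
      hF (tendsto_scale.eventually (eventually_error_le hκ (show 0 < c / 4 by positivity)))]
      with n hcorr hL herr
    refine (testError_hitTest_le (K := numSamples n) (hX n) (hlam n).1 hd hc hc2 (ℓ n) hcorr).trans ?_
    rw [scale_pow] at herr
    have hsc := scale_nonneg n
    have hK := numSamples_le n
    have h1 : ((numSamples n : ℝ) * L n + 1) * Real.exp (-((c * (δ / 2) / 4) ^ 2 * n / 2)) ≤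
        ((Real.exp (scale n ^ 2) + 1) * scale n + 1) *
          Real.exp (-((c * (δ / 2) / 4) ^ 2 / 2 * n)) := by
      rw [show (c * (δ / 2) / 4) ^ 2 * n / 2 = (c * (δ / 2) / 4) ^ 2 / 2 * n by ring]
      gcongr
    have h2 : ((numSamples n : ℝ) + 1)⁻¹ ≤ Real.exp (-scale n ^ 2) := by
      rw [Real.exp_neg]
      refine inv_anti₀ (Real.exp_pos _) ((exp_le_numSamples n).trans ?_)
      linarith
    linarith

theorem WeaklyRecovers.mono {F G : Filter ℕ} (h : F ≤ G) {L : ℕ → ℕ} {lam : ℕ → ℝ}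
    {ℓ : ∀ n, Fin (L n)} {p : Prog} {T : ℕ → ℕ} (hG : WeaklyRecovers G L lam ℓ p T) :
    WeaklyRecovers F L lam ℓ p T := by
  obtain ⟨X, hX, hrun, c, hc, hcorr⟩ := hG
  exact ⟨X, hX, h hrun, c, hc, h hcorr⟩

end AngularSync

end

/-! ### Conclusion for the full sequence and for subsequences. -/

theorem mainTheorem5 :
    ∃ ε : ℝ, 0 < ε ∧
      ∀ (δ : ℝ) (_ : 0 < δ)
        -- the number of frequencies is `n ^ o(1)`
        (L : ℕ → ℕ) (_ : ∀ η : ℝ, 0 < η → ∀ᶠ n : ℕ in atTop, (L n : ℝ) ≤ (n : ℝ) ^ η)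
        (lam : ℕ → ℝ) (_ : ∀ n, 0 ≤ lam n ∧ lam n < 1 - δ)
        (ℓ : ∀ n, Fin (L n)),
        -- under the heuristic, there is no weak recovery in time `exp (n ^ ε)`
        (AngularSync.LowDegreeHeuristic atTop L →
          ∀ (p : AngularSync.Prog) (T : ℕ → ℕ),
            AngularSync.WeaklyRecovers atTop L lam ℓ p T →
            ∃ᶠ n : ℕ in atTop, Real.exp ((n : ℝ) ^ ε) < (T n : ℝ)) ∧
        -- under the heuristic along all subsequences, the bound holds for all large `n`
        ((∀ S : Set ℕ, S.Infinite → AngularSync.LowDegreeHeuristic (atTop ⊓ 𝓟 S) L) →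
          ∀ (p : AngularSync.Prog) (T : ℕ → ℕ),
            AngularSync.WeaklyRecovers atTop L lam ℓ p T →
            ∀ᶠ n : ℕ in atTop, Real.exp ((n : ℝ) ^ ε) < (T n : ℝ)) := by
  refine ⟨1 / 8, by norm_num, fun δ hδ L hL lam hlam ℓ => ⟨fun hheur p T hrec => ?_,
    fun hheur p T hrec => ?_⟩⟩
  · intro hT
    exact AngularSync.not_weaklyRecovers le_rfl hδ (hL _ (by norm_num)) hlam hheur
      (hT.mono fun n h => not_lt.1 h) hrec
  · by_contra hT
    -- If the bound fails for arbitrarily large `n`, the algorithm is fast along this infinite set,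
    -- and the heuristic is applied along it.
    have hS : {n : ℕ | ¬ Real.exp ((n : ℝ) ^ (1 / 8 : ℝ)) < (T n : ℝ)}.Infinite :=
      Nat.frequently_atTop_iff_infinite.1 (not_eventually.1 hT)
    exact AngularSync.not_weaklyRecovers inf_le_left hδ (hL _ (by norm_num)) hlam (hheur _ hS)
      (eventually_inf_principal.2 (Eventually.of_forall fun n h => not_lt.1 h))
      (hrec.mono inf_le_left)
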